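/- Let $0<a<b$ and let $P$ be the elliptic paraboloid $z=\frac{ax^2+by^2}{2}$ in $\mathbb R^3$. The normal of $P$ at $B=(x,y,z)\in P$ is the line through $B$ with direction $\vec N=(-ax,-by,1)$, and $\nu(A)$ denotes the number of distinct normals of $P$ that pass through the point $A$. Let $$H=\frac{a+b+a^2bx^2+ab^2y^2}{2(1+a^2x^2+b^2y^2)^{3/2}},\qquad K=\frac{ab}{(1+a^2x^2+b^2y^2)^2}$$ be the mean and Gaussian curvatures of $P$ at $B$. The two caustics of $P$ are the sets of centers of principal curvature: the inner caustic $C_{\rm in}=\{B+R_{\rm in}\vec N/|\vec N| : B\in P\}$ and the outer caustic $C_{\rm out}=\{B+R_{\rm out}\vec N/|\vec N| : B\in P\}$, where $R_{\rm in}=1/(H+\sqrt{H^2-K})$ and $R_{\rm out}=1/(H-\sqrt{H^2-K})$. A point $A$ is below (above) a set $C$ if $C$ has a point with the same $x$- and $y$-coordinates as $A$ and with a larger (smaller) $z$-coordinate. A point is called lower if it is below both caustics, upper if it is above both, and middle if it is above one of them and below the other. The intersection curves are $\gamma_{\rm in}=P\cap C_{\rm in}$ and $\gamma_{\rm out}=P\cap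 C_{\rm out}$, and the regions are the connected components of $P\setminus(\gamma_{\rm in}\cup\gamma_{\rm out})$. A curve means a finite nonempty union of continuous injective images of nondegenerate intervals. Put $$E_1=(p,q,r),\quad E_2=(-p,-q,r),\quad E_3=(p,-q,r),\quad E_4=(-p,q,r),$$ $$p=\tfrac{2\sqrt2(b-a)(b-3a)}{a(a+b)^2},\qquad q=\tfrac{2\sqrt2(b-a)(3b-a)}{b(a+b)^2},\qquad r=\tfrac{4(a-b)^2}{ab(a+b)},$$ and, with the sign $+$ for $i=1$ and $-$ for $i=2$, $F_i=\left(0,\pm\tfrac{2\sqrt2}{b},\tfrac4b\right)$, $H_i=\left(0,\pm\sqrt{\tfrac{(b-a)^3}{a^3b^2}},\tfrac{3b-a}{2ab}\right)$ and, if $b>2a$, $G_i=\left(0,\pm\sqrt{\tfrac{2(a-b)^2}{ab^2(b-2a)}},\tfrac{(a-b)^2}{ab(b-2a)}\right)$. 1. If $a<b\le 2a$, then $\gamma_{\rm in}=\emptyset$, while $\gamma_{\rm out}$ is a connected curve. There are exactly 2 regions. All points of one region are lower and have $\nu=1$; all points of the other are above $C_{\rm out}$ and below $C_{\rm in}$ and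 have $\nu=3$. On $\gamma_{\rm out}$, $\nu=2$. 2. If $2a<b<3a$, then $\gamma_{\rm in}$ and $\gamma_{\rm out}$ are curves and there are exactly 4 regions. Each region consists either of lower points with $\nu=1$, or of middle points with $\nu=3$, or of upper points with $\nu=5$, and all three kinds of regions occur. All points of $\gamma_{\rm out}$ are below $C_{\rm in}$ and have $\nu=2$. All points of $\gamma_{\rm in}$ are above $C_{\rm out}$ and have $\nu=4$, except the points $G_1,G_2\in\gamma_{\rm in}$, where $\nu=3$. 3. If $b=3a$, then $\gamma_{\rm in}$ and $\gamma_{\rm out}$ are curves that meet in exactly the two points $E_1\ne E_2$, where $E_1=E_4=F_1=G_1=H_1$ and $E_2=E_3=F_2=G_2=H_2$. There are exactly 5 regions, each consisting of lower points with $\nu=1$, of middle points with $\nu=3$, or of upper points with $\nu=5$, and all three kinds occur. Apart from the points $E_i$, all points of $\gamma_{\rm out}$ are below $C_{\rm in}$ and have $\nu=2$, and all points of $\gamma_{\rm in}$ are above $C_{\rm out}$ and have $\nu=4$. At the points $E_i$, $\nu=2$. 4. If $3a<b$, then $\gamma_{\rm in}$ and $\gamma_{\rm out}$ are curves that meet in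 exactly the four distinct points $E_1,E_2,E_3,E_4$. There are exactly 7 regions, each consisting of lower points with $\nu=1$, of middle points with $\nu=3$, or of upper points with $\nu=5$, and all three kinds occur. A point of $\gamma_{\rm in}\cup\gamma_{\rm out}$ other than $E_1,\dots,E_4,G_1,G_2$ either is on one caustic and below the other, with $\nu=2$, or is on one caustic and above the other, with $\nu=4$; both possibilities occur. At $E_1,E_2,E_3,E_4$, $\nu=3$. The points $G_1,G_2$ are on $\gamma_{\rm out}$ and above $C_{\rm in}$, and $\nu=3$ there. -/

import Mathlib

noncomputable section

namespace Paraboloid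

/-- Euclidean space of dimension three; the coordinates `x, y, z` of `A` are `A 0, A 1, A 2`. -/
abbrev Space : Type := EuclideanSpace ℝ (Fin 3)

/-- The elliptic paraboloid `z = (a x² + b y²) / 2`. -/
def surface (a b : ℝ) : Set Space :=
  {A | A 2 = (a * A 0 ^ 2 + b * A 1 ^ 2) / 2}

/-! ### Normals -/

/-- The inner normal vector `(-a x, -b y, 1)` of the paraboloid at its point `B = (x, y, z)`. -/
def normalVector (a b : ℝ) (B : Space) : Space := !₂[-(a * B 0), -(b * B 1), 1]

/-- The normal of the paraboloid at `B`: the line through `B` along the normal vector. -/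
def normalLine (a b : ℝ) (B : Space) : AffineSubspace ℝ Space :=
  AffineSubspace.mk' B (Submodule.span ℝ {normalVector a b B})

/-- The number of (distinct) normals of the paraboloid that pass through `A`. -/
def normalCount (a b : ℝ) (A : Space) : ℕ :=
  Set.ncard {L : AffineSubspace ℝ Space | ∃ B ∈ surface a b, L = normalLine a b B ∧ A ∈ L}

/-! ### Caustics: the two sheets of centers of principal curvature -/

/-- Mean curvature of the paraboloid at `B`, with respect to the inner normal. -/
def meanCurvature (a b : ℝ) (B : Space) : ℝ :=
  (a + b + a ^ 2 * b * B 0 ^ 2 + a * b ^ 2 * B 1 ^ 2) /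
    (2 * Real.sqrt (1 + a ^ 2 * B 0 ^ 2 + b ^ 2 * B 1 ^ 2) ^ 3)

/-- Gaussian curvature of the paraboloid at `B`. -/
def gaussCurvature (a b : ℝ) (B : Space) : ℝ :=
  a * b / (1 + a ^ 2 * B 0 ^ 2 + b ^ 2 * B 1 ^ 2) ^ 2

/-- The smaller principal radius of curvature `1 / (H + √(H² - K))`. -/
def smallRadius (a b : ℝ) (B : Space) : ℝ :=
  1 / (meanCurvature a b B + Real.sqrt (meanCurvature a b B ^ 2 - gaussCurvature a b B))

/-- The larger principal radius of curvature `1 / (H - √(H² - K))`. -/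
def largeRadius (a b : ℝ) (B : Space) : ℝ :=
  1 / (meanCurvature a b B - Real.sqrt (meanCurvature a b B ^ 2 - gaussCurvature a b B))

/-- The point at signed distance `R` from `B` along the unit inner normal. -/
def centerAt (a b : ℝ) (B : Space) (R : ℝ) : Space :=
  B + (R / ‖normalVector a b B‖) • normalVector a b B

/-- The caustic formed by the centers of curvature for the smaller principal radius. -/
def innerCaustic (a b : ℝ) : Set Space :=
  {A | ∃ B ∈ surface a b, A = centerAt a b B (smallRadius a b B)}

/-- The caustic formed by the centers of curvature for the larger principal radius. -/
def outerCaustic (a b : ℝ) : Set Space :=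
  {A | ∃ B ∈ surface a b, A = centerAt a b B (largeRadius a b B)}

/-! ### Position with respect to the caustics -/

/-- `A` is vertically below the set `C`. -/
def Below (A : Space) (C : Set Space) : Prop :=
  ∃ B ∈ C, B 0 = A 0 ∧ B 1 = A 1 ∧ A 2 < B 2

/-- `A` is vertically above the set `C`. -/
def Above (A : Space) (C : Set Space) : Prop :=
  ∃ B ∈ C, B 0 = A 0 ∧ B 1 = A 1 ∧ B 2 < A 2

/-- `A` is below both caustics. -/
def Lower (a b : ℝ) (A : Space) : Prop :=
  Below A (innerCaustic a b) ∧ Below A (outerCaustic a b)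

/-- `A` is between the two caustics, whichever of them is the higher one there. -/
def Middle (a b : ℝ) (A : Space) : Prop :=
  (Above A (innerCaustic a b) ∧ Below A (outerCaustic a b)) ∨
    (Below A (innerCaustic a b) ∧ Above A (outerCaustic a b))

/-- `A` is above both caustics. -/
def Upper (a b : ℝ) (A : Space) : Prop :=
  Above A (innerCaustic a b) ∧ Above A (outerCaustic a b)

/-- `A` is on one of the caustics and below the other one. -/
def OnLowerPart (a b : ℝ) (A : Space) : Prop :=
  (A ∈ innerCaustic a b ∧ Below A (outerCaustic a b)) ∨
    (A ∈ outerCaustic a b ∧ Below A (innerCaustic a b))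

/-- `A` is on one of the caustics and above the other one. -/
def OnUpperPart (a b : ℝ) (A : Space) : Prop :=
  (A ∈ innerCaustic a b ∧ Above A (outerCaustic a b)) ∨
    (A ∈ outerCaustic a b ∧ Above A (innerCaustic a b))

/-! ### Intersection curves and regions -/

/-- The intersection of the paraboloid with the inner caustic. -/
def innerCurve (a b : ℝ) : Set Space := surface a b ∩ innerCaustic a b

/-- The intersection of the paraboloid with the outer caustic. -/
def outerCurve (a b : ℝ) : Set Space := surface a b ∩ outerCaustic a b

/-- A curve: a finite, nonempty union of continuous injective images of nondegenerate
intervals of the real line (open, closed or half-open, bounded or not). -/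
def IsCurve (S : Set Space) : Prop :=
  ∃ (k : ℕ) (I : Fin k → Set ℝ) (γ : Fin k → ℝ → Space), 0 < k ∧
    (∀ i, (I i).OrdConnected ∧ (I i).Nontrivial ∧
      ContinuousOn (γ i) (I i) ∧ Set.InjOn (γ i) (I i)) ∧
    S = ⋃ i, γ i '' I i

/-- The regions into which the intersection curves divide the paraboloid: the connected
components of the paraboloid with the intersection curves removed. -/
def regions (a b : ℝ) : Set (Set Space) :=
  {R | ∃ A ∈ surface a b \ (innerCurve a b ∪ outerCurve a b),
    R = connectedComponentIn (surface a b \ (innerCurve a b ∪ outerCurve a b)) A}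

/-- All points of `R` have the position `pos`, and through each of them pass exactly
`k` normals. -/
def IsRegionWith (a b : ℝ) (R : Set Space) (pos : Space → Prop) (k : ℕ) : Prop :=
  ∀ A ∈ R, pos A ∧ normalCount a b A = k

/-- Every region is a lower region with 1 normal, a middle region with 3 normals, or an upper
region with 5 normals, and all three kinds occur. -/
def RegionsOneThreeFive (a b : ℝ) : Prop :=
  (∀ R ∈ regions a b, IsRegionWith a b R (Lower a b) 1 ∨
    IsRegionWith a b R (Middle a b) 3 ∨ IsRegionWith a b R (Upper a b) 5) ∧
  (∃ R ∈ regions a b, IsRegionWith a b R (Lower a b) 1) ∧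
  (∃ R ∈ regions a b, IsRegionWith a b R (Middle a b) 3) ∧
  (∃ R ∈ regions a b, IsRegionWith a b R (Upper a b) 5)

/-! ### Special points; the arguments `σ`, `τ` are signs `1` or `-1` -/

/-- `E₁, E₂, E₃, E₄` are obtained from `(σ, τ) = (1, 1), (-1, -1), (1, -1), (-1, 1)`. -/
def pointE (a b σ τ : ℝ) : Space :=
  !₂[σ * (2 * Real.sqrt 2 * (b - a) * (b - 3 * a) / (a * (a + b) ^ 2)),
    τ * (2 * Real.sqrt 2 * (b - a) * (3 * b - a) / (b * (a + b) ^ 2)),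
    4 * (a - b) ^ 2 / (a * b * (a + b))]

/-- `F₁, F₂` are obtained from `τ = 1, -1`. -/
def pointF (b τ : ℝ) : Space := !₂[0, τ * (2 * Real.sqrt 2 / b), 4 / b]

/-- `G₁, G₂` are obtained from `τ = 1, -1`; used for `b > 2 a`. -/
def pointG (a b τ : ℝ) : Space :=
  !₂[0, τ * Real.sqrt (2 * (a - b) ^ 2 / (a * b ^ 2 * (b - 2 * a))),
    (a - b) ^ 2 / (a * b * (b - 2 * a))]

/-- `H₁, H₂` are obtained from `τ = 1, -1`. -/
def pointH (a b τ : ℝ) : Space :=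
  !₂[0, τ * Real.sqrt ((b - a) ^ 3 / (a ^ 3 * b ^ 2)), (3 * b - a) / (2 * a * b)]

end Paraboloid

end

namespace Paraboloid

open Filter Topology

/-! Fix a point of the paraboloid over `v = (p, q)`. Away from the asymptotes `t = 1/a` and `t =
1/b`, the normal whose foot is `(p/(1-at), q/(1-bt))` crosses the vertical line over `v` at the
height `height a b v t`. By `height_sub`, this height minus that of the given point is `t * (1 -
rate a b v t)`. The value `t = 0` is the point's own normal; every other normal solves `rate = 1`,
and there are none with `t < 0` or `0 < t < 1/b`. For fixed `t` the rate is a quadratic form in `v`.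

Between consecutive asymptotes the height is convex in `t`, and its critical points are exactly the
centers of curvature: the equation for a vanishing slope, with denominators cleared, is the equation
of `AreCenters`. Hence over each `v` the inner caustic has the minimal height for `t` in `(1/b,
1/a)`, and the outer caustic the minimal height for `t > 1/a`. Since `t > 0` there, a point is
below, on or above a caustic according as the supremum of the rates over that interval is less than,
equal to or greater than 1 (`describesCaustic`). By strict convexity the same trichotomy gives 0, 1
or 2 normals from that interval, so that ν is 1 plus two such contributions.

This count can fail only on the plane `x = 0`, where the pole at `t = 1/a` disappears and the value
`t = 1/a` may carry a symmetric pair of normals. The pair merges into one in-plane normal exactly at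
the points `G`, which lowers ν there (`feet_axis`, `normalCount_axis`).

Everything is thereby reduced to two continuous functions, `innerForm` and `outerForm`, homogeneous
of degree 2, whose level sets at 1 are the curves. The outer form is positive off the origin. The
inner form is nonpositive for `b ≤ 2a`, and positive near the `q`-axis directions for `b > 2a`. On
the `q`-axis the profile is maximal at `bt = 3`, which belongs to the outer interval for `b < 3a`
and to the inner one for `b > 3a`; this is the origin of the threshold `3a`.

The two forms can agree off the `q`-axis only if a monic quartic in `t` has one double root in each
interval, hence is a perfect square. Comparing values and derivatives at `1/a` and `1/b` gives `b >
3a` and the points `E` (`double_tangency`, `crossing`). So the order of the forms is constant on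
wedges bounded by the rays through the `E`, and it is read off on a coordinate axis. Homogeneity
turns each region into a radial image of a cone times an interval, or a star-shaped set; this gives
connectedness and the number of regions. -/

/-- The profile `(τ - 2) / (2 (τ - 1)²)`, whose maximum `1/8` is attained at `τ = 3`. -/
noncomputable def profile (τ : ℝ) : ℝ := (τ - 2) / (2 * (τ - 1) ^ 2)

/-- The quadratic form in `v = (p, q)` which is `1` exactly if the foot with parameter `t ≠ 0`
belongs to a normal through the point of the paraboloid over `v`. -/
noncomputable def rate (a b : ℝ) (v : ℝ × ℝ) (t : ℝ) : ℝ :=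
  a ^ 2 * v.1 ^ 2 * profile (a * t) + b ^ 2 * v.2 ^ 2 * profile (b * t)

/-- The supremum of the quadratic forms `rate` over a set of parameters. -/
noncomputable def envelope (a b : ℝ) (T : Set ℝ) (v : ℝ × ℝ) : ℝ := sSup (rate a b v '' T)

/-- The height over `v` of the normal whose foot has parameter `t`. -/
noncomputable def height (a b : ℝ) (v : ℝ × ℝ) (t : ℝ) : ℝ :=
  t + (a * v.1 ^ 2 / (1 - a * t) ^ 2 + b * v.2 ^ 2 / (1 - b * t) ^ 2) / 2

/-- The derivative of `height`. -/
noncomputable def heightSlope (a b : ℝ) (v : ℝ × ℝ) (t : ℝ) : ℝ :=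
  1 + a ^ 2 * v.1 ^ 2 / (1 - a * t) ^ 3 + b ^ 2 * v.2 ^ 2 / (1 - b * t) ^ 3

/-! ### Bounds and monotonicity of the profile -/

/-- The difference `1/8 - profile τ` is `(τ-3)² / (8(τ-1)²)`. At the pole `τ = 1` division by zero
gives the value 0, so no exception is needed. -/
theorem profile_le (τ : ℝ) : profile τ ≤ 1 / 8 := by
  unfold profile
  rcases eq_or_ne τ 1 with rfl | h
  · norm_num
  · have : 0 < (τ - 1) ^ 2 := by have := sub_ne_zero.2 h; positivity
    rw [div_le_div_iff₀ (by positivity) (by norm_num)]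
    nlinarith [sq_nonneg (τ - 3)]

theorem profile_nonpos {τ : ℝ} (h : τ ≤ 2) : profile τ ≤ 0 :=
  div_nonpos_of_nonpos_of_nonneg (by linarith) (by positivity)

theorem profile_pos {τ : ℝ} (h : 2 < τ) : 0 < profile τ :=
  div_pos (by linarith) (by have : 0 < τ - 1 := by linarith
                            positivity)

theorem profile_neg {τ : ℝ} (h : τ < 1) : profile τ < 0 :=
  div_neg_of_neg_of_pos (by linarith) (by have : 0 < (τ - 1) ^ 2 := sq_pos_of_neg (by linarith)
                                          positivity)

theorem profile_three : profile 3 = 1 / 8 := by norm_num [profile]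

theorem profile_lt {τ : ℝ} (h : τ ≠ 3) : profile τ < 1 / 8 := by
  unfold profile
  rcases eq_or_ne τ 1 with rfl | h1
  · norm_num
  · have : 0 < (τ - 1) ^ 2 := by have := sub_ne_zero.2 h1; positivity
    have : 0 < (τ - 3) ^ 2 := by have := sub_ne_zero.2 h; positivity
    rw [div_lt_div_iff₀ (by positivity) (by norm_num)]
    nlinarith

theorem profile_mono {τ σ : ℝ} (h1 : 1 < τ) (h : τ ≤ σ) (h3 : σ ≤ 3) :
    profile τ ≤ profile σ := by
  unfold profile
  have hw : 0 < τ - 1 := by linarith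
  have hz : 0 < σ - 1 := by linarith
  rw [div_le_div_iff₀ (by positivity) (by positivity)]
  -- With `w = τ - 1` and `z = σ - 1`, the cross-multiplied difference is `(z-w)(z+w-zw)`, and
  -- `z+w-zw = 1-(1-z)(1-w)` is nonnegative for `z, w` in `(0, 2]`. In `profile_anti` both exceed 2
  -- or equal it, and the sign is reversed.
  have key : 0 ≤ (σ - τ) * ((σ - 1) + (τ - 1) - (σ - 1) * (τ - 1)) := by
    apply mul_nonneg (by linarith)
    nlinarith
  nlinarith

theorem profile_anti {τ σ : ℝ} (h3 : 3 ≤ τ) (h : τ ≤ σ) :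
    profile σ ≤ profile τ := by
  unfold profile
  have hw : 0 < τ - 1 := by linarith
  have hz : 0 < σ - 1 := by linarith
  rw [div_le_div_iff₀ (by positivity) (by positivity)]
  have key : 0 ≤ (σ - τ) * ((σ - 1) * (τ - 1) - ((σ - 1) + (τ - 1))) := by
    apply mul_nonneg (by linarith)
    nlinarith
  nlinarith

theorem continuousAt_profile {τ : ℝ} (h : τ ≠ 1) : ContinuousAt profile τ := by
  unfold profile
  have : 2 * (τ - 1) ^ 2 ≠ 0 := by have := sub_ne_zero.2 h; positivity
  fun_prop (disch := assumption)

/-! ### Suprema of the quadratic forms, and convexity of the height -/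

section Envelope

variable {a b : ℝ} {T : Set ℝ} {v : ℝ × ℝ}

theorem rate_le (a b : ℝ) (v : ℝ × ℝ) (t : ℝ) :
    rate a b v t ≤ (a ^ 2 * v.1 ^ 2 + b ^ 2 * v.2 ^ 2) / 8 := by
  unfold rate
  have h1 := mul_le_mul_of_nonneg_left (profile_le (a * t))
    (by positivity : 0 ≤ a ^ 2 * v.1 ^ 2)
  have h2 := mul_le_mul_of_nonneg_left (profile_le (b * t))
    (by positivity : 0 ≤ b ^ 2 * v.2 ^ 2)
  linarith

theorem bddAbove_rate (a b : ℝ) (T : Set ℝ) (v : ℝ × ℝ) : BddAbove (rate a b v '' T) :=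
  ⟨_, by rintro _ ⟨t, -, rfl⟩; exact rate_le a b v t⟩

theorem rate_le_envelope {t : ℝ} (ht : t ∈ T) : rate a b v t ≤ envelope a b T v :=
  le_csSup (bddAbove_rate a b T v) ⟨t, ht, rfl⟩

theorem envelope_le (hT : T.Nonempty) {c : ℝ} (h : ∀ t ∈ T, rate a b v t ≤ c) :
    envelope a b T v ≤ c :=
  csSup_le (hT.image _) (by rintro _ ⟨t, ht, rfl⟩; exact h t ht)

theorem exists_lt_rate (hT : T.Nonempty) {c : ℝ} (h : c < envelope a b T v) :
    ∃ t ∈ T, c < rate a b v t := by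
  obtain ⟨_, ⟨t, ht, rfl⟩, h⟩ := exists_lt_of_lt_csSup (hT.image _) h
  exact ⟨t, ht, h⟩

theorem rate_smul (a b c : ℝ) (v : ℝ × ℝ) (t : ℝ) :
    rate a b (c • v) t = c ^ 2 * rate a b v t := by
  simp only [rate, Prod.smul_fst, Prod.smul_snd, smul_eq_mul]; ring

theorem envelope_smul (hT : T.Nonempty) (c : ℝ) (v : ℝ × ℝ) :
    envelope a b T (c • v) = c ^ 2 * envelope a b T v := by
  have key : ∀ (c : ℝ) (v : ℝ × ℝ), envelope a b T (c • v) ≤ c ^ 2 * envelope a b T v :=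
    fun c v => envelope_le hT fun t ht => by
      rw [rate_smul]
      exact mul_le_mul_of_nonneg_left (rate_le_envelope ht) (sq_nonneg c)
  rcases eq_or_ne c 0 with rfl | hc
  · obtain ⟨t, ht⟩ := hT
    refine le_antisymm (key _ _) ?_
    have := rate_le_envelope (a := a) (b := b) (v := (0 : ℝ) • v) ht
    rw [rate_smul] at this
    linarith
  · refine le_antisymm (key _ _) ?_
    have := key c⁻¹ (c • v)
    rw [smul_smul, inv_mul_cancel₀ hc, one_smul, inv_pow] at this
    have hc2 : 0 < c ^ 2 := by positivity
    calc _ ≤ c ^ 2 * ((c ^ 2)⁻¹ * envelope a b T (c • v)) := by gcongr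
      _ = _ := by field_simp

/-- A supremum of continuous functions is lower semicontinuous. For the upper bound the forms are
not equicontinuous, since the profile tends to `-∞` at the asymptotes; only its upper bound `1/8` is
available, so it may be applied only to increments with nonnegative coefficients. -/
theorem continuous_envelope (hT : T.Nonempty) : Continuous (envelope a b T) := by
  refine continuous_iff_continuousAt.2 fun v => tendsto_order.2 ⟨fun y hy => ?_, fun y hy => ?_⟩
  · obtain ⟨t, ht, h⟩ := exists_lt_rate hT hy
    have hc : ContinuousAt (fun w => rate a b w t) v := by unfold rate; fun_prop
    filter_upwards [hc.eventually (lt_mem_nhds h)] with w hw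
    exact hw.trans_le (rate_le_envelope ht)
  -- Write each squared coordinate of a nearby `w` as `c` times that of `v` plus a remainder. A
  -- factor `c < 1` makes the remainder nonnegative near `v`, so that it contributes at most an
  -- eighth; the rest is at most `c` times the envelope at `v`.
  · obtain ⟨c, ⟨hc0, hc1⟩, hcy⟩ : ∃ c ∈ Set.Ioo (0 : ℝ) 1, c * envelope a b T v +
        (a ^ 2 * (v.1 ^ 2 - c * v.1 ^ 2) + b ^ 2 * (v.2 ^ 2 - c * v.2 ^ 2)) / 8 < y := by
      have hcont : ContinuousAt (fun c : ℝ => c * envelope a b T v +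
        (a ^ 2 * (v.1 ^ 2 - c * v.1 ^ 2) + b ^ 2 * (v.2 ^ 2 - c * v.2 ^ 2)) / 8) 1 := by fun_prop
      have hlt := hcont.eventually (gt_mem_nhds (by simpa using hy))
      have := (hlt.filter_mono nhdsWithin_le_nhds).and
        (Ioo_mem_nhdsLT (show (0 : ℝ) < 1 by norm_num))
      obtain ⟨c, h1, h2⟩ := this.exists
      exact ⟨c, h2, h1⟩
    have hcont : ContinuousAt (fun w : ℝ × ℝ => c * envelope a b T v +
        (a ^ 2 * (w.1 ^ 2 - c * v.1 ^ 2) + b ^ 2 * (w.2 ^ 2 - c * v.2 ^ 2)) / 8) v := by fun_prop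
    have hsq : ∀ (f : ℝ × ℝ → ℝ), Continuous f → ∀ᶠ w in nhds v, c * f v ^ 2 ≤ f w ^ 2 := by
      intro f hf
      rcases eq_or_ne (f v) 0 with h0 | h0
      · exact Filter.Eventually.of_forall fun w => by rw [h0]; simp [sq_nonneg]
      · have : c * f v ^ 2 < f v ^ 2 := by
          have : 0 < f v ^ 2 := by positivity
          nlinarith
        have hc2 : ContinuousAt (fun w => f w ^ 2) v := (hf.pow 2).continuousAt
        exact (hc2.eventually (lt_mem_nhds this)).mono fun w hw => hw.le
    filter_upwards [hcont.eventually (gt_mem_nhds hcy), hsq _ continuous_fst,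
      hsq _ continuous_snd] with w hw h1 h2
    refine lt_of_le_of_lt (envelope_le hT fun t ht => ?_) hw
    have e1 := mul_le_mul_of_nonneg_left (profile_le (a * t))
      (mul_nonneg (sq_nonneg a) (sub_nonneg.2 h1))
    have e2 := mul_le_mul_of_nonneg_left (profile_le (b * t))
      (mul_nonneg (sq_nonneg b) (sub_nonneg.2 h2))
    have e3 := mul_le_mul_of_nonneg_left (rate_le_envelope (a := a) (b := b) (v := v) ht) hc0.le
    unfold rate at e3 ⊢
    linarith

/-- A vanishing coordinate cancels the pole of its own term. This permits evaluation at an asymptote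
on the coordinate axes, where minima of the height may sit. -/
theorem continuousAt_rate {t : ℝ} (h1 : v.1 = 0 ∨ a * t ≠ 1) (h2 : v.2 = 0 ∨ b * t ≠ 1) :
    ContinuousAt (rate a b v) t := by
  unfold rate
  have key : ∀ c x : ℝ, x = 0 ∨ c * t ≠ 1 →
      ContinuousAt (fun t => c ^ 2 * x ^ 2 * profile (c * t)) t := by
    rintro c x (rfl | h)
    · simpa using continuousAt_const
    · have : ContinuousAt (fun t => profile (c * t)) t :=
        ContinuousAt.comp (f := fun t => c * t) (continuousAt_profile h) (by fun_prop)
      fun_prop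
  exact (key a _ h1).add (key b _ h2)

theorem rate_le_envelope_of_mem_closure {t : ℝ} (ht : t ∈ closure T)
    (h1 : v.1 = 0 ∨ a * t ≠ 1) (h2 : v.2 = 0 ∨ b * t ≠ 1) : rate a b v t ≤ envelope a b T v := by
  have hc := (continuousAt_rate h1 h2).continuousWithinAt (s := T)
  have : (nhdsWithin t T).NeBot := mem_closure_iff_nhdsWithin_neBot.1 ht
  exact le_of_tendsto hc (eventually_mem_nhdsWithin.mono fun s hs => rate_le_envelope hs)

theorem envelope_eq_rate {t : ℝ} (ht : t ∈ closure T)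
    (h1 : v.1 = 0 ∨ a * t ≠ 1) (h2 : v.2 = 0 ∨ b * t ≠ 1)
    (h : ∀ s ∈ T, rate a b v s ≤ rate a b v t) : envelope a b T v = rate a b v t :=
  le_antisymm (envelope_le (closure_nonempty_iff.1 ⟨t, ht⟩) h)
    (rate_le_envelope_of_mem_closure ht h1 h2)

/-- For each coordinate, `1/(1-ct)² - 1 = ct(2-ct)/(1-ct)²`. The common factor `t` is the trivial
solution, namely the normal at the point itself. -/
theorem height_sub {t : ℝ} (h1 : v.1 = 0 ∨ a * t ≠ 1) (h2 : v.2 = 0 ∨ b * t ≠ 1) :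
    height a b v t - (a * v.1 ^ 2 + b * v.2 ^ 2) / 2 = t * (1 - rate a b v t) := by
  have key : ∀ c x : ℝ, x = 0 ∨ c * t ≠ 1 →
      c * x ^ 2 / (1 - c * t) ^ 2 - c * x ^ 2 = -(2 * t * (c ^ 2 * x ^ 2 * profile (c * t))) := by
    rintro c x (rfl | h)
    · simp
    · unfold profile
      have h' : 1 - c * t ≠ 0 := fun h' => h (by linarith)
      have h'' : c * t - 1 ≠ 0 := fun h' => h (by linarith)
      rw [show (c * t - 1) ^ 2 = (1 - c * t) ^ 2 by ring]
      field_simp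
      ring
  have k1 := key a _ h1
  have k2 := key b _ h2
  unfold height rate
  linarith

/-- This is convexity of `n ↦ 1/n²` on a half-line, with the explicit remainder
`(m-n)²(m²+2mn)/(m²n)²`. -/
theorem inv_sq_tangent {m n : ℝ} (h : 0 < m * n) :
    1 / m ^ 2 + 2 * (m - n) / m ^ 3 ≤ 1 / n ^ 2 ∧
      (m ≠ n → 1 / m ^ 2 + 2 * (m - n) / m ^ 3 < 1 / n ^ 2) := by
  have hm : m ≠ 0 := by rintro rfl; simp at h
  have hn : n ≠ 0 := by rintro rfl; simp at h
  have e : 1 / n ^ 2 - (1 / m ^ 2 + 2 * (m - n) / m ^ 3) =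
      (m - n) ^ 2 * (m * m + 2 * (m * n)) / (m ^ 2 * n) ^ 2 := by
    field_simp
    ring
  have hmm : 0 < m * m + 2 * (m * n) := by have := mul_self_pos.2 hm
                                           linarith
  constructor
  · have := div_nonneg (mul_nonneg (sq_nonneg (m - n)) hmm.le) (sq_nonneg (m ^ 2 * n))
    linarith
  · intro hne
    have : m - n ≠ 0 := sub_ne_zero.2 hne
    have := div_pos (mul_pos (by positivity : 0 < (m - n) ^ 2) hmm)
      (by positivity : 0 < (m ^ 2 * n) ^ 2)
    linarith

theorem div_sq_tangent {c x s t : ℝ} (hc : 0 < c) (h : x = 0 ∨ 0 < (1 - c * t) * (1 - c * s)) :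
    c * x ^ 2 / (1 - c * t) ^ 2 + 2 * (c ^ 2 * x ^ 2 / (1 - c * t) ^ 3) * (s - t) ≤
        c * x ^ 2 / (1 - c * s) ^ 2 ∧
      (x ≠ 0 → s ≠ t →
        c * x ^ 2 / (1 - c * t) ^ 2 + 2 * (c ^ 2 * x ^ 2 / (1 - c * t) ^ 3) * (s - t) <
          c * x ^ 2 / (1 - c * s) ^ 2) := by
  rcases h with rfl | h
  · simp
  · obtain ⟨h1, h2⟩ := inv_sq_tangent h
    have e : c * x ^ 2 / (1 - c * t) ^ 2 + 2 * (c ^ 2 * x ^ 2 / (1 - c * t) ^ 3) * (s - t) =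
      c * x ^ 2 * (1 / (1 - c * t) ^ 2 + 2 * ((1 - c * t) - (1 - c * s)) / (1 - c * t) ^ 3) := by
      ring
    have e' : c * x ^ 2 / (1 - c * s) ^ 2 = c * x ^ 2 * (1 / (1 - c * s) ^ 2) := by ring
    rw [e, e']
    refine ⟨mul_le_mul_of_nonneg_left h1 (by positivity), fun hx hst => ?_⟩
    refine mul_lt_mul_of_pos_left (h2 fun h => hst ?_) (by positivity)
    have : c * s = c * t := by linarith
    exact mul_left_cancel₀ hc.ne' this

/-- Convexity between consecutive asymptotes, in the form of tangent lines. If a coordinate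
vanishes, its asymptote is no barrier. -/
theorem height_tangent (ha : 0 < a) (hb : 0 < b) {s t : ℝ}
    (h1 : v.1 = 0 ∨ 0 < (1 - a * t) * (1 - a * s))
    (h2 : v.2 = 0 ∨ 0 < (1 - b * t) * (1 - b * s)) :
    height a b v t + heightSlope a b v t * (s - t) ≤ height a b v s := by
  have k1 := (div_sq_tangent ha h1).1
  have k2 := (div_sq_tangent hb h2).1
  unfold height heightSlope
  nlinarith

/-- One nonvanishing coordinate already makes the inequality strict. -/
theorem height_tangent_lt (ha : 0 < a) (hb : 0 < b) {s t : ℝ}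
    (h1 : v.1 = 0 ∨ 0 < (1 - a * t) * (1 - a * s))
    (h2 : v.2 = 0 ∨ 0 < (1 - b * t) * (1 - b * s)) (hv : v.1 ≠ 0) (hst : s ≠ t) :
    height a b v t + heightSlope a b v t * (s - t) < height a b v s := by
  have k1 := (div_sq_tangent ha h1).2 hv hst
  have k2 := (div_sq_tangent hb h2).1
  unfold height heightSlope
  nlinarith

/-- `t` is a (possibly boundary) minimum of the height over `T`. -/
structure IsMinParam (a b : ℝ) (T : Set ℝ) (v : ℝ × ℝ) (t : ℝ) : Prop where
  mem : t ∈ closure T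
  fst : v.1 = 0 ∨ a * t ≠ 1
  snd : v.2 = 0 ∨ b * t ≠ 1
  le : ∀ s ∈ T, height a b v t ≤ height a b v s

end Envelope

/-- Parameters of the normals between the two asymptotes. -/
def innerParams (a b : ℝ) : Set ℝ := Set.Ioo (1 / b) (1 / a)

/-- Parameters of the normals beyond the second asymptote. -/
def outerParams (a : ℝ) : Set ℝ := Set.Ioi (1 / a)

/-! ### Minimal height compared with the envelope -/

section Link

variable {a b : ℝ} {T : Set ℝ} {v : ℝ × ℝ} {t : ℝ}

/-- For `s > 0` the sign of `height s` minus the height of the surface is that of `1 - rate s`. A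
minimum equal to the surface height therefore gives rate 1 there and rates at most 1 elsewhere. -/
theorem IsMinParam.envelope_eq_one (h : IsMinParam a b T v t) (hpos : ∀ s ∈ T, 0 < s)
    (ht0 : 0 < t) (hT : ∀ s ∈ T, a * s ≠ 1 ∧ b * s ≠ 1)
    (hh : height a b v t = (a * v.1 ^ 2 + b * v.2 ^ 2) / 2) : envelope a b T v = 1 := by
  have e := height_sub h.fst h.snd
  have e1 : rate a b v t = 1 := by
    have : t * (1 - rate a b v t) = 0 := by linarith
    rcases mul_eq_zero.1 this with h | h <;> linarith
  rw [← e1]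
  refine envelope_eq_rate h.mem h.fst h.snd fun s hs => ?_
  have := height_sub (v := v) (Or.inr (hT s hs).1) (Or.inr (hT s hs).2)
  have hle := h.le s hs
  have : 0 ≤ s * (1 - rate a b v s) := by linarith
  have := nonneg_of_mul_nonneg_right this (hpos s hs)
  linarith

theorem IsMinParam.one_lt_envelope (h : IsMinParam a b T v t) (ht0 : 0 < t)
    (hh : height a b v t < (a * v.1 ^ 2 + b * v.2 ^ 2) / 2) : 1 < envelope a b T v := by
  have e := height_sub h.fst h.snd
  have : t * (1 - rate a b v t) < 0 := by linarith
  have : 1 - rate a b v t < 0 := by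
    by_contra hcon
    push Not at hcon
    have := mul_nonneg ht0.le hcon
    linarith
  have := rate_le_envelope_of_mem_closure h.mem h.fst h.snd
  linarith

/-- A supremum of rates below 1 could still equal 1, so a positive gap `δ` of heights has to be
converted into a gap of rates. That gap is `δ / s`, which degenerates only for large `s`. -/
theorem IsMinParam.rate_le (h : IsMinParam a b T v t) (hpos : ∀ s ∈ T, 0 < s)
    (hT : ∀ s ∈ T, a * s ≠ 1 ∧ b * s ≠ 1) {δ : ℝ}
    (hh : (a * v.1 ^ 2 + b * v.2 ^ 2) / 2 + δ ≤ height a b v t) {s : ℝ} (hs : s ∈ T) :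
    rate a b v s ≤ 1 - δ / s := by
  have := height_sub (v := v) (Or.inr (hT s hs).1) (Or.inr (hT s hs).2)
  have hle := h.le s hs
  have : δ / s ≤ 1 - rate a b v s := by
    rw [div_le_iff₀ (hpos s hs)]; linarith
  linarith

end Link


/-! ### The two parameter intervals -/

section Params

variable {a b : ℝ} {v : ℝ × ℝ} {t : ℝ}

theorem mem_innerParams (ha : 0 < a) (hb : 0 < b) :
    t ∈ innerParams a b ↔ 1 < b * t ∧ a * t < 1 := by
  rw [innerParams, Set.mem_Ioo, div_lt_iff₀' hb, lt_div_iff₀' ha]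

theorem mem_outerParams (ha : 0 < a) : t ∈ outerParams a ↔ 1 < a * t := by
  rw [outerParams, Set.mem_Ioi, div_lt_iff₀' ha]

theorem one_div_lt_one_div_params (ha : 0 < a) (hab : a < b) : 1 / b < 1 / a :=
  one_div_lt_one_div_of_lt ha hab

theorem innerParams_nonempty (ha : 0 < a) (hab : a < b) : (innerParams a b).Nonempty :=
  Set.nonempty_Ioo.2 (one_div_lt_one_div_params ha hab)

theorem outerParams_nonempty (a : ℝ) : (outerParams a).Nonempty := Set.nonempty_Ioi

theorem closure_innerParams (ha : 0 < a) (hab : a < b) :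
    closure (innerParams a b) = Set.Icc (1 / b) (1 / a) :=
  closure_Ioo (one_div_lt_one_div_params ha hab).ne

theorem closure_outerParams (a : ℝ) : closure (outerParams a) = Set.Ici (1 / a) := closure_Ioi _

theorem mem_closure_innerParams (ha : 0 < a) (hab : a < b) :
    t ∈ closure (innerParams a b) ↔ 1 ≤ b * t ∧ a * t ≤ 1 := by
  rw [closure_innerParams ha hab, Set.mem_Icc, div_le_iff₀' (ha.trans hab), le_div_iff₀' ha]

theorem mem_closure_outerParams (ha : 0 < a) :
    t ∈ closure (outerParams a) ↔ 1 ≤ a * t := by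
  rw [closure_outerParams, Set.mem_Ici, div_le_iff₀' ha]

theorem pos_of_one_le_mul {c : ℝ} (hc : 0 < c) (h : 1 ≤ c * t) : 0 < t :=
  pos_of_mul_pos_right (by linarith) hc.le

theorem mul_lt_mul_params (hab : a < b) (ht : 0 < t) : a * t < b * t :=
  mul_lt_mul_of_pos_right hab ht

theorem IsMinParam.envelope_inner_lt_one (ha : 0 < a) (hab : a < b)
    (h : IsMinParam a b (innerParams a b) v t)
    (hh : (a * v.1 ^ 2 + b * v.2 ^ 2) / 2 < height a b v t) :
    envelope a b (innerParams a b) v < 1 := by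
  have hb := ha.trans hab
  set δ := height a b v t - (a * v.1 ^ 2 + b * v.2 ^ 2) / 2 with hδ
  have hδ0 : 0 < δ := by linarith
  -- The interval is bounded by `1/a`, so `δ / s ≥ δ * a`.
  refine lt_of_le_of_lt (envelope_le (c := 1 - δ * a) (innerParams_nonempty ha hab)
    fun s hs => ?_) (by nlinarith)
  have hs' := (mem_innerParams ha hb).1 hs
  have hs0 : 0 < s := pos_of_one_le_mul hb hs'.1.le
  have := h.rate_le (fun s hs => pos_of_one_le_mul hb ((mem_innerParams ha hb).1 hs).1.le)
    (fun s hs => ⟨((mem_innerParams ha hb).1 hs).2.ne, ((mem_innerParams ha hb).1 hs).1.ne'⟩)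
    (δ := δ) (by linarith) hs
  have : δ * a ≤ δ / s := by
    rw [le_div_iff₀ hs0]; nlinarith
  linarith

theorem profile_le_inv {τ : ℝ} (h : 1 < τ) : profile τ ≤ 1 / (2 * (τ - 1)) := by
  unfold profile
  have : 0 < τ - 1 := by linarith
  rw [div_le_div_iff₀ (by positivity) (by positivity)]
  nlinarith

theorem IsMinParam.envelope_outer_lt_one (ha : 0 < a) (hab : a < b)
    (h : IsMinParam a b (outerParams a) v t)
    (hh : (a * v.1 ^ 2 + b * v.2 ^ 2) / 2 < height a b v t) :
    envelope a b (outerParams a) v < 1 := by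
  have hb := ha.trans hab
  set δ := height a b v t - (a * v.1 ^ 2 + b * v.2 ^ 2) / 2 with hδ
  have hδ0 : 0 < δ := by linarith
  set W := a ^ 2 * v.1 ^ 2 + b ^ 2 * v.2 ^ 2 with hW
  have hW0 : 0 ≤ W := by positivity
  -- The interval is unbounded. For `as ≥ W + 1` the decay of the profile bounds the rate by `1/2`;
  -- for smaller `s` the gap `δ / s` is at least `δa / (1+W)`.
  refine lt_of_le_of_lt (envelope_le (c := max (1 / 2) (1 - δ * a / (1 + W)))
    (outerParams_nonempty a) fun s hs => ?_)
      (max_lt (by norm_num) (by have : 0 < δ * a / (1 + W) := by positivity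
                                linarith))
  have hs' := (mem_outerParams ha).1 hs
  have hs0 : 0 < s := pos_of_one_le_mul ha hs'.le
  have hbs := mul_lt_mul_params hab hs0
  rcases le_total (W + 1) (a * s) with hc | hc
  · refine le_max_of_le_left ?_
    have h1 : profile (a * s) ≤ 1 / (2 * (a * s - 1)) := profile_le_inv hs'
    have h2 : profile (b * s) ≤ 1 / (2 * (a * s - 1)) :=
      (profile_le_inv (hs'.trans hbs)).trans
        (one_div_le_one_div_of_le (by linarith) (by linarith))
    have e1 := mul_le_mul_of_nonneg_left h1 (by positivity : 0 ≤ a ^ 2 * v.1 ^ 2)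
    have e2 := mul_le_mul_of_nonneg_left h2 (by positivity : 0 ≤ b ^ 2 * v.2 ^ 2)
    have e3 : W * (1 / (2 * (a * s - 1))) ≤ 1 / 2 := by
      have : 0 < a * s - 1 := by linarith
      rw [mul_one_div, div_le_div_iff₀ (by positivity) (by norm_num)]
      linarith
    unfold rate
    linarith
  · refine le_max_of_le_right ?_
    have hp : ∀ s ∈ outerParams a, 1 < a * s ∧ 0 < s ∧ 1 < b * s := fun s hs => by
      have h1 := (mem_outerParams ha).1 hs
      have h0 := pos_of_one_le_mul ha h1.le
      exact ⟨h1, h0, h1.trans (mul_lt_mul_params hab h0)⟩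
    have := h.rate_le (fun s hs => (hp s hs).2.1)
      (fun s hs => ⟨(hp s hs).1.ne', (hp s hs).2.2.ne'⟩)
      (δ := δ) (by linarith) hs
    have : δ * a / (1 + W) ≤ δ / s := by
      rw [div_le_div_iff₀ (by linarith) hs0]; nlinarith
    linarith

end Params

/-- `t` and `t'` are the parameters of the two centers of curvature at the point of the paraboloid
over `(x, y)`. -/
def AreCenters (a b x y t t' : ℝ) : Prop :=
  ∀ s, (1 - a * s) * (1 - b * s) + a ^ 2 * x ^ 2 * (1 - b * s) + b ^ 2 * y ^ 2 * (1 - a * s) =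
    a * b * (s - t) * (s - t')

/-- The point with parameter `t` on the normal at the point of the paraboloid over `(x, y)`. -/
noncomputable def normalPoint (a b x y t : ℝ) : Space :=
  !₂[x * (1 - a * t), y * (1 - b * t), t + (a * x ^ 2 + b * y ^ 2) / 2]

theorem space_ext {A B : Space} (h0 : A 0 = B 0) (h1 : A 1 = B 1) (h2 : A 2 = B 2) : A = B := by
  ext i
  fin_cases i <;> assumption

/-! ### Centers of curvature as roots of a quadratic -/

section Centers

variable {a b x y t t' : ℝ}

theorem norm_normalVector (a b : ℝ) (B : Space) :
    ‖normalVector a b B‖ = Real.sqrt (1 + a ^ 2 * B 0 ^ 2 + b ^ 2 * B 1 ^ 2) := by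
  rw [EuclideanSpace.norm_eq, Fin.sum_univ_three]
  congr 1
  simp only [normalVector, Real.norm_eq_abs, sq_abs]
  simp
  ring

/-- Divided by the length of the normal vector, the principal radii become the roots of the
quadratic in `AreCenters`, which is the Jacobian determinant of `(x, y, t) ↦ normalPoint a b x y t`.
With `n` the length and `h` the numerator of the mean curvature, they are `2n²/(h ± D)`, with
product `n²/(ab)` and sum `h/(ab)`. -/
theorem radii_eq (ha : 0 < a) (hb : 0 < b) (B : Space) :
    ∃ t t', smallRadius a b B / ‖normalVector a b B‖ = t ∧
      largeRadius a b B / ‖normalVector a b B‖ = t' ∧ t ≤ t' ∧ AreCenters a b (B 0) (B 1) t t' := by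
  rw [norm_normalVector]
  unfold smallRadius largeRadius meanCurvature gaussCurvature AreCenters
  set X := a ^ 2 * B 0 ^ 2 with hX
  set Y := b ^ 2 * B 1 ^ 2 with hY
  have hX0 : 0 ≤ X := by positivity
  have hY0 : 0 ≤ Y := by positivity
  set n := Real.sqrt (1 + X + Y) with hn
  have hn0 : 0 < n := Real.sqrt_pos.2 (by positivity)
  have hn2 : n ^ 2 = 1 + X + Y := Real.sq_sqrt (by positivity)
  rw [← hn2]
  set h := a + b + a ^ 2 * b * B 0 ^ 2 + a * b ^ 2 * B 1 ^ 2 with hh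
  have hh0 : 0 < h := by positivity
  have hhX : h = b * (1 + X) + a * (1 + Y) := by rw [hh, hX, hY]; ring
  set D := Real.sqrt (h ^ 2 - 4 * a * b * n ^ 2) with hD
  have hdisc : 0 ≤ h ^ 2 - 4 * a * b * n ^ 2 := by
    -- A sum of nonnegative terms, possibly zero: at umbilics the two roots coincide, whence the
    -- weak inequality `t ≤ t'`.
    have : h ^ 2 - 4 * a * b * n ^ 2 = (b * (1 + X) - a * (1 + Y)) ^ 2 + 4 * (a * b) * (X * Y) := by
      rw [hn2, hhX]; ring
    rw [this]; positivity
  have hD0 : 0 ≤ D := Real.sqrt_nonneg _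
  have hD2 : D ^ 2 = h ^ 2 - 4 * a * b * n ^ 2 := Real.sq_sqrt hdisc
  have hpos : 0 < 4 * a * b * n ^ 2 := by positivity
  have hDh : D < h := by nlinarith
  have hsq : Real.sqrt ((h / (2 * n ^ 3)) ^ 2 - a * b / (n ^ 2) ^ 2) = D / (2 * n ^ 3) := by
    rw [show (h / (2 * n ^ 3)) ^ 2 - a * b / (n ^ 2) ^ 2 = (D / (2 * n ^ 3)) ^ 2 by
      rw [div_pow, div_pow, hD2]; field_simp; ring]
    exact Real.sqrt_sq (by positivity)
  rw [hsq]
  have hm : h - D ≠ 0 := by linarith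
  have hp : h + D ≠ 0 := by linarith
  refine ⟨2 * n ^ 2 / (h + D), 2 * n ^ 2 / (h - D), ?_, ?_, ?_, fun s => ?_⟩
  · rw [← add_div]; field_simp
  · rw [← sub_div]; field_simp
  · exact div_le_div_of_nonneg_left (by positivity) (by linarith) (by linarith)
  · have e1 : a * b * (2 * n ^ 2 / (h + D) + 2 * n ^ 2 / (h - D)) = h := by
      field_simp
      linear_combination h * hD2
    have e2 : a * b * (2 * n ^ 2 / (h + D) * (2 * n ^ 2 / (h - D))) = n ^ 2 := by
      field_simp
      linear_combination hD2
    linear_combination -hn2 - s * hhX + s * e1 - e2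

theorem AreCenters.unique {u u' : ℝ} (ha : 0 < a) (hb : 0 < b) (h : AreCenters a b x y t t')
    (hu : AreCenters a b x y u u') : t + t' = u + u' ∧ t * t' = u * u' := by
  have h0 := (h 0).symm.trans (hu 0)
  have h1 := (h 1).symm.trans (hu 1)
  have hab : a * b ≠ 0 := by positivity
  constructor
  · apply mul_left_cancel₀ hab; linarith
  · apply mul_left_cancel₀ hab; linarith

theorem eq_of_sum_prod {t t' u u' : ℝ} (h : t + t' = u + u') (h' : t * t' = u * u')
    (ht : t ≤ t') (hu : u ≤ u') : t = u ∧ t' = u' := by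
  have : (t' - t) ^ 2 = (u' - u) ^ 2 := by
    linear_combination (t + t' + u + u') * h - 4 * h'
  have := (sq_eq_sq₀ (sub_nonneg.2 ht) (sub_nonneg.2 hu)).1 this
  constructor <;> linarith

theorem centerAt_eq {B : Space} (hB : B ∈ surface a b) (R : ℝ) :
    centerAt a b B R = normalPoint a b (B 0) (B 1) (R / ‖normalVector a b B‖) := by
  have hB' : B 2 = (a * B 0 ^ 2 + b * B 1 ^ 2) / 2 := hB
  apply space_ext
  · simp [centerAt, normalPoint, normalVector]; ring
  · simp [centerAt, normalPoint, normalVector]; ring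
  · simp [centerAt, normalPoint, normalVector, hB']; ring

/-- The point of the paraboloid over `v`. -/
noncomputable def lift (a b : ℝ) (v : ℝ × ℝ) : Space :=
  !₂[v.1, v.2, (a * v.1 ^ 2 + b * v.2 ^ 2) / 2]

theorem lift_mem (a b : ℝ) (v : ℝ × ℝ) : lift a b v ∈ surface a b := by
  simp [surface, lift]

@[simp] theorem lift_zero (a b : ℝ) (v : ℝ × ℝ) : lift a b v 0 = v.1 := by simp [lift]
@[simp] theorem lift_one (a b : ℝ) (v : ℝ × ℝ) : lift a b v 1 = v.2 := by simp [lift]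
@[simp] theorem lift_two (a b : ℝ) (v : ℝ × ℝ) :
    lift a b v 2 = (a * v.1 ^ 2 + b * v.2 ^ 2) / 2 := by simp [lift]

theorem eq_lift {A : Space} (hA : A ∈ surface a b) : A = lift a b (A 0, A 1) :=
  space_ext (by simp) (by simp) (by rw [lift_two]; exact hA)

/-- This removes the square roots: from here on a caustic point is a root of the quadratic together
with an order relation to the other root. -/
theorem mem_innerCaustic (ha : 0 < a) (hb : 0 < b) {C : Space} : C ∈ innerCaustic a b ↔
    ∃ x y t t', AreCenters a b x y t t' ∧ t ≤ t' ∧ C = normalPoint a b x y t := by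
  constructor
  · rintro ⟨B, hB, rfl⟩
    obtain ⟨t, t', h1, -, h3, h4⟩ := radii_eq ha hb B
    exact ⟨_, _, t, t', h4, h3, by rw [centerAt_eq hB, h1]⟩
  · rintro ⟨x, y, t, t', h, hle, rfl⟩
    refine ⟨lift a b (x, y), lift_mem _ _ _, ?_⟩
    obtain ⟨u, u', h1, -, h3, h4⟩ := radii_eq ha hb (lift a b (x, y))
    simp only [lift_zero, lift_one] at h4
    obtain ⟨hs, hp⟩ := h.unique ha hb h4
    rw [centerAt_eq (lift_mem _ _ _), h1, (eq_of_sum_prod hs hp hle h3).1]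
    simp

theorem mem_outerCaustic (ha : 0 < a) (hb : 0 < b) {C : Space} : C ∈ outerCaustic a b ↔
    ∃ x y t t', AreCenters a b x y t t' ∧ t' ≤ t ∧ C = normalPoint a b x y t := by
  constructor
  · rintro ⟨B, hB, rfl⟩
    obtain ⟨t, t', -, h1, h3, h4⟩ := radii_eq ha hb B
    exact ⟨_, _, t', t, fun s => by rw [h4 s]; ring, h3, by rw [centerAt_eq hB, h1]⟩
  · rintro ⟨x, y, t, t', h, hle, rfl⟩
    refine ⟨lift a b (x, y), lift_mem _ _ _, ?_⟩
    obtain ⟨u, u', -, h1, h3, h4⟩ := radii_eq ha hb (lift a b (x, y))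
    simp only [lift_zero, lift_one] at h4
    obtain ⟨hs, hp⟩ := h.unique ha hb h4
    rw [centerAt_eq (lift_mem _ _ _), h1,
      (eq_of_sum_prod (t := t') (t' := t) (by linarith) (by linarith) hle h3).2]
    simp

end Centers


/-! ### The caustics as graphs of the minimal height -/

section CausticHeight

variable {a b x y t t' : ℝ}

/-- Evaluation of the quadratic at `s = 1/a`. As `a < b`, the sign shows that `1/a` separates the
two roots, so that each caustic uses its own parameter interval. -/
theorem AreCenters.fst (ha : 0 < a) (h : AreCenters a b x y t t') :
    a ^ 2 * x ^ 2 * (a - b) = b * ((1 - a * t) * (1 - a * t')) := by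
  have := h (1 / a)
  field_simp at this
  linear_combination this

theorem AreCenters.snd (hb : 0 < b) (h : AreCenters a b x y t t') :
    b ^ 2 * y ^ 2 * (b - a) = a * ((1 - b * t) * (1 - b * t')) := by
  have := h (1 / b)
  field_simp at this
  linear_combination this

theorem AreCenters.root (h : AreCenters a b x y t t') :
    (1 - a * t) * (1 - b * t) + a ^ 2 * x ^ 2 * (1 - b * t) + b ^ 2 * y ^ 2 * (1 - a * t) = 0 := by
  rw [h t]; ring

theorem AreCenters.sum (h : AreCenters a b x y t t') :
    a * b * (t + t') = a + b + b * (a ^ 2 * x ^ 2) + a * (b ^ 2 * y ^ 2) := by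
  linear_combination h 1 - h 0

/-- The other root is forced by the product of the roots, which is the constant term divided by
`ab`. -/
theorem AreCenters.of_root (ha : 0 < a) (hb : 0 < b) (ht : t ≠ 0)
    (h : (1 - a * t) * (1 - b * t) + a ^ 2 * x ^ 2 * (1 - b * t) +
      b ^ 2 * y ^ 2 * (1 - a * t) = 0) :
    AreCenters a b x y t ((1 + a ^ 2 * x ^ 2 + b ^ 2 * y ^ 2) / (a * b * t)) := by
  intro s
  have e : a * b * t * ((1 + a ^ 2 * x ^ 2 + b ^ 2 * y ^ 2) / (a * b * t)) =
      1 + a ^ 2 * x ^ 2 + b ^ 2 * y ^ 2 := by field_simp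
  generalize (1 + a ^ 2 * x ^ 2 + b ^ 2 * y ^ 2) / (a * b * t) = u at e
  apply mul_left_cancel₀ ht
  linear_combination s * h + (s - t) * e

/-- If `bt < 1`, then `at < 1` as well, and the quadratic is a sum of nonnegative terms with a
positive first one. -/
theorem AreCenters.one_le (ha : 0 < a) (hab : a < b) (h : AreCenters a b x y t t') :
    1 ≤ b * t := by
  by_contra! hc
  have hat : a * t < 1 := by
    rcases le_total t 0 with h0 | h0
    · nlinarith
    · nlinarith
  have h1 : 0 < 1 - a * t := by linarith
  have h2 : 0 < 1 - b * t := by linarith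
  have := h.root
  have h3 : 0 < (1 - a * t) * (1 - b * t) := by positivity
  have h4 : 0 ≤ a ^ 2 * x ^ 2 * (1 - b * t) := by positivity
  have h5 : 0 ≤ b ^ 2 * y ^ 2 * (1 - a * t) := by positivity
  linarith

theorem AreCenters.pos (ha : 0 < a) (hab : a < b) (h : AreCenters a b x y t t') : 0 < t :=
  pos_of_one_le_mul (ha.trans hab) (h.one_le ha hab)

theorem AreCenters.mul_nonpos (ha : 0 < a) (hab : a < b) (h : AreCenters a b x y t t') :
    (1 - a * t) * (1 - a * t') ≤ 0 := by
  have h1 := h.fst ha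
  have h2 : a ^ 2 * x ^ 2 * (a - b) ≤ 0 :=
    mul_nonpos_of_nonneg_of_nonpos (by positivity) (by linarith)
  by_contra! hc
  have := mul_pos (ha.trans hab) hc
  linarith

theorem AreCenters.le_one (ha : 0 < a) (hab : a < b) (h : AreCenters a b x y t t')
    (hle : t ≤ t') : a * t ≤ 1 := by
  by_contra! hc
  have := h.mul_nonpos ha hab
  have : a * t ≤ a * t' := mul_le_mul_of_nonneg_left hle ha.le
  nlinarith

theorem AreCenters.one_le' (ha : 0 < a) (hab : a < b) (h : AreCenters a b x y t t')
    (hle : t' ≤ t) : 1 ≤ a * t := by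
  by_contra! hc
  have := h.mul_nonpos ha hab
  have : a * t' ≤ a * t := mul_le_mul_of_nonneg_left hle ha.le
  nlinarith

theorem AreCenters.fst_eq_zero (ha : 0 < a) (hab : a < b) (h : AreCenters a b x y t t')
    (h1 : a * t = 1) : x = 0 := by
  have := h.fst ha
  rw [h1, sub_self, zero_mul, mul_zero] at this
  have hne : a - b ≠ 0 := by linarith
  have : x ^ 2 = 0 := by
    rcases mul_eq_zero.1 this with h | h
    · exact (mul_eq_zero.1 h).resolve_left (by positivity)
    · exact absurd h hne
  exact pow_eq_zero_iff (two_ne_zero) |>.1 this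

theorem AreCenters.snd_eq_zero (ha : 0 < a) (hab : a < b) (h : AreCenters a b x y t t')
    (h1 : b * t = 1) : y = 0 := by
  have hb := ha.trans hab
  have := h.snd hb
  rw [h1, sub_self, zero_mul, mul_zero] at this
  have hne : b - a ≠ 0 := by linarith
  have : y ^ 2 = 0 := by
    rcases mul_eq_zero.1 this with h | h
    · exact (mul_eq_zero.1 h).resolve_left (by positivity)
    · exact absurd h hne
  exact pow_eq_zero_iff (two_ne_zero) |>.1 this

theorem height_normal (h1 : x = 0 ∨ a * t ≠ 1) (h2 : y = 0 ∨ b * t ≠ 1) :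
    height a b (x * (1 - a * t), y * (1 - b * t)) t = t + (a * x ^ 2 + b * y ^ 2) / 2 := by
  have key : ∀ c x : ℝ, x = 0 ∨ c * t ≠ 1 →
      c * (x * (1 - c * t)) ^ 2 / (1 - c * t) ^ 2 = c * x ^ 2 := by
    rintro c x (rfl | h)
    · simp
    · have : 1 - c * t ≠ 0 := fun h' => h (by linarith)
      field_simp
  unfold height
  rw [key a x h1, key b y h2]

theorem heightSlope_normal (h1 : x = 0 ∨ a * t ≠ 1) (h2 : y = 0 ∨ b * t ≠ 1) :
    heightSlope a b (x * (1 - a * t), y * (1 - b * t)) t =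
      1 + a ^ 2 * x ^ 2 / (1 - a * t) + b ^ 2 * y ^ 2 / (1 - b * t) := by
  have key : ∀ c x : ℝ, x = 0 ∨ c * t ≠ 1 →
      c ^ 2 * (x * (1 - c * t)) ^ 2 / (1 - c * t) ^ 3 = c ^ 2 * x ^ 2 / (1 - c * t) := by
    rintro c x (rfl | h)
    · simp
    · have : 1 - c * t ≠ 0 := fun h' => h (by linarith)
      field_simp
  unfold heightSlope
  rw [key a x h1, key b y h2]

theorem AreCenters.slope_eq_zero (h : AreCenters a b x y t t') (h1 : a * t ≠ 1)
    (h2 : b * t ≠ 1) :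
    1 + a ^ 2 * x ^ 2 / (1 - a * t) + b ^ 2 * y ^ 2 / (1 - b * t) = 0 := by
  have h1' : 1 - a * t ≠ 0 := fun h' => h1 (by linarith)
  have h2' : 1 - b * t ≠ 0 := fun h' => h2 (by linarith)
  have hr := h.root
  generalize 1 - a * t = m at *
  generalize 1 - b * t = n at *
  field_simp
  linear_combination hr

/-- In terms of the target `(p, q)`, the condition for a center is the vanishing of the slope of the
height, multiplied by the cubes of both denominators. -/
theorem center_equation {m n p q : ℝ} (hm : m ≠ 0) (hn : n ≠ 0)
    (h : m ^ 3 * n ^ 3 + a ^ 2 * p ^ 2 * n ^ 3 + b ^ 2 * q ^ 2 * m ^ 3 = 0) :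
    m * n + a ^ 2 * (p / m) ^ 2 * n + b ^ 2 * (q / n) ^ 2 * m = 0 := by
  field_simp
  linear_combination h

/-- In the interior the slope vanishes, and convexity makes `t` a minimum. At an end of the interval
the matching coordinate is zero, and the slope only needs the sign pointing into the interval. -/
theorem AreCenters.isMinParam_inner (ha : 0 < a) (hab : a < b) (h : AreCenters a b x y t t')
    (hle : t ≤ t') :
    IsMinParam a b (innerParams a b) (x * (1 - a * t), y * (1 - b * t)) t := by
  have hb := ha.trans hab
  have hb1 := h.one_le ha hab
  have ha1 := h.le_one ha hab hle
  have hx : x = 0 ∨ a * t ≠ 1 := or_iff_not_imp_right.2 fun h' =>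
    h.fst_eq_zero ha hab (not_not.1 h')
  have hy : y = 0 ∨ b * t ≠ 1 := or_iff_not_imp_right.2 fun h' =>
    h.snd_eq_zero ha hab (not_not.1 h')
  have ht := h.pos ha hab
  have hlt := mul_lt_mul_params hab ht
  refine ⟨(mem_closure_innerParams ha hab).2 ⟨hb1, ha1⟩, hx.imp_left (by rintro rfl; simp),
    hy.imp_left (by rintro rfl; simp), fun s hs => ?_⟩
  obtain ⟨hs1, hs2⟩ := (mem_innerParams ha hb).1 hs
  have key : 0 ≤ heightSlope a b (x * (1 - a * t), y * (1 - b * t)) t * (s - t) := by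
    rw [heightSlope_normal hx hy]
    rcases eq_or_ne (b * t) 1 with e | e
    · rw [h.snd_eq_zero ha hab e]
      have : 0 < 1 - a * t := by linarith
      have h2 : 0 ≤ s - t := by
        have : b * t ≤ b * s := by linarith
        linarith [le_of_mul_le_mul_left this hb]
      simp only [ne_eq, OfNat.ofNat_ne_zero, not_false_eq_true, zero_pow, mul_zero, zero_div,
        add_zero]
      positivity
    · rcases eq_or_ne (a * t) 1 with e' | e'
      · have hsum := h.sum
        rw [h.fst_eq_zero ha hab e'] at hsum ⊢
        -- With `x = 0` and `t = 1/a` the other root is `(1 + b²y²)/b`, so `t ≤ t'` is exactly this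
        -- inequality.
        have hY : b * t - 1 ≤ b ^ 2 * y ^ 2 := by
          have e1 : a * (b * t') = a * (1 + b ^ 2 * y ^ 2) := by
            linear_combination hsum - b * e'
          have := mul_left_cancel₀ ha.ne' e1
          have := mul_le_mul_of_nonneg_left hle hb.le
          linarith
        have : b ^ 2 * y ^ 2 / (1 - b * t) ≤ -1 := by
          rw [div_le_iff_of_neg (by linarith)]; linarith
        have h2 : s - t ≤ 0 := by
          have : a * s ≤ a * t := by linarith
          linarith [le_of_mul_le_mul_left this ha]
        simp only [ne_eq, OfNat.ofNat_ne_zero, not_false_eq_true, zero_pow, mul_zero, zero_div,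
          add_zero]
        exact mul_nonneg_of_nonpos_of_nonpos (by linarith) h2
      · rw [h.slope_eq_zero e' e, zero_mul]
  refine le_trans (by linarith) (height_tangent ha hb ?_ ?_ (s := s) (t := t))
  · rcases hx with rfl | hx
    · simp
    · exact Or.inr (mul_pos (by have := lt_of_le_of_ne ha1 hx; linarith) (by linarith))
  · rcases hy with rfl | hy
    · simp
    · exact Or.inr (mul_pos_of_neg_of_neg (by have := lt_of_le_of_ne hb1 hy.symm; linarith)
        (by linarith))

theorem AreCenters.isMinParam_outer (ha : 0 < a) (hab : a < b) (h : AreCenters a b x y t t')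
    (hle : t' ≤ t) :
    IsMinParam a b (outerParams a) (x * (1 - a * t), y * (1 - b * t)) t := by
  have hb := ha.trans hab
  have ha1 := h.one_le' ha hab hle
  have ht := h.pos ha hab
  have hlt := mul_lt_mul_params hab ht
  have hx : x = 0 ∨ a * t ≠ 1 := or_iff_not_imp_right.2 fun h' =>
    h.fst_eq_zero ha hab (not_not.1 h')
  have hy : y = 0 ∨ b * t ≠ 1 := Or.inr (by linarith)
  refine ⟨(mem_closure_outerParams ha).2 ha1, hx.imp_left (by rintro rfl; simp),
    hy.imp_left (by rintro rfl; simp), fun s hs => ?_⟩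
  have hs1 := (mem_outerParams ha).1 hs
  have hs2 := mul_lt_mul_params hab (pos_of_one_le_mul ha hs1.le)
  have key : 0 ≤ heightSlope a b (x * (1 - a * t), y * (1 - b * t)) t * (s - t) := by
    rw [heightSlope_normal hx hy]
    rcases eq_or_ne (a * t) 1 with e' | e'
    · have hsum := h.sum
      rw [h.fst_eq_zero ha hab e'] at hsum ⊢
      have hY : b ^ 2 * y ^ 2 ≤ b * t - 1 := by
        have e1 : a * (b * t') = a * (1 + b ^ 2 * y ^ 2) := by
          linear_combination hsum - b * e'
        have := mul_left_cancel₀ ha.ne' e1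
        have := mul_le_mul_of_nonneg_left hle hb.le
        linarith
      have : -1 ≤ b ^ 2 * y ^ 2 / (1 - b * t) := by
        rw [le_div_iff_of_neg (by linarith)]; linarith
      have h2 : 0 ≤ s - t := by
        have : a * t ≤ a * s := by linarith
        linarith [le_of_mul_le_mul_left this ha]
      simp only [ne_eq, OfNat.ofNat_ne_zero, not_false_eq_true, zero_pow, mul_zero, zero_div,
        add_zero]
      exact mul_nonneg (by linarith) h2
    · rw [h.slope_eq_zero e' (by linarith), zero_mul]
  refine le_trans (by linarith) (height_tangent ha hb ?_ ?_ (s := s) (t := t))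
  · rcases hx with rfl | hx
    · simp
    · exact Or.inr (mul_pos_of_neg_of_neg (by have := lt_of_le_of_ne ha1 hx.symm; linarith)
        (by linarith))
  · exact Or.inr (mul_pos_of_neg_of_neg (by linarith) (by linarith))

@[simp] theorem normalPoint_zero : normalPoint a b x y t 0 = x * (1 - a * t) := by
  simp [normalPoint]
@[simp] theorem normalPoint_one : normalPoint a b x y t 1 = y * (1 - b * t) := by
  simp [normalPoint]
@[simp] theorem normalPoint_two : normalPoint a b x y t 2 = t + (a * x ^ 2 + b * y ^ 2) / 2 := by
  simp [normalPoint]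

theorem isMinParam_of_mem_innerCaustic (ha : 0 < a) (hab : a < b) {C : Space}
    (hC : C ∈ innerCaustic a b) :
    ∃ t, IsMinParam a b (innerParams a b) (C 0, C 1) t ∧ 0 < t ∧
      C 2 = height a b (C 0, C 1) t := by
  obtain ⟨x, y, t, t', h, hle, rfl⟩ := (mem_innerCaustic ha (ha.trans hab)).1 hC
  simp only [normalPoint_zero, normalPoint_one, normalPoint_two]
  refine ⟨t, h.isMinParam_inner ha hab hle, h.pos ha hab, (height_normal ?_ ?_).symm⟩
  · exact or_iff_not_imp_right.2 fun h' => h.fst_eq_zero ha hab (not_not.1 h')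
  · exact or_iff_not_imp_right.2 fun h' => h.snd_eq_zero ha hab (not_not.1 h')

theorem isMinParam_of_mem_outerCaustic (ha : 0 < a) (hab : a < b) {C : Space}
    (hC : C ∈ outerCaustic a b) :
    ∃ t, IsMinParam a b (outerParams a) (C 0, C 1) t ∧ 0 < t ∧
      C 2 = height a b (C 0, C 1) t := by
  obtain ⟨x, y, t, t', h, hle, rfl⟩ := (mem_outerCaustic ha (ha.trans hab)).1 hC
  simp only [normalPoint_zero, normalPoint_one, normalPoint_two]
  refine ⟨t, h.isMinParam_outer ha hab hle, h.pos ha hab, (height_normal ?_ ?_).symm⟩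
  · exact or_iff_not_imp_right.2 fun h' => h.fst_eq_zero ha hab (not_not.1 h')
  · exact or_iff_not_imp_right.2 fun h' => h.snd_eq_zero ha hab (not_not.1 h')

/-- No comparison with the second root is needed: `1/a` separates the roots, so a root below `1/a`
is the smaller one. -/
theorem normalPoint_mem_innerCaustic (ha : 0 < a) (hab : a < b) (ht0 : 0 < t)
    (ht : a * t < 1)
    (h : (1 - a * t) * (1 - b * t) + a ^ 2 * x ^ 2 * (1 - b * t) +
      b ^ 2 * y ^ 2 * (1 - a * t) = 0) : normalPoint a b x y t ∈ innerCaustic a b := by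
  have hc := AreCenters.of_root ha (ha.trans hab) ht0.ne' h
  refine (mem_innerCaustic ha (ha.trans hab)).2 ⟨x, y, t, _, hc, ?_, rfl⟩
  have := hc.mul_nonpos ha hab
  set t' := (1 + a ^ 2 * x ^ 2 + b ^ 2 * y ^ 2) / (a * b * t)
  have : 1 ≤ a * t' := by
    by_contra! h
    have := mul_pos (sub_pos.2 ht) (sub_pos.2 h)
    linarith
  exact le_of_mul_le_mul_left (by linarith) ha

theorem normalPoint_mem_outerCaustic (ha : 0 < a) (hab : a < b)
    (ht : 1 < a * t)
    (h : (1 - a * t) * (1 - b * t) + a ^ 2 * x ^ 2 * (1 - b * t) +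
      b ^ 2 * y ^ 2 * (1 - a * t) = 0) : normalPoint a b x y t ∈ outerCaustic a b := by
  have hc := AreCenters.of_root ha (ha.trans hab) (pos_of_one_le_mul ha ht.le).ne' h
  refine (mem_outerCaustic ha (ha.trans hab)).2 ⟨x, y, t, _, hc, ?_, rfl⟩
  have := hc.mul_nonpos ha hab
  set t' := (1 + a ^ 2 * x ^ 2 + b ^ 2 * y ^ 2) / (a * b * t)
  have : a * t' ≤ 1 := by
    by_contra! h
    have := mul_pos_of_neg_of_neg (sub_neg.2 ht) (sub_neg.2 h)
    linarith
  exact le_of_mul_le_mul_left (by linarith) ha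

/-- For `x = 0` the quadratic splits off the factor `1 - as`. -/
theorem areCenters_axis (ha : 0 < a) (hb : 0 < b) :
    AreCenters a b 0 y (1 / a) ((1 + b ^ 2 * y ^ 2) / b) := by
  intro s
  field_simp
  ring

/-- The vertical line over every `v` meets the caustic: for nonzero coordinates the cleared slope
equation changes sign between the asymptotes. A zero coordinate removes a pole, and then the minimum
may lie at an end of the interval. -/
theorem exists_mem_innerCaustic (ha : 0 < a) (hab : a < b) (v : ℝ × ℝ) :
    ∃ C ∈ innerCaustic a b, C 0 = v.1 ∧ C 1 = v.2 := by
  have hb := ha.trans hab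
  obtain ⟨p, q⟩ := v
  have hne : 1 - a / b ≠ 0 := by
    have : a / b < 1 := (div_lt_one hb).2 hab
    linarith
  rcases eq_or_ne q 0 with rfl | hq
  · refine ⟨_, normalPoint_mem_innerCaustic (x := p / (1 - a / b)) (y := 0) (t := 1 / b) ha hab
      (by positivity) ?_ ?_, ?_, ?_⟩
    · rw [mul_one_div]; exact (div_lt_one hb).2 hab
    · field_simp; ring
    · rw [normalPoint_zero, mul_one_div]; exact div_mul_cancel₀ _ hne
    · simp
  have hle := one_div_lt_one_div_params ha hab
  rcases eq_or_ne p 0 with rfl | hp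
  -- On `p = 0` the slope equation is `(bt-1)³ = b²q²`. The threshold is its left side at `t = 1/a`;
  -- for larger `q` the minimum sits on the asymptote itself.
  · rcases le_total (b ^ 2 * q ^ 2) ((b / a - 1) ^ 3) with hc | hc
    · have hcont : ContinuousOn (fun t : ℝ => (b * t - 1) ^ 3) (Set.Icc (1 / b) (1 / a)) := by
        fun_prop
      obtain ⟨t, ⟨ht1, ht2⟩, ht⟩ := intermediate_value_Icc hle.le hcont
        (show b ^ 2 * q ^ 2 ∈ _ by
          constructor
          · simp only [mul_one_div_cancel hb.ne', sub_self]
            rw [zero_pow (by norm_num)]; positivity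
          · simpa only [mul_one_div] using hc)
      simp only at ht
      have hbt : 1 ≤ b * t := by rwa [div_le_iff₀' hb] at ht1
      have hat : a * t ≤ 1 := by rwa [le_div_iff₀' ha] at ht2
      have hbt0 : 1 - b * t ≠ 0 := by
        intro h0
        have : b * t - 1 = 0 := by linarith
        rw [this] at ht
        have : 0 < b ^ 2 * q ^ 2 := by positivity
        linarith
      have hQ : b ^ 2 * (q / (1 - b * t)) ^ 2 = b * t - 1 := by
        rw [div_pow, ← mul_div_assoc, ← ht]
        field_simp
        ring
      refine ⟨normalPoint a b 0 (q / (1 - b * t)) t, ?_, by simp, by simp [hbt0]⟩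
      rcases hat.lt_or_eq with h1 | h1
      · refine normalPoint_mem_innerCaustic ha hab (pos_of_one_le_mul hb hbt) h1 ?_
        rw [hQ]; ring
      · refine (mem_innerCaustic ha hb).2 ⟨_, _, _, _, ?_, le_refl t, rfl⟩
        have : t = 1 / a := by field_simp; linarith
        have h2 := areCenters_axis (y := q / (1 - b * t)) ha hb
        rw [hQ, ← this, show (1 + (b * t - 1)) / b = t by field_simp; ring] at h2
        exact h2
    · have hba : 1 < b / a := (one_lt_div ha).2 hab
      have hba' : 1 - b / a ≠ 0 := by linarith
      refine ⟨normalPoint a b 0 (q / (1 - b / a)) (1 / a), ?_, by simp, ?_⟩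
      · refine (mem_innerCaustic ha hb).2 ⟨_, _, _, _, areCenters_axis ha hb, ?_, rfl⟩
        rw [le_div_iff₀ hb, div_pow, ← mul_div_assoc]
        have : b / a - 1 ≤ b ^ 2 * q ^ 2 / (1 - b / a) ^ 2 := by
          rw [le_div_iff₀ (by positivity)]
          nlinarith
        have e : 1 / a * b = b / a := by ring
        linarith
      · rw [normalPoint_one, mul_one_div]; exact div_mul_cancel₀ _ hba'
  · have hcont : ContinuousOn (fun t : ℝ => (1 - a * t) ^ 3 * (1 - b * t) ^ 3 +
        a ^ 2 * p ^ 2 * (1 - b * t) ^ 3 + b ^ 2 * q ^ 2 * (1 - a * t) ^ 3)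
        (Set.Icc (1 / b) (1 / a)) := by fun_prop
    have hab' : a / b < 1 := (div_lt_one hb).2 hab
    have hba : 1 < b / a := (one_lt_div ha).2 hab
    obtain ⟨t, ht1, ht⟩ := intermediate_value_Ioo' hle.le hcont
      (show (0 : ℝ) ∈ _ by
        constructor
        · simp only [mul_one_div_cancel ha.ne', sub_self]
          have : (1 - b * (1 / a)) ^ 3 < 0 := by
            rw [mul_one_div]; exact Odd.pow_neg (by decide) (by linarith)
          have := mul_neg_of_pos_of_neg (by positivity : 0 < a ^ 2 * p ^ 2) this
          linarith
        · simp only [mul_one_div_cancel hb.ne', sub_self]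
          have : 0 < 1 - a * (1 / b) := by rw [mul_one_div]; linarith
          have : 0 < b ^ 2 * q ^ 2 * (1 - a * (1 / b)) ^ 3 := by positivity
          linarith)
    simp only at ht
    obtain ⟨h1, h2⟩ := (mem_innerParams ha hb).1 ht1
    have h1' : 1 - b * t ≠ 0 := by linarith
    have h2' : 1 - a * t ≠ 0 := by linarith
    refine ⟨_, normalPoint_mem_innerCaustic (x := p / (1 - a * t)) (y := q / (1 - b * t)) (t := t)
      ha hab (pos_of_one_le_mul hb h1.le) h2 (center_equation h2' h1' ht), ?_, ?_⟩
    · simp [h2']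
    · simp [h1']

theorem exists_mem_outerCaustic (ha : 0 < a) (hab : a < b) (v : ℝ × ℝ) :
    ∃ C ∈ outerCaustic a b, C 0 = v.1 ∧ C 1 = v.2 := by
  have hb := ha.trans hab
  obtain ⟨p, q⟩ := v
  have hba : 1 < b / a := (one_lt_div ha).2 hab
  have hba' : 1 - b / a ≠ 0 := by linarith
  rcases eq_or_ne p 0 with rfl | hp
  · rcases le_total (b ^ 2 * q ^ 2) ((b / a - 1) ^ 3) with hc | hc
    · refine ⟨normalPoint a b 0 (q / (1 - b / a)) (1 / a), ?_, by simp, ?_⟩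
      · refine (mem_outerCaustic ha hb).2 ⟨_, _, _, _, areCenters_axis ha hb, ?_, rfl⟩
        rw [div_le_iff₀ hb, div_pow, ← mul_div_assoc]
        have : b ^ 2 * q ^ 2 / (1 - b / a) ^ 2 ≤ b / a - 1 := by
          rw [div_le_iff₀ (by positivity)]
          nlinarith
        have e : 1 / a * b = b / a := by ring
        linarith
      · rw [normalPoint_one, mul_one_div]; exact div_mul_cancel₀ _ hba'
    · have hcont : Continuous (fun t : ℝ => (b * t - 1) ^ 3) := by fun_prop
      obtain ⟨t, ⟨ht1, -⟩, ht⟩ := intermediate_value_Icc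
        (show 1 / a ≤ 1 / a + (1 / b + b * q ^ 2) by
          linarith [show 0 ≤ 1 / b + b * q ^ 2 by positivity])
        hcont.continuousOn
        (show b ^ 2 * q ^ 2 ∈ _ by
          constructor
          · simpa only [mul_one_div] using hc
          · have e : b * (1 / a + (1 / b + b * q ^ 2)) - 1 = b / a + b ^ 2 * q ^ 2 := by
              field_simp; ring
            simp only [e]
            have h0 : 0 ≤ b ^ 2 * q ^ 2 := by positivity
            exact (by linarith : b ^ 2 * q ^ 2 ≤ b / a + b ^ 2 * q ^ 2).trans
              (le_self_pow₀ (by linarith) (by norm_num)))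
      simp only at ht
      have hat : 1 ≤ a * t := by rwa [div_le_iff₀' ha] at ht1
      have hbt : 1 < b * t :=
        hat.trans_lt (mul_lt_mul_params hab (pos_of_one_le_mul ha hat))
      have hbt0 : 1 - b * t ≠ 0 := by linarith
      have hQ : b ^ 2 * (q / (1 - b * t)) ^ 2 = b * t - 1 := by
        rw [div_pow, ← mul_div_assoc, ← ht]
        field_simp
        ring
      refine ⟨normalPoint a b 0 (q / (1 - b * t)) t, ?_, by simp, by simp [hbt0]⟩
      rcases hat.lt_or_eq with h1 | h1
      · refine normalPoint_mem_outerCaustic ha hab h1 ?_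
        rw [hQ]; ring
      · refine (mem_outerCaustic ha hb).2 ⟨_, _, _, _, ?_, le_refl t, rfl⟩
        have : t = 1 / a := by field_simp; linarith
        have h2 := areCenters_axis (y := q / (1 - b * t)) ha hb
        rw [hQ, ← this, show (1 + (b * t - 1)) / b = t by field_simp; ring] at h2
        exact h2
  · set U := a ^ 2 * p ^ 2 with hU
    set V := b ^ 2 * q ^ 2 with hV
    have hU0 : 0 < U := by positivity
    have hV0 : 0 ≤ V := by positivity
    -- At the right end `1 - at = -m` with `m = 1 + U + V`, and `1 - bt = -n` with `n ≥ m`. The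
    -- value `m³n³ - Un³ - Vm³` is then positive.
    have hcont : ContinuousOn (fun t : ℝ => (1 - a * t) ^ 3 * (1 - b * t) ^ 3 +
        U * (1 - b * t) ^ 3 + V * (1 - a * t) ^ 3)
        (Set.Icc (1 / a) ((2 + U + V) / a)) := by fun_prop
    obtain ⟨t, ht1, ht⟩ := intermediate_value_Ioo
      (by gcongr; linarith) hcont
      (show (0 : ℝ) ∈ _ by
        constructor
        · simp only [mul_one_div_cancel ha.ne', sub_self]
          have : (1 - b * (1 / a)) ^ 3 < 0 := by
            rw [mul_one_div]; exact Odd.pow_neg (by decide) (by linarith)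
          have := mul_neg_of_pos_of_neg hU0 this
          linarith
        · have e : 1 - a * ((2 + U + V) / a) = -(1 + U + V) := by field_simp; ring
          have hn : 1 - a * ((2 + U + V) / a) ≥ 1 - b * ((2 + U + V) / a) := by
            have : a * ((2 + U + V) / a) ≤ b * ((2 + U + V) / a) :=
              mul_le_mul_of_nonneg_right hab.le (by positivity)
            linarith
          rw [e] at hn ⊢
          obtain ⟨n, hn'⟩ : ∃ n, n = -(1 - b * ((2 + U + V) / a)) := ⟨_, rfl⟩
          rw [show 1 - b * ((2 + U + V) / a) = -n by rw [hn']; ring] at hn ⊢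
          have h1 : 1 + U + V ≤ (1 + U + V) ^ 3 := le_self_pow₀ (by linarith) (by norm_num)
          have h2 : 1 + U + V ≤ n := by linarith
          have h3 : (1 + U + V) ^ 3 ≤ n ^ 3 := by gcongr
          have h4 : 0 < n ^ 3 := by have : 0 < n := by linarith
                                    positivity
          have h5 := mul_le_mul_of_nonneg_right h1 h4.le
          have h6 := mul_le_mul_of_nonneg_left h3 hV0
          nlinarith)
    simp only at ht
    have h1 := (mem_outerParams ha).1 ht1.1
    have h2 := mul_lt_mul_params hab (pos_of_one_le_mul ha h1.le)
    have h1' : 1 - a * t ≠ 0 := by linarith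
    have h2' : 1 - b * t ≠ 0 := by linarith
    refine ⟨_, normalPoint_mem_outerCaustic (x := p / (1 - a * t)) (y := q / (1 - b * t)) (t := t)
      ha hab h1 (center_equation h1' h2' ht), ?_, ?_⟩
    · simp [h1']
    · simp [h2']

/-- The position of a point of the paraboloid relative to a caustic, in terms of an envelope. -/
structure DescribesCaustic (a b : ℝ) (T : Set ℝ) (C : Set Space) : Prop where
  mem_iff : ∀ v, lift a b v ∈ C ↔ envelope a b T v = 1
  below : ∀ v, envelope a b T v < 1 → Below (lift a b v) C
  above : ∀ v, 1 < envelope a b T v → Above (lift a b v) C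

/-- Every point of `C` has the minimal height over its projection, and `C` has a point over every
`v`; thus `C` is a graph. The three comparisons of heights correspond to three mutually exclusive
comparisons of the envelope with 1, which gives the converse implications. -/
theorem describesCaustic {T : Set ℝ} {C : Set Space}
    (hT : ∀ s ∈ T, 0 < s ∧ a * s ≠ 1 ∧ b * s ≠ 1)
    (hlt : ∀ v t, IsMinParam a b T v t →
      (a * v.1 ^ 2 + b * v.2 ^ 2) / 2 < height a b v t → envelope a b T v < 1)
    (hC : ∀ A ∈ C, ∃ t, IsMinParam a b T (A 0, A 1) t ∧ 0 < t ∧ A 2 = height a b (A 0, A 1) t)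
    (hex : ∀ v : ℝ × ℝ, ∃ A ∈ C, A 0 = v.1 ∧ A 1 = v.2) : DescribesCaustic a b T C := by
  have key : ∀ v : ℝ × ℝ, ∃ A ∈ C, A 0 = v.1 ∧ A 1 = v.2 ∧
      (lift a b v 2 < A 2 → envelope a b T v < 1) ∧
      (lift a b v 2 = A 2 → envelope a b T v = 1) ∧
      (A 2 < lift a b v 2 → 1 < envelope a b T v) := fun v => by
    obtain ⟨A, hA, h0, h1⟩ := hex v
    obtain ⟨t, ht, ht0, h2⟩ := hC A hA
    have e : (A 0, A 1) = v := Prod.ext h0 h1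
    rw [e] at ht h2
    refine ⟨A, hA, h0, h1, ?_, ?_, ?_⟩ <;> rw [lift_two, h2]
    · exact hlt v t ht
    · exact fun h =>
        ht.envelope_eq_one (fun s hs => (hT s hs).1) ht0 (fun s hs => (hT s hs).2) h.symm
    · exact ht.one_lt_envelope ht0
  constructor
  · intro v
    constructor
    · intro h
      obtain ⟨t, ht, ht0, h2⟩ := hC _ h
      have e : (lift a b v 0, lift a b v 1) = v := by simp
      rw [e] at ht h2
      rw [lift_two] at h2
      exact ht.envelope_eq_one (fun s hs => (hT s hs).1) ht0 (fun s hs => (hT s hs).2) h2.symm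
    · intro h
      obtain ⟨A, hA, h0, h1, k1, k2, k3⟩ := key v
      have : lift a b v = A := by
        refine space_ext (by simp [h0]) (by simp [h1]) ?_
        rcases lt_trichotomy (lift a b v 2) (A 2) with h' | h' | h'
        · linarith [k1 h']
        · exact h'
        · linarith [k3 h']
      rwa [this]
  · intro v h
    obtain ⟨A, hA, h0, h1, k1, k2, k3⟩ := key v
    refine ⟨A, hA, by simp [h0], by simp [h1], ?_⟩
    by_contra! h'
    rcases h'.lt_or_eq with h' | h'
    · linarith [k3 h']
    · linarith [k2 h'.symm]
  · intro v h
    obtain ⟨A, hA, h0, h1, k1, k2, k3⟩ := key v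
    refine ⟨A, hA, by simp [h0], by simp [h1], ?_⟩
    by_contra! h'
    rcases h'.lt_or_eq with h' | h'
    · linarith [k1 h']
    · linarith [k2 h']

theorem describesCaustic_inner (ha : 0 < a) (hab : a < b) :
    DescribesCaustic a b (innerParams a b) (innerCaustic a b) :=
  describesCaustic (fun s hs => by
      obtain ⟨h1, h2⟩ := (mem_innerParams ha (ha.trans hab)).1 hs
      exact ⟨pos_of_one_le_mul (ha.trans hab) h1.le, h2.ne, h1.ne'⟩)
    (fun _ _ h => h.envelope_inner_lt_one ha hab)
    (fun _ h => isMinParam_of_mem_innerCaustic ha hab h) (exists_mem_innerCaustic ha hab)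

theorem describesCaustic_outer (ha : 0 < a) (hab : a < b) :
    DescribesCaustic a b (outerParams a) (outerCaustic a b) :=
  describesCaustic (fun s hs => by
      have h1 := (mem_outerParams ha).1 hs
      have h0 := pos_of_one_le_mul ha h1.le
      exact ⟨h0, h1.ne', (h1.trans (mul_lt_mul_params hab h0)).ne'⟩)
    (fun _ _ h => h.envelope_outer_lt_one ha hab)
    (fun _ h => isMinParam_of_mem_outerCaustic ha hab h) (exists_mem_outerCaustic ha hab)

end CausticHeight


/-- The number of solutions of `f = r` for a strictly convex coercive `f`, where `G` is less than,
equal to, or greater than `1` according as `r` is below, at, or above the minimum of `f`. -/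
noncomputable def crossings (G : ℝ) : ℕ := if G < 1 then 0 else if G = 1 then 1 else 2

theorem crossings_of_lt {G : ℝ} (h : G < 1) : crossings G = 0 := if_pos h
theorem crossings_one : crossings 1 = 1 := by simp [crossings]
theorem crossings_of_gt {G : ℝ} (h : 1 < G) : crossings G = 2 := by
  simp [crossings, h.not_gt, h.ne']

/-! ### Level sets of a strictly convex function -/

section Level

variable {f f' : ℝ → ℝ} {T : Set ℝ} {t₀ r : ℝ}

theorem level_eq_empty (hmin : ∀ s ∈ T, f t₀ ≤ f s) (h : r < f t₀) : {t ∈ T | f t = r} = ∅ := by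
  ext t
  simp only [Set.mem_ofPred_eq, Set.mem_empty_iff_false, iff_false, not_and]
  intro ht e
  have := hmin t ht
  linarith

theorem level_eq_singleton (hord : T.OrdConnected)
    (htan : ∀ t ∈ T, ∀ s ∈ T, s ≠ t → f t + f' t * (s - t) < f s) (h0 : t₀ ∈ T)
    (hmin : ∀ s ∈ T, f t₀ ≤ f s) : {t ∈ T | f t = f t₀} = {t₀} := by
  ext t
  simp only [Set.mem_ofPred_eq, Set.mem_singleton_iff]
  refine ⟨fun ⟨ht, e⟩ => ?_, by rintro rfl; exact ⟨h0, rfl⟩⟩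
  by_contra hne
  -- At the midpoint of two distinct minimizers strict convexity would give a smaller value.
  have hm : (t + t₀) / 2 ∈ T := by
    rcases le_total t t₀ with h | h
    · exact hord.out ht h0 ⟨by linarith, by linarith⟩
    · exact hord.out h0 ht ⟨by linarith, by linarith⟩
  have h1 := htan _ hm t ht (fun h => hne (by linarith))
  have h2 := htan _ hm t₀ h0 (fun h => hne (by linarith))
  have h3 := hmin _ hm
  nlinarith

/-- The tangent at the middle point would have to descend strictly in both directions. -/
theorem not_three_levels (htan : ∀ t ∈ T, ∀ s ∈ T, s ≠ t → f t + f' t * (s - t) < f s)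
    {x y z : ℝ} (hx : x ∈ T) (hy : y ∈ T) (hz : z ∈ T) (hxy : x < y) (hyz : y < z)
    (h1 : f x = r) (h2 : f y = r) (h3 : f z = r) : False := by
  have e1 := htan y hy x hx hxy.ne
  have e2 := htan y hy z hz hyz.ne'
  have e1' : f' y * (x - y) < 0 := by linarith
  have e2' : f' y * (z - y) < 0 := by linarith
  rcases le_total 0 (f' y) with h | h <;> nlinarith

theorem level_ncard_two (hord : T.OrdConnected) (hcont : ContinuousOn f T)
    (htan : ∀ t ∈ T, ∀ s ∈ T, s ≠ t → f t + f' t * (s - t) < f s) (h0 : t₀ ∈ T)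
    (hl : ∃ t ∈ T, t < t₀ ∧ r < f t) (hr : ∃ t ∈ T, t₀ < t ∧ r < f t) (h : f t₀ < r) :
    {t ∈ T | f t = r}.ncard = 2 := by
  obtain ⟨x, hx, hx0, hxr⟩ := hl
  obtain ⟨y, hy, hy0, hyr⟩ := hr
  obtain ⟨s₁, hs₁, e₁⟩ := intermediate_value_Ioo' hx0.le (hcont.mono (hord.out hx h0)) ⟨h, hxr⟩
  obtain ⟨s₂, hs₂, e₂⟩ := intermediate_value_Ioo hy0.le (hcont.mono (hord.out h0 hy)) ⟨h, hyr⟩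
  have m₁ : s₁ ∈ T := hord.out hx h0 ⟨hs₁.1.le, hs₁.2.le⟩
  have m₂ : s₂ ∈ T := hord.out h0 hy ⟨hs₂.1.le, hs₂.2.le⟩
  have hlt : s₁ < s₂ := hs₁.2.trans hs₂.1
  rw [Set.ncard_eq_two]
  refine ⟨s₁, s₂, hlt.ne, ?_⟩
  ext t
  simp only [Set.mem_ofPred_eq, Set.mem_insert_iff, Set.mem_singleton_iff]
  constructor
  · rintro ⟨ht, e⟩
    by_contra! hne
    rcases lt_or_gt_of_ne hne.1 with h1 | h1
    · exact not_three_levels htan ht m₁ m₂ h1 hlt e e₁ e₂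
    · rcases lt_or_gt_of_ne hne.2 with h2 | h2
      · exact not_three_levels htan m₁ ht m₂ h1 h2 e₁ e e₂
      · exact not_three_levels htan m₁ m₂ ht hlt h2 e₁ e₂ e
  · rintro (rfl | rfl)
    · exact ⟨m₁, e₁⟩
    · exact ⟨m₂, e₂⟩

end Level

/-! ### Counting solutions in each parameter interval -/

section Roots

variable {a b : ℝ} {v : ℝ × ℝ}

theorem tendsto_div_sq_atTop {c x : ℝ} (hc : 0 < c) (hx : x ≠ 0) :
    Tendsto (fun t => c * x ^ 2 / (1 - c * t) ^ 2) (𝓝[≠] (1 / c)) atTop := by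
  have h1 : Tendsto (fun t => (1 - c * t) ^ 2) (𝓝[≠] (1 / c)) (𝓝[>] 0) := by
    refine tendsto_nhdsWithin_iff.2 ⟨?_, ?_⟩
    · have : ContinuousAt (fun t => (1 - c * t) ^ 2) (1 / c) := by fun_prop
      have h := this.tendsto.mono_left (nhdsWithin_le_nhds (s := {1 / c}ᶜ))
      simpa [hc.ne'] using h
    · filter_upwards [self_mem_nhdsWithin] with t ht
      have : 1 - c * t ≠ 0 := fun h => ht (by
        rw [Set.mem_singleton_iff, eq_div_iff hc.ne']; linarith)
      exact Set.mem_Ioi.2 (by positivity)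
  have := (tendsto_inv_nhdsGT_zero.comp h1).const_mul_atTop (by positivity : 0 < c * x ^ 2)
  simpa [Function.comp_def, div_eq_mul_inv] using this

theorem le_height (ha : 0 < a) (hb : 0 < b) (t : ℝ) :
    t ≤ height a b v t ∧ t + a * v.1 ^ 2 / (1 - a * t) ^ 2 / 2 ≤ height a b v t ∧
      t + b * v.2 ^ 2 / (1 - b * t) ^ 2 / 2 ≤ height a b v t := by
  have h1 : 0 ≤ a * v.1 ^ 2 / (1 - a * t) ^ 2 := by positivity
  have h2 : 0 ≤ b * v.2 ^ 2 / (1 - b * t) ^ 2 := by positivity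
  unfold height
  refine ⟨?_, ?_, ?_⟩ <;> linarith

theorem exists_height_gt_right {c x t₀ : ℝ} {f : ℝ → ℝ} (hc : 0 < c) (hx : x ≠ 0)
    (hf : ∀ t, 1 / c < t → c * x ^ 2 / (1 - c * t) ^ 2 / 2 ≤ f t) (h : 1 / c < t₀) (r : ℝ) :
    ∃ t, 1 / c < t ∧ t < t₀ ∧ r < f t := by
  have h1 : Tendsto _ (𝓝[>] (1 / c)) atTop := (tendsto_div_sq_atTop hc hx).mono_left
    (nhdsWithin_mono _ fun t (ht : 1 / c < t) => ht.ne')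
  obtain ⟨t, ht, ht'⟩ := ((h1.eventually_gt_atTop (2 * r)).and (Ioo_mem_nhdsGT h)).exists
  refine ⟨t, ht'.1, ht'.2, ?_⟩
  have := hf t ht'.1
  linarith

theorem exists_height_gt_left {c x t₀ t₁ : ℝ} {f : ℝ → ℝ} (hc : 0 < c) (hx : x ≠ 0)
    (hf : ∀ t, t₁ < t → c * x ^ 2 / (1 - c * t) ^ 2 / 2 ≤ f t) (h : t₀ < 1 / c) (h' : t₁ < t₀)
    (r : ℝ) : ∃ t, t < 1 / c ∧ t₀ < t ∧ r < f t := by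
  have h1 : Tendsto _ (𝓝[<] (1 / c)) atTop := (tendsto_div_sq_atTop hc hx).mono_left
    (nhdsWithin_mono _ fun t (ht : t < 1 / c) => ht.ne)
  obtain ⟨t, ht, ht'⟩ := ((h1.eventually_gt_atTop (2 * r)).and (Ioo_mem_nhdsLT h)).exists
  refine ⟨t, ht'.2, ht'.1, ?_⟩
  have := hf t (h'.trans ht'.1)
  linarith

theorem continuousAt_height {t : ℝ} (h1 : a * t ≠ 1) (h2 : b * t ≠ 1) :
    ContinuousAt (height a b v) t := by
  have h1' : (1 - a * t) ^ 2 ≠ 0 := pow_ne_zero _ fun h => h1 (by linarith)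
  have h2' : (1 - b * t) ^ 2 ≠ 0 := pow_ne_zero _ fun h => h2 (by linarith)
  unfold height
  fun_prop (disch := assumption)

/-- The hypotheses `hl` and `hr` express coercivity at both ends of `T`, which is needed only to
obtain two solutions when the minimum is below the surface. -/
theorem level_ncard {T : Set ℝ} {t₀ : ℝ} (hord : T.OrdConnected)
    (hT : ∀ s ∈ T, 0 < s ∧ a * s ≠ 1 ∧ b * s ≠ 1)
    (htan : ∀ t ∈ T, ∀ s ∈ T, s ≠ t →
      height a b v t + heightSlope a b v t * (s - t) < height a b v s)
    (h0 : t₀ ∈ T) (hmin : ∀ s ∈ T, height a b v t₀ ≤ height a b v s)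
    (hlt : IsMinParam a b T v t₀ →
      (a * v.1 ^ 2 + b * v.2 ^ 2) / 2 < height a b v t₀ → envelope a b T v < 1)
    (hl : ∀ r, ∃ t ∈ T, t < t₀ ∧ r < height a b v t)
    (hr : ∀ r, ∃ t ∈ T, t₀ < t ∧ r < height a b v t) :
    {t ∈ T | height a b v t = (a * v.1 ^ 2 + b * v.2 ^ 2) / 2}.ncard =
      crossings (envelope a b T v) := by
  have hM : IsMinParam a b T v t₀ :=
    ⟨subset_closure h0, Or.inr (hT _ h0).2.1, Or.inr (hT _ h0).2.2, hmin⟩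
  rcases lt_trichotomy ((a * v.1 ^ 2 + b * v.2 ^ 2) / 2) (height a b v t₀) with h | h | h
  · rw [level_eq_empty hmin h, crossings_of_lt (hlt hM h), Set.ncard_empty]
  · rw [h, level_eq_singleton hord htan h0 hmin,
      hM.envelope_eq_one (fun s hs => (hT s hs).1) (hT _ h0).1 (fun s hs => (hT s hs).2) h.symm,
      crossings_one, Set.ncard_singleton]
  · rw [crossings_of_gt (hM.one_lt_envelope (hT _ h0).1 h)]
    exact level_ncard_two hord
      (fun t ht => (continuousAt_height (hT t ht).2.1 (hT t ht).2.2).continuousWithinAt) htan h0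
      (hl _) (hr _) h

theorem innerParams_spec (ha : 0 < a) (hb : 0 < b) {s : ℝ} (hs : s ∈ innerParams a b) :
    0 < s ∧ a * s ≠ 1 ∧ b * s ≠ 1 := by
  obtain ⟨h1, h2⟩ := (mem_innerParams ha hb).1 hs
  exact ⟨pos_of_one_le_mul hb h1.le, h2.ne, h1.ne'⟩

theorem outerParams_spec (ha : 0 < a) (hab : a < b) {s : ℝ} (hs : s ∈ outerParams a) :
    0 < s ∧ a * s ≠ 1 ∧ b * s ≠ 1 := by
  have h1 := (mem_outerParams ha).1 hs
  have h0 := pos_of_one_le_mul ha h1.le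
  exact ⟨h0, h1.ne', (h1.trans (mul_lt_mul_params hab h0)).ne'⟩

theorem exists_innerParams_min (ha : 0 < a) (hab : a < b) (h1 : v.1 ≠ 0) (h2 : v.2 ≠ 0) :
    ∃ t ∈ innerParams a b, ∀ s ∈ innerParams a b, height a b v t ≤ height a b v s := by
  obtain ⟨C, hC, e0, e1⟩ := exists_mem_innerCaustic ha hab v
  obtain ⟨t, ht, -, -⟩ := isMinParam_of_mem_innerCaustic ha hab hC
  rw [e0, e1] at ht
  obtain ⟨k1, k2⟩ := (mem_closure_innerParams ha hab).1 ht.mem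
  exact ⟨t, (mem_innerParams ha (ha.trans hab)).2
    ⟨lt_of_le_of_ne k1 (ht.snd.resolve_left h2).symm, lt_of_le_of_ne k2 (ht.fst.resolve_left h1)⟩,
    ht.le⟩

theorem exists_outerParams_min (ha : 0 < a) (hab : a < b) (h1 : v.1 ≠ 0) :
    ∃ t ∈ outerParams a, ∀ s ∈ outerParams a, height a b v t ≤ height a b v s := by
  obtain ⟨C, hC, e0, e1⟩ := exists_mem_outerCaustic ha hab v
  obtain ⟨t, ht, -, -⟩ := isMinParam_of_mem_outerCaustic ha hab hC
  rw [e0, e1] at ht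
  have k1 := (mem_closure_outerParams ha).1 ht.mem
  exact ⟨t, (mem_outerParams ha).2 (lt_of_le_of_ne k1 (ht.fst.resolve_left h1).symm), ht.le⟩

theorem inner_roots_ncard (ha : 0 < a) (hab : a < b) (h1 : v.1 ≠ 0) (h2 : v.2 ≠ 0) :
    {t ∈ innerParams a b | height a b v t = (a * v.1 ^ 2 + b * v.2 ^ 2) / 2}.ncard =
      crossings (envelope a b (innerParams a b) v) := by
  have hb := ha.trans hab
  obtain ⟨t₀, ht₀, hmin⟩ := exists_innerParams_min ha hab h1 h2
  refine level_ncard Set.ordConnected_Ioo (fun s => innerParams_spec ha hb)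
    (fun t ht s hs hne => ?_) ht₀ hmin (fun h => h.envelope_inner_lt_one ha hab)
    (fun r => ?_) (fun r => ?_)
  · obtain ⟨hs1, hs2⟩ := (mem_innerParams ha hb).1 hs
    obtain ⟨ht1, ht2⟩ := (mem_innerParams ha hb).1 ht
    exact height_tangent_lt ha hb (Or.inr (mul_pos (by linarith) (by linarith)))
      (Or.inr (mul_pos_of_neg_of_neg (by linarith) (by linarith))) h1 hne
  · obtain ⟨t, k1, k2, k3⟩ := exists_height_gt_right (f := height a b v) hb h2 (fun t ht => by
      have := (le_height (v := v) ha hb t).2.2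
      have : 0 < 1 / b := by positivity
      linarith) ht₀.1 r
    exact ⟨t, ⟨k1, k2.trans ht₀.2⟩, k2, k3⟩
  · obtain ⟨t, k1, k2, k3⟩ := exists_height_gt_left (f := height a b v) ha h1 (fun t ht => by
      have := (le_height (v := v) ha hb t).2.1
      have : 0 < 1 / b := by positivity
      linarith) ht₀.2 ht₀.1 r
    exact ⟨t, ⟨ht₀.1.trans k2, k1⟩, k2, k3⟩

theorem outer_roots_ncard (ha : 0 < a) (hab : a < b) (h1 : v.1 ≠ 0) :
    {t ∈ outerParams a | height a b v t = (a * v.1 ^ 2 + b * v.2 ^ 2) / 2}.ncard =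
      crossings (envelope a b (outerParams a) v) := by
  have hb := ha.trans hab
  obtain ⟨t₀, ht₀, hmin⟩ := exists_outerParams_min ha hab h1
  refine level_ncard Set.ordConnected_Ioi (fun s => outerParams_spec ha hab)
    (fun t ht s hs hne => ?_) ht₀ hmin (fun h => h.envelope_outer_lt_one ha hab)
    (fun r => ?_) (fun r => ?_)
  · have hs1 := (mem_outerParams ha).1 hs
    have ht1 := (mem_outerParams ha).1 ht
    have hs2 := mul_lt_mul_params hab (outerParams_spec ha hab hs).1
    have ht2 := mul_lt_mul_params hab (outerParams_spec ha hab ht).1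
    exact height_tangent_lt ha hb (Or.inr (mul_pos_of_neg_of_neg (by linarith) (by linarith)))
      (Or.inr (mul_pos_of_neg_of_neg (by linarith) (by linarith))) h1 hne
  · obtain ⟨t, k1, k2, k3⟩ := exists_height_gt_right (f := height a b v) ha h1 (fun t ht => by
      have := (le_height (v := v) ha hb t).2.1
      have : 0 < 1 / a := by positivity
      linarith) ht₀ r
    exact ⟨t, k1, k2, k3⟩
  · refine ⟨max (t₀ + 1) (r + 1), ?_, ?_, ?_⟩
    · have := le_max_left (t₀ + 1) (r + 1)
      have h : 1 / a < t₀ := ht₀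
      exact Set.mem_Ioi.2 (by linarith)
    · have := le_max_left (t₀ + 1) (r + 1)
      linarith
    · have := le_max_right (t₀ + 1) (r + 1)
      have := (le_height (v := v) ha hb (max (t₀ + 1) (r + 1))).1
      linarith

theorem rate_nonpos {t : ℝ} (h1 : a * t ≤ 2) (h2 : b * t ≤ 2) : rate a b v t ≤ 0 := by
  have e1 := mul_nonpos_of_nonneg_of_nonpos (by positivity : 0 ≤ a ^ 2 * v.1 ^ 2)
    (profile_nonpos h1)
  have e2 := mul_nonpos_of_nonneg_of_nonpos (by positivity : 0 ≤ b ^ 2 * v.2 ^ 2)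
    (profile_nonpos h2)
  unfold rate
  linarith

theorem height_eq_iff {t : ℝ} (h1 : v.1 = 0 ∨ a * t ≠ 1) (h2 : v.2 = 0 ∨ b * t ≠ 1) :
    height a b v t = (a * v.1 ^ 2 + b * v.2 ^ 2) / 2 ↔ t = 0 ∨ rate a b v t = 1 := by
  rw [← sub_eq_zero, height_sub h1 h2, mul_eq_zero, sub_eq_zero, eq_comm (a := (1 : ℝ))]

theorem innerEnvelope_nonpos_of_snd (ha : 0 < a) (hab : a < b) (h : v.2 = 0) :
    envelope a b (innerParams a b) v ≤ 0 :=
  envelope_le (innerParams_nonempty ha hab) fun t ht => by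
    have h1 := ((mem_innerParams ha (ha.trans hab)).1 ht).2
    have := mul_nonpos_of_nonneg_of_nonpos (by positivity : 0 ≤ a ^ 2 * v.1 ^ 2)
      (profile_neg h1).le
    simpa [rate, h] using this

theorem roots_eq_empty {T : Set ℝ} (hT : ∀ s ∈ T, 0 < s ∧ a * s ≠ 1 ∧ b * s ≠ 1)
    (h : envelope a b T v < 1) :
    {t ∈ T | height a b v t = (a * v.1 ^ 2 + b * v.2 ^ 2) / 2} = ∅ := by
  ext t
  simp only [Set.mem_ofPred_eq, Set.mem_empty_iff_false, iff_false, not_and]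
  intro ht e
  obtain ⟨k0, k1, k2⟩ := hT t ht
  have := ((height_eq_iff (Or.inr k1) (Or.inr k2)).1 e).resolve_left k0.ne'
  linarith [rate_le_envelope (a := a) (b := b) (v := v) ht]

/-- For `q = 0` the pole at `1/b` is gone and coercivity fails there, but the form is nonpositive,
so there are no solutions at all. -/
theorem inner_roots_ncard' (ha : 0 < a) (hab : a < b) (h1 : v.1 ≠ 0) :
    {t ∈ innerParams a b | height a b v t = (a * v.1 ^ 2 + b * v.2 ^ 2) / 2}.ncard =
      crossings (envelope a b (innerParams a b) v) := by
  rcases eq_or_ne v.2 0 with h2 | h2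
  · have hlt := (innerEnvelope_nonpos_of_snd (v := v) ha hab h2).trans_lt one_pos
    rw [crossings_of_lt hlt, roots_eq_empty (fun s => innerParams_spec ha (ha.trans hab)) hlt,
      Set.ncard_empty]
  · exact inner_roots_ncard ha hab h1 h2

end Roots

/-! ### From parameters to normals -/

section Feet

variable {a b : ℝ}

/-- Coordinates of the feet of the normals through `A`. -/
def feet (a b : ℝ) (A : Space) : Set (ℝ × ℝ) :=
  {w | ∃ t, A 0 = w.1 * (1 - a * t) ∧ A 1 = w.2 * (1 - b * t) ∧
    A 2 = t + (a * w.1 ^ 2 + b * w.2 ^ 2) / 2}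

theorem mem_normalLine_lift {A : Space} {w : ℝ × ℝ} :
    A ∈ normalLine a b (lift a b w) ↔ w ∈ feet a b A := by
  rw [normalLine, AffineSubspace.mem_mk', Submodule.mem_span_singleton]
  constructor
  · rintro ⟨t, ht⟩
    have e := fun i => congrArg (fun B : Space => B i) ht
    have e0 := e 0
    have e1 := e 1
    have e2 := e 2
    simp [normalVector] at e0 e1 e2
    exact ⟨t, by linarith, by linarith, by linarith⟩
  · rintro ⟨t, h0, h1, h2⟩
    refine ⟨t, space_ext ?_ ?_ ?_⟩ <;> simp [normalVector] <;> linarith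

/-- If a line were normal at two points, going back and forth would use opposite parameters `t` and
`-t`. The coordinates would satisfy `p = p(1-a²t²)` and its analogue, so both points would be the
vertex. Counting lines is therefore counting feet. -/
theorem normalLine_lift_injective (ha : 0 < a) (hb : 0 < b) :
    Function.Injective fun w => normalLine a b (lift a b w) := by
  intro v w h
  simp only at h
  have h1 : v ∈ feet a b (lift a b w) := by
    rw [← mem_normalLine_lift, h]; exact AffineSubspace.self_mem_mk' _ _
  have h2 : w ∈ feet a b (lift a b v) := by
    rw [← mem_normalLine_lift, ← h]; exact AffineSubspace.self_mem_mk' _ _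
  obtain ⟨t, t0, t1, t2⟩ := h1
  obtain ⟨s, s0, s1, s2⟩ := h2
  simp only [lift_zero, lift_one, lift_two] at *
  have e : s = -t := by linarith
  subst e
  rcases eq_or_ne t 0 with rfl | ht
  · exact Prod.ext (by linarith) (by linarith)
  · have k1 : (a * t) ^ 2 * v.1 = 0 := by linear_combination (1 + a * t) * t0 - s0 + 2 * s0
    have k2 : (b * t) ^ 2 * v.2 = 0 := by linear_combination (1 + b * t) * t1 - s1 + 2 * s1
    have k1' := (mul_eq_zero.1 k1).resolve_left (by positivity)
    have k2' := (mul_eq_zero.1 k2).resolve_left (by positivity)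
    exact Prod.ext (by rw [t0, k1']; simp) (by rw [t1, k2']; simp)

theorem normalCount_eq_ncard_feet (ha : 0 < a) (hb : 0 < b) (A : Space) :
    normalCount a b A = (feet a b A).ncard := by
  rw [← Set.ncard_image_of_injective _ (normalLine_lift_injective ha hb), normalCount]
  congr 1
  ext L
  simp only [Set.mem_ofPred_eq, Set.mem_image]
  constructor
  · rintro ⟨B, hB, rfl, hA⟩
    rw [eq_lift hB] at hA ⊢
    exact ⟨_, mem_normalLine_lift.1 hA, rfl⟩
  · rintro ⟨w, hw, rfl⟩
    exact ⟨_, lift_mem a b w, rfl, mem_normalLine_lift.2 hw⟩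

theorem feet_eq_image (ha : 0 < a) (hab : a < b) {v : ℝ × ℝ} (h1 : v.1 ≠ 0) :
    feet a b (lift a b v) = (fun t => (v.1 / (1 - a * t), v.2 / (1 - b * t))) ''
      {t | a * t ≠ 1 ∧ b * t ≠ 1 ∧ height a b v t = (a * v.1 ^ 2 + b * v.2 ^ 2) / 2} := by
  have hb := ha.trans hab
  ext w
  simp only [feet, lift_zero, lift_one, lift_two, Set.mem_ofPred_eq, Set.mem_image]
  constructor
  · rintro ⟨t, e0, e1, e2⟩
    have ka : a * t ≠ 1 := by
      intro h; rw [h, sub_self, mul_zero] at e0; exact h1 e0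
    have kb : b * t ≠ 1 := by
      intro h
      rw [h, sub_self, mul_zero] at e1
      -- At `bt = 1` the target has `q = 0`, and its foot has `|x| ≥ |p|` because `0 < at < 1`. The
      -- normal then passes strictly above the paraboloid over `v`; so this asymptote carries no
      -- normal.
      have ht : 0 < t := pos_of_one_le_mul hb h.ge
      have := mul_lt_mul_params hab ht
      have : v.1 ^ 2 ≤ w.1 ^ 2 := by
        have hat : 0 < a * t := by positivity
        rw [e0, mul_pow]
        have : (1 - a * t) ^ 2 ≤ 1 := by nlinarith
        nlinarith [sq_nonneg w.1]
      rw [e1] at e2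
      have := mul_le_mul_of_nonneg_left this ha.le
      have : 0 ≤ b * w.2 ^ 2 := by positivity
      nlinarith
    have ka' : 1 - a * t ≠ 0 := fun h => ka (by linarith)
    have kb' : 1 - b * t ≠ 0 := fun h => kb (by linarith)
    refine ⟨t, ⟨ka, kb, ?_⟩, Prod.ext ?_ ?_⟩
    · have := height_normal (a := a) (b := b) (x := w.1) (y := w.2) (Or.inr ka) (Or.inr kb)
      rw [← e0, ← e1, ← e2] at this
      exact this
    · simp only; rw [e0, mul_div_cancel_right₀ _ ka']
    · simp only; rw [e1, mul_div_cancel_right₀ _ kb']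
  · rintro ⟨t, ⟨ka, kb, h⟩, rfl⟩
    have ka' : 1 - a * t ≠ 0 := fun h => ka (by linarith)
    have kb' : 1 - b * t ≠ 0 := fun h => kb (by linarith)
    refine ⟨t, (div_mul_cancel₀ _ ka').symm, (div_mul_cancel₀ _ kb').symm, ?_⟩
    rw [← h, height]
    simp only [div_pow, mul_div_assoc]

theorem root_params_eq (ha : 0 < a) (hab : a < b) (v : ℝ × ℝ) :
    {t | a * t ≠ 1 ∧ b * t ≠ 1 ∧ height a b v t = (a * v.1 ^ 2 + b * v.2 ^ 2) / 2} =
      {0} ∪ {t ∈ innerParams a b | height a b v t = (a * v.1 ^ 2 + b * v.2 ^ 2) / 2} ∪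
        {t ∈ outerParams a | height a b v t = (a * v.1 ^ 2 + b * v.2 ^ 2) / 2} := by
  have hb := ha.trans hab
  ext t
  simp only [Set.mem_ofPred_eq, Set.mem_union, Set.mem_singleton_iff]
  constructor
  · rintro ⟨h1, h2, h⟩
    rcases eq_or_ne t 0 with h0 | h0
    · exact Or.inl (Or.inl h0)
    have hr := ((height_eq_iff (Or.inr h1) (Or.inr h2)).1 h).resolve_left h0
    rcases lt_or_gt_of_ne h1 with k1 | k1
    · refine Or.inl (Or.inr ⟨(mem_innerParams ha hb).2 ⟨?_, k1⟩, h⟩)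
      -- For `bt ≤ 1`, negative `t` included, both profiles are nonpositive, so the rate cannot be
      -- 1.
      by_contra! hc
      have := rate_nonpos (v := v) (by linarith : a * t ≤ 2) (by linarith : b * t ≤ 2)
      linarith
    · exact Or.inr ⟨(mem_outerParams ha).2 k1, h⟩
  · rintro ((rfl | ⟨h, h'⟩) | ⟨h, h'⟩)
    · simp [height]
    · exact ⟨(innerParams_spec ha hb h).2.1, (innerParams_spec ha hb h).2.2, h'⟩
    · exact ⟨(outerParams_spec ha hab h).2.1, (outerParams_spec ha hab h).2.2, h'⟩

/-- `Set.ncard` is 0 for infinite sets. A nonzero value proves finiteness, and the value 0 arises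
only for `G < 1`, where the set is known to be empty. -/
theorem crossings_finite {S : Set ℝ} {G : ℝ} (hS : S.ncard = crossings G) (h : G < 1 → S = ∅) :
    S.Finite := by
  rcases lt_or_ge G 1 with hG | hG
  · rw [h hG]; exact Set.finite_empty
  · refine Set.finite_of_ncard_ne_zero ?_
    rw [hS, crossings, if_neg hG.not_gt]
    split_ifs <;> norm_num

theorem normalCount_of_fst_ne_zero (ha : 0 < a) (hab : a < b) {v : ℝ × ℝ} (h1 : v.1 ≠ 0) :
    normalCount a b (lift a b v) = 1 + crossings (envelope a b (innerParams a b) v) +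
      crossings (envelope a b (outerParams a) v) := by
  have hb := ha.trans hab
  have hi := inner_roots_ncard' ha hab h1
  have ho := outer_roots_ncard ha hab h1
  rw [normalCount_eq_ncard_feet ha hb, feet_eq_image ha hab h1, Set.InjOn.ncard_image,
    root_params_eq ha hab, ← hi, ← ho]
  · have fi := crossings_finite hi (roots_eq_empty fun s => innerParams_spec ha hb)
    have fo := crossings_finite ho (roots_eq_empty fun s => outerParams_spec ha hab)
    rw [Set.ncard_union_eq _ ((Set.finite_singleton _).union fi) fo, Set.ncard_union_eq _
      (Set.finite_singleton _) fi, Set.ncard_singleton]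
    · rw [Set.disjoint_left]
      rintro _ rfl ⟨h, -⟩
      exact (innerParams_spec ha hb h).1.ne' rfl
    · rw [Set.disjoint_left]
      rintro t (rfl | ⟨h, -⟩) ⟨h', -⟩
      · exact (outerParams_spec ha hab h').1.ne' rfl
      · exact absurd ((mem_outerParams ha).1 h') ((mem_innerParams ha hb).1 h).2.not_gt
  · rintro t ⟨ht, -, -⟩ s ⟨hs, -, -⟩ e
    have e := congrArg Prod.fst e
    simp only at e
    have ht' : 1 - a * t ≠ 0 := fun h => ht (by linarith)
    have hs' : 1 - a * s ≠ 0 := fun h => hs (by linarith)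
    rw [div_eq_div_iff ht' hs'] at e
    have := mul_left_cancel₀ h1 e
    exact mul_left_cancel₀ ha.ne' (by linarith)

end Feet


/-! ### The plane of symmetry `x = 0` -/

section Axis

variable {a b : ℝ}

/-- The shift `1 + c` lets `crossings` count real square roots by the sign of `c`. -/
theorem sq_solutions (c : ℝ) :
    {z : ℝ | z ^ 2 = c}.Finite ∧ {z : ℝ | z ^ 2 = c}.ncard = crossings (1 + c) := by
  rcases lt_trichotomy c 0 with h | rfl | h
  · have : {z : ℝ | z ^ 2 = c} = ∅ := by
      ext z
      simp only [Set.mem_ofPred_eq, Set.mem_empty_iff_false, iff_false]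
      nlinarith [sq_nonneg z]
    rw [this, crossings_of_lt (by linarith)]
    simp
  · have : {z : ℝ | z ^ 2 = 0} = {0} := by
      ext z
      simp
    rw [this, add_zero, crossings_one]
    simp
  · have : {z : ℝ | z ^ 2 = c} = {Real.sqrt c, -Real.sqrt c} := by
      ext z
      simp only [Set.mem_ofPred_eq, Set.mem_insert_iff, Set.mem_singleton_iff]
      nth_rewrite 1 [← Real.sq_sqrt h.le]
      exact sq_eq_sq_iff_eq_or_eq_neg
    have hs := Real.sqrt_pos.2 h
    rw [this, crossings_of_gt (by linarith), Set.ncard_pair (by linarith)]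
    simp

theorem sq_solutions_affine {k l : ℝ} (hk : k ≠ 0) (c : ℝ) :
    {z : ℝ | (k * z + l) ^ 2 = c}.Finite ∧
      {z : ℝ | (k * z + l) ^ 2 = c}.ncard = crossings (1 + c) := by
  obtain ⟨h1, h2⟩ := sq_solutions c
  have hinj : Function.Injective fun z : ℝ => (z - l) / k := fun x y h => by
    have := (div_left_inj' hk).1 h
    linarith
  have e : {z : ℝ | (k * z + l) ^ 2 = c} = (fun z : ℝ => (z - l) / k) '' {z : ℝ | z ^ 2 = c} := by
    ext z
    simp only [Set.mem_ofPred_eq, Set.mem_image]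
    constructor
    · intro h
      exact ⟨k * z + l, h, by field_simp; ring⟩
    · rintro ⟨w, h, rfl⟩
      rw [mul_div_cancel₀ _ hk, sub_add_cancel]
      exact h
  rw [e, Set.ncard_image_of_injective _ hinj, h2]
  exact ⟨h1.image _, rfl⟩

/-- The limit of `rate` over `(0, q)` at the asymptote `t = 1 / a`. -/
noncomputable def axisRate (a b q : ℝ) : ℝ := b ^ 2 * q ^ 2 * profile (b / a)

theorem axisRate_eq (ha : 0 < a) (hab : a < b) (q : ℝ) :
    axisRate a b q = b * q ^ 2 * (a * (b - 2 * a)) * b / (2 * (b - a) ^ 2) := by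
  have : b - a ≠ 0 := by linarith
  unfold axisRate profile
  rw [show b / a - 2 = (b - 2 * a) / a by field_simp, show b / a - 1 = (b - a) / a by field_simp]
  field_simp

/-- Three kinds of feet occur: the point itself, feet in the plane `x = 0`, and feet off this plane,
which force `t = 1/a`. The value `x = 0` is removed from the last kind to keep the kinds disjoint.
-/
theorem feet_axis (ha : 0 < a) (hab : a < b) (q : ℝ) :
    feet a b (lift a b (0, q)) = {((0 : ℝ), q)} ∪
      (fun y => ((0 : ℝ), y)) '' {y | (2 * b * y + b * q) ^ 2 = b ^ 2 * q ^ 2 - 8} ∪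
      (fun x => (x, q / (1 - b / a))) '' ({x | (a * x + 0) ^ 2 = 2 * (axisRate a b q - 1)} \ {0}) := by
  have hb := ha.trans hab
  have hba : b - a ≠ 0 := by linarith
  have hba' : 1 - b / a ≠ 0 := by
    have : 1 < b / a := (one_lt_div ha).2 hab
    linarith
  have key : ∀ x : ℝ, (a * x + 0) ^ 2 = 2 * (axisRate a b q - 1) ↔
      b * q ^ 2 / 2 = 1 / a + (a * x ^ 2 + b * (q / (1 - b / a)) ^ 2) / 2 := by
    intro x
    rw [axisRate_eq ha hab, show 1 - b / a = (a - b) / a by field_simp]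
    have : a - b ≠ 0 := by linarith
    rw [show (b - a) ^ 2 = (a - b) ^ 2 by ring]
    field_simp
    constructor <;> intro h <;> linear_combination -h
  ext ⟨x, y⟩
  simp only [feet, lift_zero, lift_one, lift_two, Set.mem_ofPred_eq, Set.mem_image, Set.mem_union,
    Set.mem_singleton_iff, Set.mem_sdiff, Prod.mk.injEq]
  constructor
  · rintro ⟨t, e0, e1, e2⟩
    rcases eq_or_ne x 0 with rfl | hx
    · left
      -- Eliminating `t = b(q² - y²)/2` leaves a cubic in `y` with the trivial root `q`; completing
      -- the square in the other factor gives the condition in the statement.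
      have h : (y - q) * (b ^ 2 * (y * (y + q)) + 2) = 0 := by
        have ht : t = b * (q ^ 2 - y ^ 2) / 2 := by linear_combination -e2
        rw [ht] at e1
        linear_combination -2 * e1
      rcases mul_eq_zero.1 h with h | h
      · exact Or.inl ⟨rfl, by linarith⟩
      · exact Or.inr ⟨y, by linear_combination 4 * h, rfl, rfl⟩
    · right
      have hat : 1 - a * t = 0 := (mul_eq_zero.1 e0.symm).resolve_left hx
      have ht : t = 1 / a := by field_simp; linarith
      subst ht
      rw [mul_one_div] at e1
      have hy : y = q / (1 - b / a) := by rw [e1, mul_div_cancel_right₀ _ hba']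
      refine ⟨x, ⟨(key x).2 ?_, hx⟩, rfl, hy.symm⟩
      rw [← hy]
      linear_combination e2
  · rintro ((⟨rfl, rfl⟩ | ⟨y', h, rfl, rfl⟩) | ⟨x', ⟨h, hx⟩, rfl, rfl⟩)
    · exact ⟨0, by simp, by simp, by simp⟩
    · refine ⟨b * (q ^ 2 - y' ^ 2) / 2, by simp, ?_, by ring⟩
      linear_combination -(1 / 8) * (y' - q) * h
    · refine ⟨1 / a, ?_, ?_, ?_⟩
      · rw [mul_one_div_cancel ha.ne']; simp
      · rw [mul_one_div, div_mul_cancel₀ _ hba']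
      · have := (key x').1 h
        linear_combination this

/-- The off-plane feet come in pairs `±x`. At `axisRate = 1` the pair merges at `x = 0` and
contributes nothing, whereas the generic formula would count 1. -/
theorem normalCount_axis (ha : 0 < a) (hab : a < b) (q : ℝ) :
    normalCount a b (lift a b (0, q)) =
      1 + crossings (b ^ 2 * q ^ 2 / 8) + if 1 < axisRate a b q then 2 else 0 := by
  have hb := ha.trans hab
  obtain ⟨f1, c1⟩ := sq_solutions_affine (by positivity : 2 * b ≠ 0) (l := b * q)
    (b ^ 2 * q ^ 2 - 8)
  obtain ⟨f2, c2⟩ := sq_solutions_affine ha.ne' (l := 0) (2 * (axisRate a b q - 1))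
  have i1 : Function.Injective fun y : ℝ => ((0 : ℝ), y) := fun x y h => (Prod.mk.inj h).2
  have i2 : Function.Injective fun x : ℝ => (x, q / (1 - b / a)) := fun x y h => (Prod.mk.inj h).1
  rw [normalCount_eq_ncard_feet ha hb, feet_axis ha hab,
    Set.ncard_union_eq ?_ ((Set.finite_singleton _).union (f1.image _))
      ((f2.subset Set.sdiff_subset).image _),
    Set.ncard_union_eq ?_ (Set.finite_singleton _) (f1.image _), Set.ncard_singleton, Set.ncard_image_of_injective _ i1, Set.ncard_image_of_injective _ i2, c1]
  · congr 1
    · congr 1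
      rcases lt_trichotomy (b ^ 2 * q ^ 2) 8 with h | h | h
      · rw [crossings_of_lt (by linarith), crossings_of_lt (by linarith)]
      · rw [h]; norm_num
      · rw [crossings_of_gt (by linarith), crossings_of_gt (by linarith)]
    · split_ifs with h
      · rw [Set.sdiff_singleton_eq_self, c2, crossings_of_gt (by linarith)]
        simp only [Set.mem_ofPred_eq, mul_zero, add_zero]
        intro h'
        rw [zero_pow two_ne_zero] at h'
        linarith
      · rw [Set.ncard_eq_zero (f2.subset Set.sdiff_subset)]
        ext x
        simp only [Set.mem_sdiff, Set.mem_ofPred_eq, Set.mem_singleton_iff,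
          Set.mem_empty_iff_false, iff_false, not_and, not_not, add_zero]
        intro h'
        have : (a * x) ^ 2 = 0 := le_antisymm (by linarith) (sq_nonneg _)
        have := pow_eq_zero_iff two_ne_zero |>.1 this
        exact (mul_eq_zero.1 this).resolve_left ha.ne'
  · rw [Set.disjoint_left]
    rintro _ rfl ⟨y, h, e⟩
    have e := (Prod.mk.inj e).2
    subst e
    simp only [Set.mem_ofPred_eq] at h
    nlinarith [sq_nonneg (b * y)]
  · rw [Set.disjoint_left]
    rintro _ (rfl | ⟨y, h, rfl⟩) ⟨x, ⟨h', hx⟩, e⟩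
    · exact hx (Prod.mk.inj e).1
    · exact hx (Prod.mk.inj e).1

theorem mem_closure_outerParams_three (ha : 0 < a) (hb : 0 < b) (h : b ≤ 3 * a) :
    3 / b ∈ closure (outerParams a) := by
  rw [mem_closure_outerParams ha, ← mul_div_assoc, le_div_iff₀ hb]
  linarith

theorem one_div_mem_closures (ha : 0 < a) (hab : a < b) :
    1 / a ∈ closure (innerParams a b) ∧ 1 / a ∈ closure (outerParams a) := by
  constructor
  · rw [mem_closure_innerParams ha hab, mul_one_div_cancel ha.ne', mul_one_div, le_div_iff₀ ha]
    exact ⟨by linarith, le_rfl⟩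
  · rw [mem_closure_outerParams ha, mul_one_div_cancel ha.ne']

theorem rate_axis (q t : ℝ) : rate a b (0, q) t = b ^ 2 * q ^ 2 * profile (b * t) := by
  simp [rate]

theorem rate_axis_le (q t : ℝ) : rate a b (0, q) t ≤ b ^ 2 * q ^ 2 / 8 := by
  have := rate_le a b (0, q) t
  simpa using this

theorem rate_axis_three (hb : 0 < b) (q : ℝ) : rate a b (0, q) (3 / b) = b ^ 2 * q ^ 2 / 8 := by
  rw [rate_axis, mul_div_cancel₀ _ hb.ne', profile_three]; ring

theorem rate_axis_one_div (q : ℝ) : rate a b (0, q) (1 / a) = axisRate a b q := by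
  rw [rate_axis, mul_one_div, axisRate]

/-- On the axis only the profile at `bt` matters, with its maximum at `t = 3/b`. The interval whose
closure contains `3/b` sees `b²q²/8`; the other one, by monotonicity, sees the limit at its end
`1/a`. The roles change at `b = 3a`. -/
theorem outerEnvelope_axis_of_le (ha : 0 < a) (hab : a < b) (h : b ≤ 3 * a) (q : ℝ) :
    envelope a b (outerParams a) (0, q) = b ^ 2 * q ^ 2 / 8 := by
  have hb := ha.trans hab
  rw [← rate_axis_three (a := a) hb]
  refine envelope_eq_rate (mem_closure_outerParams_three ha hb h) (Or.inl rfl)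
    (Or.inr (by rw [mul_div_cancel₀ _ hb.ne']; norm_num)) fun s _ => ?_
  rw [rate_axis_three hb]
  exact rate_axis_le q s

theorem innerEnvelope_axis_of_le (ha : 0 < a) (hab : a < b) (h : b ≤ 3 * a) (q : ℝ) :
    envelope a b (innerParams a b) (0, q) = axisRate a b q := by
  have hb := ha.trans hab
  rw [← rate_axis_one_div]
  refine envelope_eq_rate (one_div_mem_closures ha hab).1 (Or.inl rfl)
    (Or.inr (by rw [mul_one_div]; exact ((one_lt_div ha).2 hab).ne')) fun s hs => ?_
  obtain ⟨h1, h2⟩ := (mem_innerParams ha hb).1 hs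
  rw [rate_axis, rate_axis, mul_one_div]
  refine mul_le_mul_of_nonneg_left (profile_mono h1 ?_ ?_) (by positivity)
  · rw [le_div_iff₀ ha]; nlinarith
  · rw [div_le_iff₀ ha]; exact h

theorem outerEnvelope_axis_of_ge (ha : 0 < a) (hab : a < b) (h : 3 * a ≤ b) (q : ℝ) :
    envelope a b (outerParams a) (0, q) = axisRate a b q := by
  have hb := ha.trans hab
  rw [← rate_axis_one_div]
  refine envelope_eq_rate (one_div_mem_closures ha hab).2 (Or.inl rfl)
    (Or.inr (by rw [mul_one_div]; exact ((one_lt_div ha).2 hab).ne')) fun s hs => ?_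
  have h1 := (mem_outerParams ha).1 hs
  rw [rate_axis, rate_axis, mul_one_div]
  refine mul_le_mul_of_nonneg_left (profile_anti ?_ ?_) (by positivity)
  · rw [le_div_iff₀ ha]; exact h
  · rw [div_le_iff₀ ha]; nlinarith

theorem innerEnvelope_axis_of_ge (ha : 0 < a) (hab : a < b) (h : 3 * a ≤ b) (q : ℝ) :
    envelope a b (innerParams a b) (0, q) = b ^ 2 * q ^ 2 / 8 := by
  have hb := ha.trans hab
  rw [← rate_axis_three (a := a) hb]
  refine envelope_eq_rate ?_ (Or.inl rfl)
    (Or.inr (by rw [mul_div_cancel₀ _ hb.ne']; norm_num)) fun s _ => ?_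
  · rw [mem_closure_innerParams ha hab, mul_div_cancel₀ _ hb.ne', ← mul_div_assoc, div_le_iff₀ hb]
    exact ⟨by norm_num, by linarith⟩
  · rw [rate_axis_three hb]
    exact rate_axis_le q s

theorem normalCount_eq (ha : 0 < a) (hab : a < b) {v : ℝ × ℝ}
    (h : v.1 = 0 → axisRate a b v.2 ≠ 1) :
    normalCount a b (lift a b v) = 1 + crossings (envelope a b (innerParams a b) v) +
      crossings (envelope a b (outerParams a) v) := by
  rcases eq_or_ne v.1 0 with h1 | h1
  · obtain ⟨p, q⟩ := v
    simp only at h1 h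
    subst h1
    have h := h rfl
    have e : (if 1 < axisRate a b q then 2 else 0) = crossings (axisRate a b q) := by
      rcases lt_or_gt_of_ne h with h | h
      · rw [crossings_of_lt h, if_neg h.not_gt]
      · rw [crossings_of_gt h, if_pos h]
    rw [normalCount_axis ha hab, e]
    rcases le_total b (3 * a) with h3 | h3
    · rw [innerEnvelope_axis_of_le ha hab h3, outerEnvelope_axis_of_le ha hab h3]; ring
    · rw [innerEnvelope_axis_of_ge ha hab h3, outerEnvelope_axis_of_ge ha hab h3]
  · exact normalCount_of_fst_ne_zero ha hab h1

end Axis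


/-! ### Where the two curves cross: double tangency -/

theorem quartic_deriv_eq_zero {c₃ c₂ c₁ c₀ t : ℝ}
    (h : ∀ᶠ s in 𝓝 t, 0 ≤ s ^ 4 + c₃ * s ^ 3 + c₂ * s ^ 2 + c₁ * s + c₀)
    (h0 : t ^ 4 + c₃ * t ^ 3 + c₂ * t ^ 2 + c₁ * t + c₀ = 0) :
    4 * t ^ 3 + 3 * c₃ * t ^ 2 + 2 * c₂ * t + c₁ = 0 := by
  have hmin : IsLocalMin (fun s : ℝ => s ^ 4 + c₃ * s ^ 3 + c₂ * s ^ 2 + c₁ * s + c₀) t := by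
    filter_upwards [h] with s hs
    rwa [h0]
  have hd : HasDerivAt (fun s : ℝ => s ^ 4 + c₃ * s ^ 3 + c₂ * s ^ 2 + c₁ * s + c₀)
      (4 * t ^ 3 + c₃ * (3 * t ^ 2) + c₂ * (2 * t) + c₁ * 1) t := by
    have h4 := hasDerivAt_pow 4 t
    have h3 := (hasDerivAt_pow 3 t).const_mul c₃
    have h2 := (hasDerivAt_pow 2 t).const_mul c₂
    have h1 := (hasDerivAt_id t).const_mul c₁
    have := (((h4.add h3).add h2).add h1).add_const c₀
    exact this.congr_deriv (by norm_num)
  linear_combination hmin.hasDerivAt_eq_zero hd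

/-- Two distinct double roots determine a monic quartic as the square of a quadratic. -/
theorem quartic_coeffs {c₃ c₂ c₁ c₀ t₁ t₂ : ℝ} (hne : t₁ ≠ t₂)
    (h1 : t₁ ^ 4 + c₃ * t₁ ^ 3 + c₂ * t₁ ^ 2 + c₁ * t₁ + c₀ = 0)
    (h2 : t₂ ^ 4 + c₃ * t₂ ^ 3 + c₂ * t₂ ^ 2 + c₁ * t₂ + c₀ = 0)
    (d1 : 4 * t₁ ^ 3 + 3 * c₃ * t₁ ^ 2 + 2 * c₂ * t₁ + c₁ = 0)
    (d2 : 4 * t₂ ^ 3 + 3 * c₃ * t₂ ^ 2 + 2 * c₂ * t₂ + c₁ = 0) (s : ℝ) :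
    s ^ 4 + c₃ * s ^ 3 + c₂ * s ^ 2 + c₁ * s + c₀ = ((s - t₁) * (s - t₂)) ^ 2 ∧
      4 * s ^ 3 + 3 * c₃ * s ^ 2 + 2 * c₂ * s + c₁ =
        2 * ((s - t₁) * (s - t₂)) * (2 * s - (t₁ + t₂)) ∧ c₃ = -2 * (t₁ + t₂) := by
  have hne' : t₁ - t₂ ≠ 0 := sub_ne_zero.2 hne
  have e3 : c₃ + 2 * (t₁ + t₂) = 0 := by
    apply (mul_eq_zero.1 (_ : (t₁ - t₂) ^ 3 * (c₃ + 2 * (t₁ + t₂)) = 0)).resolve_left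
    · positivity
    · linear_combination (t₁ - t₂) * (d1 + d2) - 2 * (h1 - h2)
  obtain rfl : c₃ = -2 * (t₁ + t₂) := by linarith
  have e2 : c₂ - ((t₁ + t₂) ^ 2 + 2 * (t₁ * t₂)) = 0 := by
    apply (mul_eq_zero.1 (_ : (t₁ - t₂) * (2 * _) = 0)).resolve_left hne' |> mul_eq_zero.1
      |>.resolve_left two_ne_zero
    linear_combination d1 - d2
  obtain rfl : c₂ = (t₁ + t₂) ^ 2 + 2 * (t₁ * t₂) := by linarith
  obtain rfl : c₁ = -2 * (t₁ + t₂) * (t₁ * t₂) := by linear_combination d1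
  obtain rfl : c₀ = (t₁ * t₂) ^ 2 := by linear_combination h1
  refine ⟨by ring, by ring, rfl⟩

/-- Here `u = 1/a`, `w = 1/b`, and `P`, `R` are half of `ap²`, `bq²`. At `u` only the term with `P`
survives in the value and in the derivative, so eliminating `P` gives a linear relation between
`(u-t₁)(u-t₂)` and `t₁+t₂`; likewise at `w` with `R`. The difference of the two products determines
`t₁+t₂`, and hence everything. -/
theorem double_tangency {u w P R t₁ t₂ : ℝ} (hw : 0 < w) (hwu : w < u) (h1 : w < t₁)
    (h1' : t₁ < u) (h2 : u < t₂)
    (e : ∀ s, 4 * s ^ 3 + 3 * (-2 * (u + w) - P - R) * s ^ 2 +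
      2 * ((u + w) ^ 2 + 2 * (u * w) + P * (2 * u + 2 * w) + R * (2 * u + 2 * w)) * s +
      (-2 * (u + w) * (u * w) - P * (w ^ 2 + 4 * u * w) - R * (u ^ 2 + 4 * u * w)) =
        2 * ((s - t₁) * (s - t₂)) * (2 * s - (t₁ + t₂)))
    (e' : ∀ s, (s - u) ^ 2 * (s - w) ^ 2 - P * (s - 2 * u) * (s - w) ^ 2 -
      R * (s - 2 * w) * (s - u) ^ 2 = ((s - t₁) * (s - t₂)) ^ 2) :
    3 * w < u ∧ P * (u + w) ^ 4 = 4 * u * ((u - w) * (u - 3 * w)) ^ 2 ∧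
      R * (u + w) ^ 4 = 4 * w * ((u - w) * (3 * u - w)) ^ 2 := by
  have hu : 0 < u := hw.trans hwu
  obtain ⟨s, hs⟩ : ∃ s, s = t₁ + t₂ := ⟨_, rfl⟩
  obtain ⟨g, hg⟩ : ∃ g, g = (u - t₁) * (u - t₂) := ⟨_, rfl⟩
  obtain ⟨h, hh⟩ : ∃ h, h = (w - t₁) * (w - t₂) := ⟨_, rfl⟩
  have hg0 : g < 0 := hg ▸ mul_neg_of_pos_of_neg (by linarith) (by linarith)
  have hh0 : 0 < h := hh ▸ mul_pos_of_neg_of_neg (by linarith) (by linarith)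
  have eu := e u
  have ew := e w
  have eu' := e' u
  have ew' := e' w
  rw [← hg, ← hs] at eu
  rw [← hh, ← hs] at ew
  rw [← hg] at eu'
  rw [← hh] at ew'
  have k1 : g * (u + w) = 2 * u * (u - w) * (2 * u - s) := by
    apply mul_left_cancel₀ hg0.ne
    linear_combination (-(u + w)) * eu' + u * (u - w) * eu
  have k2 : h * (u + w) = 2 * w * (w - u) * (2 * w - s) := by
    apply mul_left_cancel₀ hh0.ne'
    linear_combination (-(u + w)) * ew' + w * (w - u) * ew
  have k3 : s * (u + w) = 3 * u ^ 2 + 3 * w ^ 2 - 2 * u * w := by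
    have hne : u - w ≠ 0 := by linarith
    apply mul_left_cancel₀ hne
    have : g - h = (u - w) * (u + w - s) := by rw [hg, hh, hs]; ring
    linear_combination k1 - k2 - (u + w) * this
  have k4 : g * (u + w) ^ 2 = -(2 * u * (u - w) ^ 2 * (u - 3 * w)) := by
    linear_combination (u + w) * k1 - 2 * u * (u - w) * k3
  have k5 : h * (u + w) ^ 2 = 2 * w * (u - w) ^ 2 * (3 * u - w) := by
    linear_combination (u + w) * k2 - 2 * w * (w - u) * k3
  have hpos : 0 < (u - w) ^ 2 := by have : 0 < u - w := by linarith
                                    positivity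
  refine ⟨?_, ?_, ?_⟩
  -- The point `u` lies between the two double roots, so `g < 0`; the formula for `g` then requires
  -- `u > 3w`.
  · by_contra! hc
    have h1 : g * (u + w) ^ 2 < 0 := mul_neg_of_neg_of_pos hg0 (by positivity)
    have h2 : 2 * u * (u - w) ^ 2 * (u - 3 * w) ≤ 0 :=
      mul_nonpos_of_nonneg_of_nonpos (by positivity) (by linarith)
    linarith
  · have hne : u * (u - w) ^ 2 ≠ 0 := by positivity
    apply mul_left_cancel₀ hne
    linear_combination (u + w) ^ 4 * eu' + (g * (u + w) ^ 2 -
      2 * u * (u - w) ^ 2 * (u - 3 * w)) * k4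
  · have hne : w * (u - w) ^ 2 ≠ 0 := by positivity
    apply mul_left_cancel₀ hne
    linear_combination (u + w) ^ 4 * ew' + (h * (u + w) ^ 2 +
      2 * w * (u - w) ^ 2 * (3 * u - w)) * k5

section Crossing

variable {a b : ℝ} {v : ℝ × ℝ}

/-- Clearing denominators turns `1 - rate` into a monic quartic in `t`, nonnegative wherever the
rate is at most 1. -/
theorem rate_eq (ha : 0 < a) (hb : 0 < b) {t : ℝ} (h1 : a * t ≠ 1) (h2 : b * t ≠ 1) :
    (t - 1 / a) ^ 2 * (t - 1 / b) ^ 2 * (1 - rate a b v t) =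
      (t - 1 / a) ^ 2 * (t - 1 / b) ^ 2 -
        a * v.1 ^ 2 / 2 * (t - 2 * (1 / a)) * (t - 1 / b) ^ 2 -
        b * v.2 ^ 2 / 2 * (t - 2 * (1 / b)) * (t - 1 / a) ^ 2 := by
  have key : ∀ c x : ℝ, 0 < c → c * t ≠ 1 →
      (t - 1 / c) ^ 2 * (c ^ 2 * x ^ 2 * profile (c * t)) =
        c * x ^ 2 / 2 * (t - 2 * (1 / c)) := by
    intro c x hc h
    have h' : c * t - 1 ≠ 0 := fun h' => h (by linarith)
    have e : t - 1 / c = (c * t - 1) / c := by field_simp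
    rw [e, profile]
    generalize hm : c * t - 1 = m at *
    have : t = (m + 1) / c := by field_simp; linarith
    rw [this]
    field_simp
  have k1 := key a v.1 ha h1
  have k2 := key b v.2 hb h2
  unfold rate
  linear_combination (-(t - 1 / b) ^ 2) * k1 - (t - 1 / a) ^ 2 * k2

theorem rate_eq_one_of_min {T : Set ℝ} {t : ℝ}
    (hT : ∀ s ∈ T, 0 < s ∧ a * s ≠ 1 ∧ b * s ≠ 1) (ht : t ∈ T)
    (hmin : ∀ s ∈ T, height a b v t ≤ height a b v s)
    (hlt : IsMinParam a b T v t →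
      (a * v.1 ^ 2 + b * v.2 ^ 2) / 2 < height a b v t → envelope a b T v < 1)
    (h : envelope a b T v = 1) : rate a b v t = 1 := by
  have hM : IsMinParam a b T v t :=
    ⟨subset_closure ht, Or.inr (hT _ ht).2.1, Or.inr (hT _ ht).2.2, hmin⟩
  have he : height a b v t = (a * v.1 ^ 2 + b * v.2 ^ 2) / 2 := by
    rcases lt_trichotomy (height a b v t) ((a * v.1 ^ 2 + b * v.2 ^ 2) / 2) with h' | h' | h'
    · exact absurd h (hM.one_lt_envelope (hT _ ht).1 h').ne'
    · exact h'
    · exact absurd h (hlt hM h').ne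
  exact ((height_eq_iff hM.fst hM.snd).1 he).resolve_left (hT _ ht).1.ne'

/-- When both suprema equal 1 they are attained in the interiors, because no coordinate vanishes.
Each maximizer is a zero and a local minimum of the quartic, hence a double root. -/
theorem crossing (ha : 0 < a) (hab : a < b) (h1 : v.1 ≠ 0) (h2 : v.2 ≠ 0)
    (hi : envelope a b (innerParams a b) v = 1) (ho : envelope a b (outerParams a) v = 1) :
    3 * a < b ∧
      v.1 ^ 2 = (2 * Real.sqrt 2 * (b - a) * (b - 3 * a) / (a * (a + b) ^ 2)) ^ 2 ∧
      v.2 ^ 2 = (2 * Real.sqrt 2 * (b - a) * (3 * b - a) / (b * (a + b) ^ 2)) ^ 2 := by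
  have hb := ha.trans hab
  obtain ⟨t₁, ht₁, m₁⟩ := exists_innerParams_min ha hab h1 h2
  obtain ⟨t₂, ht₂, m₂⟩ := exists_outerParams_min ha hab h1
  have r₁ := rate_eq_one_of_min (fun s => innerParams_spec ha hb) ht₁ m₁
    (fun h => h.envelope_inner_lt_one ha hab) hi
  have r₂ := rate_eq_one_of_min (fun s => outerParams_spec ha hab) ht₂ m₂
    (fun h => h.envelope_outer_lt_one ha hab) ho
  obtain ⟨u, hu⟩ : ∃ u, u = 1 / a := ⟨_, rfl⟩
  obtain ⟨w, hw⟩ : ∃ w, w = 1 / b := ⟨_, rfl⟩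
  obtain ⟨P, hP⟩ : ∃ P, P = a * v.1 ^ 2 / 2 := ⟨_, rfl⟩
  obtain ⟨R, hR⟩ : ∃ R, R = b * v.2 ^ 2 / 2 := ⟨_, rfl⟩
  have expand : ∀ s : ℝ, (s - u) ^ 2 * (s - w) ^ 2 - P * (s - 2 * u) * (s - w) ^ 2 -
      R * (s - 2 * w) * (s - u) ^ 2 = s ^ 4 + (-2 * (u + w) - P - R) * s ^ 3 +
      ((u + w) ^ 2 + 2 * (u * w) + P * (2 * u + 2 * w) + R * (2 * u + 2 * w)) * s ^ 2 +
      (-2 * (u + w) * (u * w) - P * (w ^ 2 + 4 * u * w) - R * (u ^ 2 + 4 * u * w)) * s +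
      (u ^ 2 * w ^ 2 + 2 * P * u * w ^ 2 + 2 * R * w * u ^ 2) := fun s => by ring
  have hform : ∀ {s : ℝ}, a * s ≠ 1 → b * s ≠ 1 →
      (s - u) ^ 2 * (s - w) ^ 2 * (1 - rate a b v s) =
        (s - u) ^ 2 * (s - w) ^ 2 - P * (s - 2 * u) * (s - w) ^ 2 -
      R * (s - 2 * w) * (s - u) ^ 2 := fun {s} k1 k2 => by
    rw [hu, hw, hP, hR]; exact rate_eq ha hb k1 k2
  have zero : ∀ {T : Set ℝ} {t : ℝ}, (∀ s ∈ T, 0 < s ∧ a * s ≠ 1 ∧ b * s ≠ 1) → t ∈ T →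
      rate a b v t = 1 → t ^ 4 + (-2 * (u + w) - P - R) * t ^ 3 +
      ((u + w) ^ 2 + 2 * (u * w) + P * (2 * u + 2 * w) + R * (2 * u + 2 * w)) * t ^ 2 +
      (-2 * (u + w) * (u * w) - P * (w ^ 2 + 4 * u * w) - R * (u ^ 2 + 4 * u * w)) * t +
      (u ^ 2 * w ^ 2 + 2 * P * u * w ^ 2 + 2 * R * w * u ^ 2) = 0 := fun {T t} hT ht hr => by
    rw [← expand, ← hform (hT t ht).2.1 (hT t ht).2.2, hr]; ring
  have nonneg : ∀ {T : Set ℝ} {t : ℝ}, (∀ s ∈ T, 0 < s ∧ a * s ≠ 1 ∧ b * s ≠ 1) → IsOpen T →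
      t ∈ T → envelope a b T v = 1 → ∀ᶠ s in 𝓝 t, 0 ≤ s ^ 4 + (-2 * (u + w) - P - R) * s ^ 3 +
      ((u + w) ^ 2 + 2 * (u * w) + P * (2 * u + 2 * w) + R * (2 * u + 2 * w)) * s ^ 2 +
      (-2 * (u + w) * (u * w) - P * (w ^ 2 + 4 * u * w) - R * (u ^ 2 + 4 * u * w)) * s +
      (u ^ 2 * w ^ 2 + 2 * P * u * w ^ 2 + 2 * R * w * u ^ 2) := fun {T t} hT ho ht hr => by
    filter_upwards [ho.mem_nhds ht] with s hs
    rw [← expand, ← hform (hT s hs).2.1 (hT s hs).2.2]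
    have := rate_le_envelope (a := a) (b := b) (v := v) hs
    exact mul_nonneg (by positivity) (by linarith)
  have z₁ := zero (fun s => innerParams_spec ha hb) ht₁ r₁
  have z₂ := zero (fun s => outerParams_spec ha hab) ht₂ r₂
  have d₁ := quartic_deriv_eq_zero (nonneg (fun s => innerParams_spec ha hb) isOpen_Ioo ht₁ hi) z₁
  have d₂ := quartic_deriv_eq_zero (nonneg (fun s => outerParams_spec ha hab) isOpen_Ioi ht₂ ho) z₂
  have hlt : t₁ < t₂ := ht₁.2.trans ht₂
  have co := quartic_coeffs hlt.ne z₁ z₂ d₁ d₂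
  obtain ⟨k1, k2, k3⟩ := double_tangency (w := w) (u := u) (by rw [hw]; positivity)
    (by rw [hw, hu]; exact one_div_lt_one_div_params ha hab) (hw ▸ ht₁.1) (hu ▸ ht₁.2) (hu ▸ ht₂)
    (fun s => (co s).2.1) (fun s => by rw [expand]; exact (co s).1)
  have h2' : Real.sqrt 2 ^ 2 = 2 := Real.sq_sqrt (by norm_num)
  subst hu hw hP hR
  refine ⟨?_, ?_, ?_⟩
  · rw [mul_one_div, div_lt_div_iff₀ hb ha] at k1
    linarith
  · rw [div_pow, mul_pow, mul_pow, mul_pow, h2']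
    field_simp at k2 ⊢
    linear_combination k2
  · rw [div_pow, mul_pow, mul_pow, mul_pow, h2']
    field_simp at k3 ⊢
    linear_combination k3

end Crossing


/-- The form which compares points of the paraboloid with the inner caustic. -/
noncomputable abbrev innerForm (a b : ℝ) : ℝ × ℝ → ℝ := envelope a b (innerParams a b)

/-- The form which compares points of the paraboloid with the outer caustic. -/
noncomputable abbrev outerForm (a b : ℝ) : ℝ × ℝ → ℝ := envelope a b (outerParams a)

/-- The first coordinate of the crossing point of the two intersection curves. -/
noncomputable def crossFst (a b : ℝ) : ℝ :=
  2 * Real.sqrt 2 * (b - a) * (b - 3 * a) / (a * (a + b) ^ 2)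

/-- The second coordinate of the crossing point of the two intersection curves. -/
noncomputable def crossSnd (a b : ℝ) : ℝ :=
  2 * Real.sqrt 2 * (b - a) * (3 * b - a) / (b * (a + b) ^ 2)

/-! ### Comparison of the two forms -/

section Forms

variable {a b : ℝ} {v : ℝ × ℝ}

theorem continuous_innerForm (ha : 0 < a) (hab : a < b) : Continuous (innerForm a b) :=
  continuous_envelope (innerParams_nonempty ha hab)

theorem continuous_outerForm (a b : ℝ) : Continuous (outerForm a b) :=
  continuous_envelope (outerParams_nonempty a)

theorem innerForm_smul (ha : 0 < a) (hab : a < b) (c : ℝ) (v : ℝ × ℝ) :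
    innerForm a b (c • v) = c ^ 2 * innerForm a b v :=
  envelope_smul (innerParams_nonempty ha hab) c v

theorem outerForm_smul (a b c : ℝ) (v : ℝ × ℝ) :
    outerForm a b (c • v) = c ^ 2 * outerForm a b v :=
  envelope_smul (outerParams_nonempty a) c v

theorem envelope_congr {T : Set ℝ} {v w : ℝ × ℝ} (h1 : v.1 ^ 2 = w.1 ^ 2)
    (h2 : v.2 ^ 2 = w.2 ^ 2) : envelope a b T v = envelope a b T w := by
  have : rate a b v = rate a b w := by
    ext t; rw [rate, rate, h1, h2]
  rw [envelope, envelope, this]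

theorem outerForm_pos (ha : 0 < a) (hab : a < b) (hv : v ≠ 0) : 0 < outerForm a b v := by
  have hb := ha.trans hab
  -- At this parameter both profiles are positive, since `at = 3` and `bt > 3`.
  have hmem : 3 / a ∈ outerParams a := by
    rw [mem_outerParams ha, mul_div_cancel₀ _ ha.ne']; norm_num
  refine lt_of_lt_of_le ?_ (rate_le_envelope hmem)
  have k1 : 0 < profile (a * (3 / a)) := by
    rw [mul_div_cancel₀ _ ha.ne', profile_three]; norm_num
  have k2 : 0 < profile (b * (3 / a)) := profile_pos (by
    rw [← mul_div_assoc, lt_div_iff₀ ha]; linarith)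
  unfold rate
  rcases ne_or_eq v.1 0 with h | h
  · have e1 : 0 < a ^ 2 * v.1 ^ 2 * profile (a * (3 / a)) := by positivity
    have e2 : 0 ≤ b ^ 2 * v.2 ^ 2 * profile (b * (3 / a)) := by positivity
    linarith
  · have h' : v.2 ≠ 0 := fun h' => hv (Prod.ext h h')
    have e1 : 0 ≤ a ^ 2 * v.1 ^ 2 * profile (a * (3 / a)) := by positivity
    have e2 : 0 < b ^ 2 * v.2 ^ 2 * profile (b * (3 / a)) := by positivity
    linarith

/-- On the inner interval `at < 1` and `bt < b/a ≤ 2`, so neither profile is positive. -/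
theorem innerForm_nonpos (ha : 0 < a) (hab : a < b) (h : b ≤ 2 * a) : innerForm a b v ≤ 0 :=
  envelope_le (innerParams_nonempty ha hab) fun t ht => by
    obtain ⟨h1, h2⟩ := (mem_innerParams ha (ha.trans hab)).1 ht
    have := pos_of_one_le_mul (ha.trans hab) h1.le
    exact rate_nonpos (by linarith) (by nlinarith)

theorem snd_ne_zero_of_innerForm_pos (ha : 0 < a) (hab : a < b) (h : 0 < innerForm a b v) :
    v.2 ≠ 0 := fun h' => (innerEnvelope_nonpos_of_snd ha hab h').not_gt h

/-- Where `at < 1` the first term is nonpositive, so positivity comes from `q` alone: shrinking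
`|p|` or enlarging `|q|` preserves it. -/
theorem innerForm_pos_of_le {w : ℝ × ℝ} (ha : 0 < a) (hab : a < b) (h : 0 < innerForm a b v)
    (h1 : w.1 ^ 2 ≤ v.1 ^ 2) (h2 : v.2 ^ 2 ≤ w.2 ^ 2) : 0 < innerForm a b w := by
  obtain ⟨t, ht, hr⟩ := exists_lt_rate (innerParams_nonempty ha hab) h
  refine lt_of_lt_of_le ?_ (rate_le_envelope ht)
  obtain ⟨k1, k2⟩ := (mem_innerParams ha (ha.trans hab)).1 ht
  have hp := profile_neg k2
  unfold rate at hr ⊢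
  have e1 : a ^ 2 * v.1 ^ 2 * profile (a * t) ≤ a ^ 2 * w.1 ^ 2 * profile (a * t) :=
    mul_le_mul_of_nonpos_right (by gcongr) hp.le
  have e0 : a ^ 2 * v.1 ^ 2 * profile (a * t) ≤ 0 :=
    mul_nonpos_of_nonneg_of_nonpos (by positivity) hp.le
  have hq : 0 < profile (b * t) := pos_of_mul_pos_right (b := profile (b * t))
    (by linarith : 0 < b ^ 2 * v.2 ^ 2 * profile (b * t)) (by positivity)
  have e2 : b ^ 2 * v.2 ^ 2 * profile (b * t) ≤ b ^ 2 * w.2 ^ 2 * profile (b * t) := by gcongr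
  linarith

theorem axisRate_pos (ha : 0 < a) (hb : 0 < b) (h : 2 * a < b) {q : ℝ} (hq : q ≠ 0) :
    0 < axisRate a b q := by
  have := profile_pos ((lt_div_iff₀ ha).2 h)
  unfold axisRate
  positivity

theorem innerForm_axis_pos (ha : 0 < a) (hab : a < b) (h : 2 * a < b) {q : ℝ} (hq : q ≠ 0) :
    0 < innerForm a b (0, q) := by
  have hb := ha.trans hab
  rcases le_total b (3 * a) with h3 | h3
  · rw [innerForm, innerEnvelope_axis_of_le ha hab h3]
    exact axisRate_pos ha hb h hq
  · rw [innerForm, innerEnvelope_axis_of_ge ha hab h3]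
    positivity

theorem axisRate_lt (ha : 0 < a) (hb : 0 < b) (h : b ≠ 3 * a) {q : ℝ} (hq : q ≠ 0) :
    axisRate a b q < b ^ 2 * q ^ 2 / 8 := by
  have : profile (b / a) < 1 / 8 := profile_lt fun h' => h (by rw [div_eq_iff ha.ne'] at h'; exact h')
  have hpos : 0 < b ^ 2 * q ^ 2 := by positivity
  unfold axisRate
  nlinarith

theorem exists_smul_eq_one {G : ℝ × ℝ → ℝ} (hG : ∀ (c : ℝ) v, G (c • v) = c ^ 2 * G v)
    (h : 0 < G v) : 0 < (Real.sqrt (G v))⁻¹ ∧ G ((Real.sqrt (G v))⁻¹ • v) = 1 := by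
  refine ⟨inv_pos.2 (Real.sqrt_pos.2 h), ?_⟩
  rw [hG, inv_pow, Real.sq_sqrt h.le, inv_mul_cancel₀ h.ne']

/-- By homogeneity a coincidence of the forms can be rescaled to the common value 1. So coincidences
off the axis occur only on the rays through the crossing points. -/
theorem crossing_direction (ha : 0 < a) (hab : a < b) (h1 : v.1 ≠ 0)
    (h : innerForm a b v = outerForm a b v) :
    3 * a < b ∧ ∃ c : ℝ, 0 < c ∧ c ^ 2 = outerForm a b v ∧ v.1 ^ 2 = c ^ 2 * crossFst a b ^ 2 ∧
      v.2 ^ 2 = c ^ 2 * crossSnd a b ^ 2 := by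
  have hpos : 0 < outerForm a b v := outerForm_pos ha hab fun h => h1 (by rw [h]; rfl)
  obtain ⟨hc, ho⟩ := exists_smul_eq_one (outerForm_smul a b) hpos
  have h2 := snd_ne_zero_of_innerForm_pos ha hab (h ▸ hpos)
  obtain ⟨c, hc'⟩ : ∃ c, c = Real.sqrt (outerForm a b v) := ⟨_, rfl⟩
  have hc0 : 0 < c := hc' ▸ Real.sqrt_pos.2 hpos
  rw [← hc'] at ho
  have hi : innerForm a b (c⁻¹ • v) = 1 := by
    rw [← ho, innerForm_smul ha hab, outerForm_smul, h]
  obtain ⟨k1, k2, k3⟩ := crossing ha hab (v := c⁻¹ • v) (by simpa using ⟨hc0.ne', h1⟩)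
    (by simpa using ⟨hc0.ne', h2⟩) hi ho
  refine ⟨k1, c, hc0, by rw [hc', Real.sq_sqrt hpos.le], ?_, ?_⟩
  · rw [crossFst, ← k2]; simp only [Prod.smul_fst, smul_eq_mul]; field_simp
  · rw [crossSnd, ← k3]; simp only [Prod.smul_snd, smul_eq_mul]; field_simp

theorem innerForm_lt_outerForm_of_connected (ha : 0 < a) (hab : a < b) {S : Set (ℝ × ℝ)}
    (hS : IsPreconnected S) (hne : ∀ v ∈ S, innerForm a b v ≠ outerForm a b v) {w : ℝ × ℝ}
    (hw : w ∈ S) (h : innerForm a b w < outerForm a b w) (hv : v ∈ S) :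
    innerForm a b v < outerForm a b v := by
  have := hS.mapsTo_Ioi_or_Iio (f := fun v => outerForm a b v - innerForm a b v) (b := 0)
    ((continuous_outerForm a b).sub (continuous_innerForm ha hab)).continuousOn
    (fun v hv h => hne v hv (by linarith))
  rcases this with h' | h'
  · exact sub_pos.1 (h' hv)
  · exact absurd (h' hw) (by simp only [Set.mem_Iio, not_lt]; linarith)

theorem outerForm_lt_innerForm_of_connected (ha : 0 < a) (hab : a < b) {S : Set (ℝ × ℝ)}
    (hS : IsPreconnected S) (hne : ∀ v ∈ S, innerForm a b v ≠ outerForm a b v) {w : ℝ × ℝ}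
    (hw : w ∈ S) (h : outerForm a b w < innerForm a b w) (hv : v ∈ S) :
    outerForm a b v < innerForm a b v := by
  by_contra! hc
  have := innerForm_lt_outerForm_of_connected ha hab hS hne hv (lt_of_le_of_ne hc (hne v hv)) hw
  linarith

theorem convex_halfPlane (c d : ℝ) : Convex ℝ {v : ℝ × ℝ | 0 < c * v.1 + d * v.2} :=
  convex_halfSpace_gt (f := fun v : ℝ × ℝ => c * v.1 + d * v.2)
    ⟨fun x y => by simp; ring, fun c x => by simp; ring⟩ 0

theorem innerForm_lt_outerForm_of_snd (ha : 0 < a) (hab : a < b) (hv : v ≠ 0) (h : v.2 = 0) :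
    innerForm a b v < outerForm a b v :=
  (innerEnvelope_nonpos_of_snd ha hab h).trans_lt (outerForm_pos ha hab hv)

/-- Without coincidences in the half-plane `p > 0` the order is that at `(1, 0)`; the other
half-plane follows since the forms are even in each coordinate. -/
theorem innerForm_lt_outerForm_of_fst_ne (ha : 0 < a) (hab : a < b) (h : b ≤ 3 * a)
    (hv : v.1 ≠ 0) : innerForm a b v < outerForm a b v := by
  have key := innerForm_lt_outerForm_of_connected (v := (|v.1|, v.2)) (w := (1, 0)) ha hab
    (convex_halfPlane 1 0).isPreconnected
    (fun w hw e => by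
      have hw : 0 < 1 * w.1 + 0 * w.2 := hw
      exact absurd (crossing_direction ha hab (by linarith : 0 < w.1).ne' e).1 (by linarith))
    (by simp) (innerForm_lt_outerForm_of_snd ha hab (by simp) rfl) (by simpa using hv)
  have e1 := envelope_congr (a := a) (b := b) (T := innerParams a b) (v := (|v.1|, v.2)) (w := v)
    (by simp) (by simp)
  have e2 := envelope_congr (a := a) (b := b) (T := outerParams a) (v := (|v.1|, v.2)) (w := v)
    (by simp) (by simp)
  rwa [innerForm, outerForm, e1, e2] at key

theorem innerForm_lt_outerForm (ha : 0 < a) (hab : a < b) (h : b < 3 * a)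
    (hv : v ≠ 0) : innerForm a b v < outerForm a b v := by
  rcases eq_or_ne v.1 0 with h1 | h1
  · obtain ⟨p, q⟩ := v
    simp only at h1
    subst h1
    rw [innerForm, outerForm, innerEnvelope_axis_of_le ha hab h.le,
      outerEnvelope_axis_of_le ha hab h.le]
    exact axisRate_lt ha (ha.trans hab) h.ne fun h => hv (by rw [h]; rfl)
  · exact innerForm_lt_outerForm_of_fst_ne ha hab h.le h1

theorem innerForm_eq_outerForm_axis (ha : 0 < a) (q : ℝ) :
    innerForm a (3 * a) (0, q) = (3 * a) ^ 2 * q ^ 2 / 8 ∧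
      outerForm a (3 * a) (0, q) = (3 * a) ^ 2 * q ^ 2 / 8 :=
  ⟨innerEnvelope_axis_of_ge ha (by linarith) le_rfl q,
    outerEnvelope_axis_of_le ha (by linarith) le_rfl q⟩

theorem crossSnd_pos (ha : 0 < a) (hab : a < b) : 0 < crossSnd a b := by
  have : 0 < b - a := by linarith
  have : 0 < 3 * b - a := by linarith
  have : 0 < b := by linarith
  unfold crossSnd
  positivity

theorem crossFst_pos (ha : 0 < a) (h3 : 3 * a < b) : 0 < crossFst a b := by
  have : 0 < b - a := by linarith
  have : 0 < b - 3 * a := by linarith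
  have : 0 < b := by linarith
  unfold crossFst
  positivity

theorem innerForm_lt_outerForm_of_wedge (ha : 0 < a) (h3 : 3 * a < b)
    (hv : (crossFst a b * v.2) ^ 2 < (crossSnd a b * v.1) ^ 2) :
    innerForm a b v < outerForm a b v := by
  have hab : a < b := by linarith
  have hp := crossFst_pos ha h3
  have hq := crossSnd_pos ha hab
  set p₀ := crossFst a b
  set q₀ := crossSnd a b
  have key := innerForm_lt_outerForm_of_connected (v := (|v.1|, |v.2|)) (w := (1, 0)) ha hab
    ((convex_halfPlane q₀ p₀).inter (convex_halfPlane q₀ (-p₀))).isPreconnected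
    (fun w ⟨hw1, hw2⟩ e => by
      have hw1 : 0 < q₀ * w.1 + p₀ * w.2 := hw1
      have hw2 : 0 < q₀ * w.1 + -p₀ * w.2 := hw2
      have hw : 0 < w.1 := pos_of_mul_pos_right (by linarith : 0 < q₀ * w.1) hq.le
      obtain ⟨-, c, -, -, e1, e2⟩ := crossing_direction ha hab hw.ne' e
      have := mul_pos hw1 hw2
      have : (q₀ * w.1 + p₀ * w.2) * (q₀ * w.1 + -p₀ * w.2) = 0 := by
        linear_combination q₀ ^ 2 * e1 - p₀ ^ 2 * e2
      linarith)
    (by simp [hq]) (innerForm_lt_outerForm_of_snd ha hab (by simp) rfl) (by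
      have := sq_lt_sq.1 hv
      rw [abs_mul, abs_mul, abs_of_pos hp, abs_of_pos hq] at this
      have h2 : 0 ≤ q₀ * |v.1| := by positivity
      have h3 : 0 ≤ p₀ * |v.2| := by positivity
      constructor <;> simp only [Set.mem_ofPred_eq] <;> linarith)
  have e1 := envelope_congr (a := a) (b := b) (T := innerParams a b) (v := (|v.1|, |v.2|)) (w := v)
    (by simp) (by simp)
  have e2 := envelope_congr (a := a) (b := b) (T := outerParams a) (v := (|v.1|, |v.2|)) (w := v)
    (by simp) (by simp)
  rwa [innerForm, outerForm, e1, e2] at key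

theorem outerForm_lt_innerForm_of_wedge (ha : 0 < a) (h3 : 3 * a < b)
    (hv : (crossSnd a b * v.1) ^ 2 < (crossFst a b * v.2) ^ 2) :
    outerForm a b v < innerForm a b v := by
  have hab : a < b := by linarith
  have hp := crossFst_pos ha h3
  have hq := crossSnd_pos ha hab
  set p₀ := crossFst a b
  set q₀ := crossSnd a b
  have axis : ∀ q : ℝ, q ≠ 0 → outerForm a b (0, q) < innerForm a b (0, q) := fun q hq => by
    rw [innerForm, outerForm, innerEnvelope_axis_of_ge ha hab h3.le,
      outerEnvelope_axis_of_ge ha hab h3.le]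
    exact axisRate_lt ha (ha.trans hab) h3.ne' hq
  have key := outerForm_lt_innerForm_of_connected (v := (|v.1|, |v.2|)) (w := (0, 1)) ha hab
    ((convex_halfPlane q₀ p₀).inter (convex_halfPlane (-q₀) p₀)).isPreconnected
    (fun w ⟨hw1, hw2⟩ e => by
      have hw1 : 0 < q₀ * w.1 + p₀ * w.2 := hw1
      have hw2 : 0 < -q₀ * w.1 + p₀ * w.2 := hw2
      have hw : 0 < w.2 := pos_of_mul_pos_right (by linarith : 0 < p₀ * w.2) hp.le
      rcases eq_or_ne w.1 0 with h0 | h0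
      · have := axis w.2 hw.ne'
        rw [show ((0 : ℝ), w.2) = w from Prod.ext h0.symm rfl] at this
        linarith
      obtain ⟨-, c, -, -, e1, e2⟩ := crossing_direction ha hab h0 e
      have := mul_pos hw1 hw2
      have : (q₀ * w.1 + p₀ * w.2) * (-q₀ * w.1 + p₀ * w.2) = 0 := by
        linear_combination -q₀ ^ 2 * e1 + p₀ ^ 2 * e2
      linarith)
    (by simp [hp]) (axis 1 one_ne_zero) (by
      have := sq_lt_sq.1 hv
      rw [abs_mul, abs_mul, abs_of_pos hp, abs_of_pos hq] at this
      have h2 : 0 ≤ q₀ * |v.1| := by positivity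
      have h3 : 0 ≤ p₀ * |v.2| := by positivity
      constructor <;> simp only [Set.mem_ofPred_eq] <;> linarith)
  have e1 := envelope_congr (a := a) (b := b) (T := innerParams a b) (v := (|v.1|, |v.2|)) (w := v)
    (by simp) (by simp)
  have e2 := envelope_congr (a := a) (b := b) (T := outerParams a) (v := (|v.1|, |v.2|)) (w := v)
    (by simp) (by simp)
  rwa [innerForm, outerForm, e1, e2] at key

/-- Double tangency gave only a necessary condition. That the crossing points really lie on both
curves follows from continuity: the forms are ordered oppositely in adjacent wedges, hence agree on
the ray, and `crossing_direction` fixes the scale. -/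
theorem forms_crossing (ha : 0 < a) (h3 : 3 * a < b) :
    innerForm a b (crossFst a b, crossSnd a b) = 1 ∧
      outerForm a b (crossFst a b, crossSnd a b) = 1 := by
  have hab : a < b := by linarith
  have hp := crossFst_pos ha h3
  have hq := crossSnd_pos ha hab
  set p₀ := crossFst a b
  set q₀ := crossSnd a b
  have hcont : ContinuousAt
      (fun c : ℝ => outerForm a b (p₀, c * q₀) - innerForm a b (p₀, c * q₀)) 1 := by
    have := ((continuous_outerForm a b).sub (continuous_innerForm ha hab)).comp
      (by fun_prop : Continuous fun c : ℝ => (p₀, c * q₀))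
    exact this.continuousAt
  have hpq : 0 < p₀ * q₀ := by positivity
  have h1 : outerForm a b (p₀, 1 * q₀) - innerForm a b (p₀, 1 * q₀) ≤ 0 := by
    refine le_of_tendsto (hcont.tendsto.mono_left (nhdsWithin_le_nhds (s := Set.Ioi 1))) ?_
    filter_upwards [self_mem_nhdsWithin] with c hc
    have := outerForm_lt_innerForm_of_wedge (v := (p₀, c * q₀)) ha h3 (by
      have hc : 1 < c := hc
      change (q₀ * p₀) ^ 2 < (p₀ * (c * q₀)) ^ 2
      rw [show p₀ * (c * q₀) = c * (p₀ * q₀) by ring, mul_comm q₀]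
      exact pow_lt_pow_left₀ (lt_mul_of_one_lt_left hpq hc) hpq.le two_ne_zero)
    linarith
  have h2 : 0 ≤ outerForm a b (p₀, 1 * q₀) - innerForm a b (p₀, 1 * q₀) := by
    refine ge_of_tendsto (hcont.tendsto.mono_left (nhdsWithin_le_nhds (s := Set.Iio 1))) ?_
    filter_upwards [Ioo_mem_nhdsLT (show (0 : ℝ) < 1 by norm_num)] with c hc
    have := innerForm_lt_outerForm_of_wedge (v := (p₀, c * q₀)) ha h3 (by
      obtain ⟨hc0, hc⟩ := hc
      change (p₀ * (c * q₀)) ^ 2 < (q₀ * p₀) ^ 2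
      rw [show p₀ * (c * q₀) = c * (p₀ * q₀) by ring, mul_comm q₀]
      exact pow_lt_pow_left₀ (mul_lt_of_lt_one_left hpq hc) (by positivity) two_ne_zero)
    linarith
  rw [one_mul] at h1 h2
  have e : innerForm a b (p₀, q₀) = outerForm a b (p₀, q₀) := by linarith
  obtain ⟨-, c, hc, hc2, e1, -⟩ := crossing_direction ha hab (v := (p₀, q₀)) hp.ne' e
  -- The first coordinate of the point is also `c` times `crossFst` up to sign, so the common value
  -- `c²` is 1.
  have : c ^ 2 = 1 := by
    have hp2 : p₀ ^ 2 ≠ 0 := by positivity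
    apply mul_right_cancel₀ hp2
    rw [one_mul]; exact e1.symm
  rw [e, ← hc2, this]
  exact ⟨rfl, rfl⟩

end Forms


/-! ### Curves, regions and radial projection -/

section Topology

variable {a b : ℝ}

theorem lift_injective (a b : ℝ) : Function.Injective (lift a b) := fun v w h =>
  Prod.ext (by simpa using congrArg (fun A : Space => A 0) h)
    (by simpa using congrArg (fun A : Space => A 1) h)

theorem continuous_lift (a b : ℝ) : Continuous (lift a b) := by
  unfold lift
  refine (PiLp.continuous_toLp 2 _).comp (continuous_pi fun i => ?_)
  fin_cases i <;> simp <;> fun_prop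

theorem continuous_coords : Continuous fun A : Space => ((A 0, A 1) : ℝ × ℝ) := by fun_prop

theorem innerCurve_eq (ha : 0 < a) (hab : a < b) :
    innerCurve a b = lift a b '' {v | innerForm a b v = 1} := by
  ext A
  constructor
  · rintro ⟨h1, h2⟩
    rw [eq_lift h1] at h2 ⊢
    exact ⟨_, ((describesCaustic_inner ha hab).mem_iff _).1 h2, rfl⟩
  · rintro ⟨v, hv, rfl⟩
    exact ⟨lift_mem a b v, ((describesCaustic_inner ha hab).mem_iff _).2 hv⟩

theorem outerCurve_eq (ha : 0 < a) (hab : a < b) :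
    outerCurve a b = lift a b '' {v | outerForm a b v = 1} := by
  ext A
  constructor
  · rintro ⟨h1, h2⟩
    rw [eq_lift h1] at h2 ⊢
    exact ⟨_, ((describesCaustic_outer ha hab).mem_iff _).1 h2, rfl⟩
  · rintro ⟨v, hv, rfl⟩
    exact ⟨lift_mem a b v, ((describesCaustic_outer ha hab).mem_iff _).2 hv⟩

theorem complement_eq (ha : 0 < a) (hab : a < b) :
    surface a b \ (innerCurve a b ∪ outerCurve a b) =
      lift a b '' {v | innerForm a b v ≠ 1 ∧ outerForm a b v ≠ 1} := by
  rw [innerCurve_eq ha hab, outerCurve_eq ha hab, ← Set.image_union]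
  ext A
  constructor
  · rintro ⟨h1, h2⟩
    rw [eq_lift h1, (lift_injective a b).mem_set_image] at h2
    rw [eq_lift h1, (lift_injective a b).mem_set_image]
    exact not_or.1 h2
  · rintro ⟨v, hv, rfl⟩
    exact ⟨lift_mem a b v, fun h => not_or.2 hv ((lift_injective a b).mem_set_image.1 h)⟩

/-- Disjoint open connected pieces are the components of their union. The continuous left inverse
`g` carries openness from the plane to the image, which is not open in `X` in the application. -/
theorem connectedComponentIn_eq_of_cover {X Y ι : Type*} [TopologicalSpace X]
    [TopologicalSpace Y] {f : Y → X} {g : X → Y} (hf : Continuous f) (hg : Continuous g)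
    (hgf : ∀ y, g (f y) = y) {W : ι → Set Y} (hopen : ∀ i, IsOpen (W i))
    (hconn : ∀ i, IsPreconnected (W i)) (hdisj : ∀ i j, i ≠ j → Disjoint (W i) (W j)) {i : ι} {y : Y}
    (hy : y ∈ W i) : connectedComponentIn (f '' ⋃ i, W i) (f y) = f '' W i := by
  have hsub : W i ⊆ ⋃ i, W i := Set.subset_iUnion W i
  apply subset_antisymm
  · have hpre := isPreconnected_connectedComponentIn (x := f y) (F := f '' ⋃ i, W i)
    have hle := connectedComponentIn_subset (f '' ⋃ i, W i) (f y)
    have := IsPreconnected.subset_left_of_subset_union (u := g ⁻¹' W i)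
      (v := g ⁻¹' ⋃ j ∈ {j | j ≠ i}, W j) ((hopen i).preimage hg)
      ((isOpen_biUnion fun j _ => hopen j).preimage hg)
      (Disjoint.preimage _ (Set.disjoint_iUnion₂_right.2 fun j hj => hdisj i j (Ne.symm hj)))
      (fun x hx => by
        obtain ⟨z, hz, rfl⟩ := hle hx
        obtain ⟨j, hj⟩ := Set.mem_iUnion.1 hz
        rcases eq_or_ne j i with rfl | hne
        · exact Or.inl (by rw [Set.mem_preimage, hgf]; exact hj)
        · exact Or.inr (by
            rw [Set.mem_preimage, hgf]; exact Set.mem_biUnion (show j ∈ {j | j ≠ i} from hne) hj))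
      ⟨f y, mem_connectedComponentIn (Set.mem_image_of_mem f (hsub hy)), by
        rw [Set.mem_preimage, hgf]; exact hy⟩ hpre
    intro x hx
    obtain ⟨z, hz, rfl⟩ := hle hx
    have h := this hx
    rw [Set.mem_preimage, hgf] at h
    exact ⟨z, h, rfl⟩
  · exact ((hconn i).image f hf.continuousOn).subset_connectedComponentIn
      (Set.mem_image_of_mem f hy) (Set.image_mono hsub)

theorem regions_eq_range {ι : Type*} (ha : 0 < a) (hab : a < b)
    {W : ι → Set (ℝ × ℝ)} (hopen : ∀ i, IsOpen (W i))
    (hconn : ∀ i, IsConnected (W i)) (hdisj : ∀ i j, i ≠ j → Disjoint (W i) (W j))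
    (hcover : {v | innerForm a b v ≠ 1 ∧ outerForm a b v ≠ 1} = ⋃ i, W i) :
    regions a b = Set.range fun i => lift a b '' W i := by
  have key : ∀ i, ∀ v ∈ W i, connectedComponentIn (surface a b \ (innerCurve a b ∪ outerCurve a b))
      (lift a b v) = lift a b '' W i := fun i v hv => by
    rw [complement_eq ha hab, hcover]
    exact connectedComponentIn_eq_of_cover (continuous_lift a b) continuous_coords (by simp) hopen
      (fun i => (hconn i).isPreconnected) hdisj hv
  ext R
  constructor
  · rintro ⟨A, hA, rfl⟩
    have hA' := hA
    rw [complement_eq ha hab, hcover] at hA'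
    obtain ⟨v, hv, rfl⟩ := hA'
    obtain ⟨i, hi⟩ := Set.mem_iUnion.1 hv
    exact ⟨i, (key i v hi).symm⟩
  · rintro ⟨i, rfl⟩
    obtain ⟨v, hv⟩ := (hconn i).nonempty
    refine ⟨lift a b v, ?_, (key i v hv).symm⟩
    rw [complement_eq ha hab, hcover]
    exact Set.mem_image_of_mem _ (Set.mem_iUnion.2 ⟨i, hv⟩)

theorem image_lift_injective {ι : Type*} {W : ι → Set (ℝ × ℝ)}
    (hne : ∀ i, (W i).Nonempty) (hdisj : ∀ i j, i ≠ j → Disjoint (W i) (W j)) :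
    Function.Injective fun i => lift a b '' W i := by
  intro i j h
  by_contra hij
  have h := (lift_injective a b).image_injective h
  obtain ⟨v, hv⟩ := hne i
  exact Set.disjoint_left.1 (hdisj i j hij) hv (h ▸ hv)

theorem regions_ncard {n : ℕ} {W : Fin n → Set (ℝ × ℝ)} (ha : 0 < a) (hab : a < b)
    (hopen : ∀ i, IsOpen (W i))
    (hconn : ∀ i, IsConnected (W i)) (hdisj : ∀ i j, i ≠ j → Disjoint (W i) (W j))
    (hcover : {v | innerForm a b v ≠ 1 ∧ outerForm a b v ≠ 1} = ⋃ i, W i) :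
    (regions a b).ncard = n := by
  rw [regions_eq_range ha hab hopen hconn hdisj hcover, ← Set.image_univ,
    Set.ncard_image_of_injective _ (image_lift_injective (fun i => (hconn i).nonempty) hdisj),
    Set.ncard_univ, Nat.card_fin]

theorem continuousOn_normalize {X : Type*} [TopologicalSpace X] {L : X → ℝ} {f : X → ℝ × ℝ}
    (hL : Continuous L) (hf : Continuous f) {S : Set X} (h : ∀ x ∈ S, 0 < L x) :
    ContinuousOn (fun x => (Real.sqrt (L x))⁻¹ • f x) S :=
  (hL.sqrt.continuousOn.inv₀ fun x hx => (Real.sqrt_pos.2 (h x hx)).ne').smul hf.continuousOn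

/-- On each ray of the cone the set is an interval. Rescaling `v` to the level 1 of the interpolated
form `(1-s)g₁ + s g₂` presents it as a continuous image of `K × (0,1)`. -/
theorem isConnected_between {K : Set (ℝ × ℝ)} {g₁ g₂ : ℝ × ℝ → ℝ} (hK : IsConnected K)
    (hcone : ∀ v ∈ K, ∀ c : ℝ, 0 < c → c • v ∈ K) (c₁ : Continuous g₁) (c₂ : Continuous g₂)
    (hom₁ : ∀ (c : ℝ) v, g₁ (c • v) = c ^ 2 * g₁ v) (hom₂ : ∀ (c : ℝ) v, g₂ (c • v) = c ^ 2 * g₂ v)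
    (h0 : ∀ v ∈ K, 0 ≤ g₁ v) (hlt : ∀ v ∈ K, g₁ v < g₂ v) :
    IsConnected {v | v ∈ K ∧ g₁ v < 1 ∧ 1 < g₂ v} := by
  set L : (ℝ × ℝ) × ℝ → ℝ := fun x => (1 - x.2) * g₁ x.1 + x.2 * g₂ x.1 with hL
  have hLpos : ∀ x ∈ K ×ˢ Set.Ioo (0 : ℝ) 1, g₁ x.1 < L x ∧ L x < g₂ x.1 := by
    rintro ⟨v, s⟩ ⟨hv, hs0, hs1⟩
    have := hlt v hv
    simp only [hL] at hv hs0 hs1 ⊢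
    constructor <;> nlinarith
  have himg : (fun x : (ℝ × ℝ) × ℝ => (Real.sqrt (L x))⁻¹ • x.1) '' (K ×ˢ Set.Ioo (0 : ℝ) 1) =
      {v | v ∈ K ∧ g₁ v < 1 ∧ 1 < g₂ v} := by
    ext v
    constructor
    · rintro ⟨x, hx, rfl⟩
      obtain ⟨k1, k2⟩ := hLpos x hx
      have hp : 0 < L x := (h0 _ hx.1).trans_lt k1
      refine ⟨hcone _ hx.1 _ (inv_pos.2 (Real.sqrt_pos.2 hp)), ?_, ?_⟩
      · rw [hom₁, inv_pow, Real.sq_sqrt hp.le, inv_mul_lt_iff₀ hp]; linarith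
      · rw [hom₂, inv_pow, Real.sq_sqrt hp.le, lt_inv_mul_iff₀ hp]; linarith
    · rintro ⟨hv, k1, k2⟩
      have hd : 0 < g₂ v - g₁ v := by linarith
      -- This `s` makes the interpolated form equal to 1 at `v`, so no rescaling moves `v`.
      refine ⟨(v, (1 - g₁ v) / (g₂ v - g₁ v)), ⟨hv, ?_, ?_⟩, ?_⟩
      · exact div_pos (by linarith) hd
      · rw [div_lt_one hd]; linarith
      · have : L (v, (1 - g₁ v) / (g₂ v - g₁ v)) = 1 := by
          simp only [hL]; field_simp; ring
        simp only [this, Real.sqrt_one, inv_one, one_smul]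
  rw [← himg]
  refine (hK.prod (isConnected_Ioo one_pos)).image _ ?_
  have hLc : Continuous L := by simp only [hL]; fun_prop
  exact continuousOn_normalize hLc continuous_fst fun x hx => (h0 _ hx.1).trans_lt (hLpos x hx).1

/-- A ray on which `G` is positive meets the level set exactly once. Lines of directions `d i`
therefore parametrize it, each over the set where `G` is positive. -/
theorem isCurve_level {G : ℝ × ℝ → ℝ} (hG : Continuous G)
    (hom : ∀ (c : ℝ) v, G (c • v) = c ^ 2 * G v) {n : ℕ} (hn : 0 < n) (d : Fin n → ℝ → ℝ × ℝ)
    (hd : ∀ i, Continuous (d i)) (hI : ∀ i, {w | 0 < G (d i w)}.OrdConnected)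
    (hI' : ∀ i, {w | 0 < G (d i w)}.Nontrivial)
    (hinj : ∀ i w w', ∀ c > (0 : ℝ), ∀ c' > (0 : ℝ), c • d i w = c' • d i w' → w = w')
    (hcover : ∀ v, G v = 1 → ∃ i w, ∃ c > (0 : ℝ), v = c • d i w) :
    IsCurve (lift a b '' {v | G v = 1}) := by
  refine ⟨n, fun i => {w | 0 < G (d i w)},
    fun i w => lift a b ((Real.sqrt (G (d i w)))⁻¹ • d i w), hn, fun i => ⟨hI i, hI' i, ?_, ?_⟩, ?_⟩
  · refine (continuous_lift a b).comp_continuousOn ?_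
    exact continuousOn_normalize (hG.comp (hd i)) (hd i) fun x hx => hx
  · intro w hw w' hw' h
    exact hinj i w w' _ (inv_pos.2 (Real.sqrt_pos.2 hw)) _ (inv_pos.2 (Real.sqrt_pos.2 hw'))
      (lift_injective a b h)
  · ext A
    simp only [Set.mem_image, Set.mem_iUnion]
    constructor
    · rintro ⟨v, hv, rfl⟩
      obtain ⟨i, w, c, hc, rfl⟩ := hcover v hv
      have hv : G (c • d i w) = 1 := hv
      rw [hom] at hv
      have hG' : G (d i w) = (c ^ 2)⁻¹ := by
        exact eq_inv_of_mul_eq_one_right hv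
      refine ⟨i, w, ?_, ?_⟩
      · rw [Set.mem_ofPred_eq, hG']; positivity
      · rw [hG', Real.sqrt_inv, inv_inv, Real.sqrt_sq hc.le]
    · rintro ⟨i, w, hw, rfl⟩
      exact ⟨_, (exists_smul_eq_one hom hw).2, rfl⟩

theorem dir_injective_fst {s : ℝ} (hs : s ≠ 0) {w w' c c' : ℝ} (hc : 0 < c)
    (h : c • (s, w) = c' • (s, w')) : w = w' := by
  have h1 := congrArg Prod.fst h
  have h2 := congrArg Prod.snd h
  simp only [Prod.smul_fst, Prod.smul_snd, smul_eq_mul] at h1 h2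
  obtain rfl := mul_right_cancel₀ hs h1
  exact mul_left_cancel₀ hc.ne' h2

theorem dir_injective_snd {s : ℝ} (hs : s ≠ 0) {w w' c c' : ℝ} (hc : 0 < c)
    (h : c • (w, s) = c' • (w', s)) : w = w' := by
  have h1 := congrArg Prod.fst h
  have h2 := congrArg Prod.snd h
  simp only [Prod.smul_fst, Prod.smul_snd, smul_eq_mul] at h1 h2
  obtain rfl := mul_right_cancel₀ hs h2
  exact mul_left_cancel₀ hc.ne' h1

theorem isCurve_outerCurve (ha : 0 < a) (hab : a < b) : IsCurve (outerCurve a b) := by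
  rw [outerCurve_eq ha hab]
  -- Two vertical lines meet all rays except those along the `q`-axis; the horizontal lines supply
  -- these.
  set d : Fin 4 → ℝ → ℝ × ℝ :=
    ![fun w => (1, w), fun w => (-1, w), fun w => (w, 1), fun w => (w, -1)] with hd
  have hne : ∀ i w, d i w ≠ 0 := by
    intro i w; fin_cases i <;> simp [hd]
  have huniv : ∀ i, {w | 0 < outerForm a b (d i w)} = Set.univ := fun i => by
    ext w; simpa using outerForm_pos ha hab (hne i w)
  refine isCurve_level (continuous_outerForm a b) (outerForm_smul a b) (by norm_num) d
    ?_ ?_ ?_ ?_ ?_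
  · intro i; fin_cases i <;>
      first | exact continuous_const.prodMk continuous_id | exact continuous_id.prodMk continuous_const
  · intro i; rw [huniv]; exact Set.ordConnected_univ
  · intro i; rw [huniv]; exact Set.nontrivial_univ
  · intro i w w' c hc c' _ h
    fin_cases i
    · exact dir_injective_fst one_ne_zero hc h
    · exact dir_injective_fst (by norm_num) hc h
    · exact dir_injective_snd one_ne_zero hc h
    · exact dir_injective_snd (by norm_num) hc h
  · rintro ⟨p, q⟩ hv
    rcases lt_trichotomy p 0 with h | rfl | h
    · refine ⟨1, q / -p, -p, by linarith, ?_⟩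
      have h' : -p ≠ 0 := by linarith
      exact Prod.ext (by simp [hd]) (mul_div_cancel₀ q h').symm
    · rcases lt_trichotomy q 0 with h | rfl | h
      · exact ⟨3, 0, -q, by linarith, by simp [hd]⟩
      · have := outerForm_smul a b 0 (0, 0)
        simp only [smul_zero, ne_eq, OfNat.ofNat_ne_zero, not_false_eq_true, zero_pow, zero_mul,
          Prod.smul_mk] at this
        rw [this] at hv
        norm_num at hv
      · exact ⟨2, 0, q, h, by simp [hd]⟩
    · exact ⟨0, q / p, p, h, by simp [hd, mul_div_cancel₀ _ h.ne']⟩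

theorem isCurve_innerCurve (ha : 0 < a) (hab : a < b) (h2 : 2 * a < b) :
    IsCurve (innerCurve a b) := by
  rw [innerCurve_eq ha hab]
  have hcont := continuous_innerForm ha hab
  -- Two horizontal lines suffice, because the inner form is not positive on `q = 0`.
  set d : Fin 2 → ℝ → ℝ × ℝ := ![fun w => (w, 1), fun w => (w, -1)] with hd
  have hdc : ∀ i, Continuous (d i) := by
    intro i; fin_cases i <;>
      first | exact continuous_const.prodMk continuous_id | exact continuous_id.prodMk continuous_const
  have hfst : ∀ i w, (d i w).1 = w := by
    intro i w; fin_cases i <;> simp [hd]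
  have hsnd : ∀ i w, (d i w).2 ^ 2 = 1 := by
    intro i w; fin_cases i <;> simp [hd]
  refine isCurve_level hcont (innerForm_smul ha hab) (by norm_num) d hdc ?_ ?_ ?_ ?_
  · refine fun i => ⟨fun x hx y hy z hz => ?_⟩
    -- A point between `x` and `y` is no farther from 0 than one of them, and positivity of the form
    -- passes to smaller `|p|`.
    have hle : z ^ 2 ≤ x ^ 2 ∨ z ^ 2 ≤ y ^ 2 := by
      rcases le_total 0 z with h | h
      · right; nlinarith [hz.2]
      · left; nlinarith [hz.1]
    rcases hle with h | h
    · exact innerForm_pos_of_le ha hab hx (by rwa [hfst, hfst]) (by rw [hsnd, hsnd])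
    · exact innerForm_pos_of_le ha hab hy (by rwa [hfst, hfst]) (by rw [hsnd, hsnd])
  · intro i
    have hopen : IsOpen {w | 0 < innerForm a b (d i w)} :=
      isOpen_lt continuous_const (hcont.comp (hdc i))
    have h0 : (0 : ℝ) ∈ {w | 0 < innerForm a b (d i w)} := by
      have e : d i 0 = (0, (d i 0).2) := Prod.ext (hfst i 0) rfl
      rw [Set.mem_ofPred_eq, e]
      refine innerForm_axis_pos ha hab h2 fun h => ?_
      have := hsnd i 0
      rw [h] at this
      norm_num at this
    obtain ⟨ε, hε, hb⟩ := Metric.isOpen_iff.1 hopen 0 h0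
    refine ⟨0, h0, ε / 2, hb ?_, (by positivity : 0 < ε / 2).ne⟩
    rw [Metric.mem_ball, Real.dist_eq, sub_zero, abs_of_pos (by positivity)]
    linarith
  · intro i w w' c hc c' _ h
    fin_cases i
    · exact dir_injective_snd one_ne_zero hc h
    · exact dir_injective_snd (by norm_num) hc h
  · rintro ⟨p, q⟩ hv
    have hq := snd_ne_zero_of_innerForm_pos ha hab (v := (p, q)) (by rw [hv]; exact one_pos)
    rcases lt_or_gt_of_ne hq with h | h
    · have h : q < 0 := h
      have h' : -q ≠ 0 := by linarith
      exact ⟨1, p / -q, -q, by linarith,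
        Prod.ext (mul_div_cancel₀ p h').symm (by simp [hd])⟩
    · exact ⟨0, p / q, q, h, by simp [hd, mul_div_cancel₀ _ h.ne']⟩

theorem isConnected_punctured : IsConnected ({0}ᶜ : Set (ℝ × ℝ)) :=
  isConnected_compl_singleton_of_one_lt_rank (by simp; norm_num) 0

theorem isConnected_outerCurve (ha : 0 < a) (hab : a < b) : IsConnected (outerCurve a b) := by
  have hcont := continuous_outerForm a b
  have himg : outerCurve a b =
      (fun v => lift a b ((Real.sqrt (outerForm a b v))⁻¹ • v)) '' ({0}ᶜ : Set (ℝ × ℝ)) := by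
    rw [outerCurve_eq ha hab]
    ext A
    constructor
    · rintro ⟨v, hv, rfl⟩
      have hv : outerForm a b v = 1 := hv
      refine ⟨v, ?_, by simp [hv]⟩
      rintro rfl
      have := outerForm_smul a b 0 0
      rw [smul_zero, hv] at this
      norm_num at this
    · rintro ⟨v, hv, rfl⟩
      exact ⟨_, (exists_smul_eq_one (outerForm_smul a b) (outerForm_pos ha hab hv)).2, rfl⟩
  rw [himg]
  refine isConnected_punctured.image _ ((continuous_lift a b).comp_continuousOn ?_)
  exact continuousOn_normalize hcont continuous_id fun x hx => outerForm_pos ha hab hx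

end Topology


/-! ### The regions in the coordinate plane -/

section Cells

variable {a b : ℝ} {v : ℝ × ℝ}

/-- On the axis `axisRate` is the value of one of the two forms, so the exceptional count cannot
occur off the curves. -/
theorem axisRate_ne_one (ha : 0 < a) (hab : a < b) (hi : innerForm a b v ≠ 1)
    (ho : outerForm a b v ≠ 1) (h : v.1 = 0) : axisRate a b v.2 ≠ 1 := by
  have e : v = (0, v.2) := Prod.ext h rfl
  rcases le_total b (3 * a) with h3 | h3
  · rw [e, innerForm, innerEnvelope_axis_of_le ha hab h3] at hi
    exact hi
  · rw [e, outerForm, outerEnvelope_axis_of_ge ha hab h3] at ho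
    exact ho

theorem lower_cell (ha : 0 < a) (hab : a < b) (hi : innerForm a b v < 1)
    (ho : outerForm a b v < 1) :
    Lower a b (lift a b v) ∧ normalCount a b (lift a b v) = 1 := by
  refine ⟨⟨(describesCaustic_inner ha hab).below _ hi, (describesCaustic_outer ha hab).below _ ho⟩, ?_⟩
  rw [normalCount_eq ha hab (axisRate_ne_one ha hab hi.ne ho.ne), crossings_of_lt hi,
    crossings_of_lt ho]

theorem middle_cell (ha : 0 < a) (hab : a < b) (hi : innerForm a b v < 1)
    (ho : 1 < outerForm a b v) :
    (Below (lift a b v) (innerCaustic a b) ∧ Above (lift a b v) (outerCaustic a b)) ∧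
      normalCount a b (lift a b v) = 3 := by
  refine ⟨⟨(describesCaustic_inner ha hab).below _ hi, (describesCaustic_outer ha hab).above _ ho⟩, ?_⟩
  rw [normalCount_eq ha hab (axisRate_ne_one ha hab hi.ne ho.ne'), crossings_of_lt hi,
    crossings_of_gt ho]

theorem middle_cell' (ha : 0 < a) (hab : a < b) (hi : 1 < innerForm a b v)
    (ho : outerForm a b v < 1) :
    (Above (lift a b v) (innerCaustic a b) ∧ Below (lift a b v) (outerCaustic a b)) ∧
      normalCount a b (lift a b v) = 3 := by
  refine ⟨⟨(describesCaustic_inner ha hab).above _ hi, (describesCaustic_outer ha hab).below _ ho⟩, ?_⟩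
  rw [normalCount_eq ha hab (axisRate_ne_one ha hab hi.ne' ho.ne), crossings_of_gt hi,
    crossings_of_lt ho]

theorem upper_cell (ha : 0 < a) (hab : a < b) (hi : 1 < innerForm a b v)
    (ho : 1 < outerForm a b v) :
    Upper a b (lift a b v) ∧ normalCount a b (lift a b v) = 5 := by
  refine ⟨⟨(describesCaustic_inner ha hab).above _ hi, (describesCaustic_outer ha hab).above _ ho⟩, ?_⟩
  rw [normalCount_eq ha hab (axisRate_ne_one ha hab hi.ne' ho.ne'), crossings_of_gt hi,
    crossings_of_gt ho]

/-- The part of the plane described by a condition and by comparisons of the two forms with `1`. -/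
def cell (K A B : ℝ × ℝ → Prop) : Set (ℝ × ℝ) := {v | K v ∧ A v ∧ B v}

theorem disjoint_cell {K A B K' A' B' : ℝ × ℝ → Prop}
    (h : ∀ v, K v → A v → B v → K' v → A' v → B' v → False) :
    Disjoint (cell K A B) (cell K' A' B') :=
  Set.disjoint_left.2 fun v ⟨h1, h2, h3⟩ ⟨h4, h5, h6⟩ => h v h1 h2 h3 h4 h5 h6

theorem isOpen_cell {K A B : ℝ × ℝ → Prop} (hK : IsOpen {v | K v}) (hA : IsOpen {v | A v})
    (hB : IsOpen {v | B v}) : IsOpen (cell K A B) := hK.inter (hA.inter hB)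

/-- Below both caustics. -/
def lowerCell (a b : ℝ) : Set (ℝ × ℝ) :=
  cell (fun _ => True) (fun v => innerForm a b v < 1) (fun v => outerForm a b v < 1)

/-- Between the caustics, the outer one being the lower one. -/
def middleCell (a b : ℝ) (K : ℝ × ℝ → Prop) : Set (ℝ × ℝ) :=
  cell K (fun v => innerForm a b v < 1) (fun v => 1 < outerForm a b v)

/-- Between the caustics, the inner one being the lower one. -/
def middleCell' (a b : ℝ) (σ : ℝ) : Set (ℝ × ℝ) :=
  cell (fun v => 0 < σ * v.2) (fun v => outerForm a b v < 1) (fun v => 1 < innerForm a b v)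

/-- Above both caustics. -/
def upperCell (a b : ℝ) (σ : ℝ) : Set (ℝ × ℝ) :=
  cell (fun v => 0 < σ * v.2) (fun v => 1 < innerForm a b v) (fun v => 1 < outerForm a b v)

theorem isOpen_lowerCell (ha : 0 < a) (hab : a < b) : IsOpen (lowerCell a b) :=
  isOpen_cell (by simp) (isOpen_lt (continuous_innerForm ha hab) continuous_const)
    (isOpen_lt (continuous_outerForm a b) continuous_const)

theorem isOpen_middleCell (ha : 0 < a) (hab : a < b) {K : ℝ × ℝ → Prop} (hK : IsOpen {v | K v}) :
    IsOpen (middleCell a b K) :=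
  isOpen_cell hK (isOpen_lt (continuous_innerForm ha hab) continuous_const)
    (isOpen_lt continuous_const (continuous_outerForm a b))

theorem isOpen_pos_fst (σ : ℝ) : IsOpen {v : ℝ × ℝ | 0 < σ * v.1} :=
  isOpen_lt continuous_const (by fun_prop)

theorem isOpen_pos_snd (σ : ℝ) : IsOpen {v : ℝ × ℝ | 0 < σ * v.2} :=
  isOpen_lt continuous_const (by fun_prop)

theorem isOpen_middleCell' (ha : 0 < a) (hab : a < b) (σ : ℝ) : IsOpen (middleCell' a b σ) :=
  isOpen_cell (isOpen_pos_snd σ) (isOpen_lt (continuous_outerForm a b) continuous_const)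
    (isOpen_lt continuous_const (continuous_innerForm ha hab))

theorem isOpen_upperCell (ha : 0 < a) (hab : a < b) (σ : ℝ) : IsOpen (upperCell a b σ) :=
  isOpen_cell (isOpen_pos_snd σ) (isOpen_lt continuous_const (continuous_innerForm ha hab))
    (isOpen_lt continuous_const (continuous_outerForm a b))

theorem forms_zero (ha : 0 < a) (hab : a < b) : innerForm a b 0 = 0 ∧ outerForm a b 0 = 0 := by
  have h1 := innerForm_smul ha hab 0 0
  have h2 := outerForm_smul a b 0 0
  rw [smul_zero] at h1 h2
  constructor <;> linarith

theorem smul_lt_one {G c : ℝ} (hG : G < 1) (hc0 : 0 ≤ c) (hc : c ≤ 1) : c ^ 2 * G < 1 := by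
  have h2 : c ^ 2 ≤ 1 := pow_le_one₀ hc0 hc
  rcases le_total G 0 with h | h
  · have := mul_nonpos_of_nonneg_of_nonpos (sq_nonneg c) h
    linarith
  · nlinarith [sq_nonneg c]

/-- Star-shaped about the origin: shrinking `v` keeps both forms below 1, whatever their signs. -/
theorem isConnected_lowerCell (ha : 0 < a) (hab : a < b) : IsConnected (lowerCell a b) := by
  obtain ⟨hi, ho⟩ := forms_zero ha hab
  have h0 : (0 : ℝ × ℝ) ∈ lowerCell a b :=
    ⟨trivial, hi.trans_lt one_pos, ho.trans_lt one_pos⟩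
  have hs : StarConvex ℝ (0 : ℝ × ℝ) (lowerCell a b) := by
    rw [starConvex_zero_iff]
    rintro v ⟨-, h1, h2⟩ c hc0 hc1
    refine ⟨trivial, ?_, ?_⟩
    · simp only [innerForm_smul ha hab]; exact smul_lt_one h1 hc0 hc1
    · simp only [outerForm_smul]; exact smul_lt_one h2 hc0 hc1
  exact (hs.isPathConnected h0).isConnected

theorem isConnected_middle (ha : 0 < a) (hab : a < b) {K : Set (ℝ × ℝ)} (hK : IsConnected K)
    (hcone : ∀ v ∈ K, ∀ c : ℝ, 0 < c → c • v ∈ K) (h0 : ∀ v ∈ K, v ≠ 0)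
    (hlt : ∀ v ∈ K, innerForm a b v < outerForm a b v) :
    IsConnected {v | v ∈ K ∧ innerForm a b v < 1 ∧ 1 < outerForm a b v} := by
  -- The inner form may be negative; truncating it at 0 meets the positivity hypothesis without
  -- changing the condition of being less than 1.
  have := isConnected_between (g₁ := fun v => max (innerForm a b v) 0) hK hcone
    ((continuous_innerForm ha hab).max continuous_const) (continuous_outerForm a b)
    (fun c v => by
      simp only [innerForm_smul ha hab]
      rw [mul_max_of_nonneg _ _ (sq_nonneg c), mul_zero]) (outerForm_smul a b)
    (fun v _ => le_max_right _ _) (fun v hv => max_lt (hlt v hv) (outerForm_pos ha hab (h0 v hv)))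
  simpa only [max_lt_iff, zero_lt_one, and_true] using this

theorem isConnected_halfPlane {c d : ℝ} (h : (c, d) ≠ 0) :
    IsConnected {v : ℝ × ℝ | 0 < c * v.1 + d * v.2} := by
  refine ⟨⟨(c, d), ?_⟩, (convex_halfPlane c d).isPreconnected⟩
  rw [Set.mem_ofPred_eq]
  rcases eq_or_ne c 0 with rfl | hc
  · have hd : d ≠ 0 := fun hd => h (by rw [hd]; rfl)
    have := mul_self_pos.2 hd
    linarith
  · have := mul_self_pos.2 hc
    have := mul_self_nonneg d
    linarith

theorem isConnected_middleCell_top (ha : 0 < a) (hab : a < b) (h3 : b < 3 * a) :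
    IsConnected (middleCell a b fun _ => True) := by
  have := isConnected_middle ha hab isConnected_punctured
    (fun v hv c hc => smul_ne_zero hc.ne' hv) (fun v hv => hv)
    (fun v hv => innerForm_lt_outerForm ha hab h3 hv)
  convert this using 1
  ext v
  refine ⟨fun ⟨_, h1, h2⟩ => ⟨?_, h1, h2⟩, fun ⟨_, h1, h2⟩ => ⟨trivial, h1, h2⟩⟩
  rintro rfl
  have h2 : 1 < outerForm a b 0 := h2
  rw [(forms_zero ha hab).2] at h2
  linarith

theorem isConnected_middleCell_of_eq (ha : 0 < a) {σ : ℝ} (hσ : σ ≠ 0) :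
    IsConnected (middleCell a (3 * a) fun v => 0 < σ * v.1) := by
  have hab : a < 3 * a := by linarith
  have hK : IsConnected {v : ℝ × ℝ | 0 < σ * v.1} := by
    simpa using isConnected_halfPlane (c := σ) (d := 0) (by simpa using hσ)
  have hne : ∀ v ∈ {v : ℝ × ℝ | 0 < σ * v.1}, v.1 ≠ 0 := fun v hv h => by
    rw [Set.mem_ofPred_eq, h] at hv
    simp at hv
  exact isConnected_middle ha hab hK
    (fun v hv c hc => by
      have : 0 < c * (σ * v.1) := mul_pos hc hv
      change 0 < σ * (c * v.1)
      linarith)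
    (fun v hv h => hne v hv (by rw [h]; rfl))
    (fun v hv => innerForm_lt_outerForm_of_fst_ne ha hab le_rfl (hne v hv))

theorem forms_eq_of_wedge (ha : 0 < a) (h3 : 3 * a < b)
    (h : (crossFst a b * v.2) ^ 2 = (crossSnd a b * v.1) ^ 2) :
    innerForm a b v = outerForm a b v := by
  have hab : a < b := by linarith
  have hp := crossFst_pos ha h3
  obtain ⟨hi, ho⟩ := forms_crossing ha h3
  set p₀ := crossFst a b
  set q₀ := crossSnd a b
  have e1 : v.1 ^ 2 = ((v.1 / p₀) • (p₀, q₀)).1 ^ 2 := by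
    simp only [Prod.smul_fst, smul_eq_mul]; field_simp
  have e2 : v.2 ^ 2 = ((v.1 / p₀) • (p₀, q₀)).2 ^ 2 := by
    simp only [Prod.smul_snd, smul_eq_mul]; field_simp; linear_combination h
  rw [innerForm, outerForm, envelope_congr e1 e2, envelope_congr e1 e2,
    ← innerForm, ← outerForm, innerForm_smul ha hab, outerForm_smul, hi, ho]

theorem innerForm_lt_iff (ha : 0 < a) (h3 : 3 * a < b) :
    innerForm a b v < outerForm a b v ↔ (crossFst a b * v.2) ^ 2 < (crossSnd a b * v.1) ^ 2 := by
  refine ⟨fun h => ?_, innerForm_lt_outerForm_of_wedge ha h3⟩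
  by_contra! hc
  rcases hc.lt_or_eq with hc | hc
  · linarith [outerForm_lt_innerForm_of_wedge ha h3 hc]
  · linarith [forms_eq_of_wedge ha h3 hc.symm]

theorem outerForm_lt_iff (ha : 0 < a) (h3 : 3 * a < b) :
    outerForm a b v < innerForm a b v ↔ (crossSnd a b * v.1) ^ 2 < (crossFst a b * v.2) ^ 2 := by
  refine ⟨fun h => ?_, outerForm_lt_innerForm_of_wedge ha h3⟩
  by_contra! hc
  rcases hc.lt_or_eq with hc | hc
  · linarith [innerForm_lt_outerForm_of_wedge ha h3 hc]
  · linarith [forms_eq_of_wedge ha h3 hc]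

theorem sq_lt_sq_iff_wedge {σ x y : ℝ} (hσ : σ ^ 2 = 1) (h : 0 < σ * y) :
    x ^ 2 < y ^ 2 ↔ 0 < σ * y + x ∧ 0 < σ * y + -x := by
  rw [show y ^ 2 = (σ * y) ^ 2 by rw [mul_pow, hσ, one_mul]]
  constructor
  · intro h'
    obtain ⟨h1, h2⟩ := abs_lt_of_sq_lt_sq' h' h.le
    constructor <;> linarith
  · rintro ⟨h1, h2⟩
    exact sq_lt_sq' (by linarith) (by linarith)

theorem isConnected_wedge {c d c' d' : ℝ} (w : ℝ × ℝ) (h1 : 0 < c * w.1 + d * w.2)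
    (h2 : 0 < c' * w.1 + d' * w.2) :
    IsConnected ({v : ℝ × ℝ | 0 < c * v.1 + d * v.2} ∩ {v : ℝ × ℝ | 0 < c' * v.1 + d' * v.2}) :=
  ⟨⟨w, h1, h2⟩, ((convex_halfPlane c d).inter (convex_halfPlane c' d')).isPreconnected⟩

theorem wedge_cone {c d c' d' : ℝ} : ∀ v ∈ {v : ℝ × ℝ | 0 < c * v.1 + d * v.2} ∩
    {v : ℝ × ℝ | 0 < c' * v.1 + d' * v.2}, ∀ k : ℝ, 0 < k → k • v ∈
    {v : ℝ × ℝ | 0 < c * v.1 + d * v.2} ∩ {v : ℝ × ℝ | 0 < c' * v.1 + d' * v.2} := by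
  rintro v ⟨h1, h2⟩ k hk
  have h1 := mul_pos hk h1
  have h2 := mul_pos hk h2
  constructor <;> simp only [Set.mem_ofPred_eq, Prod.smul_fst, Prod.smul_snd, smul_eq_mul] <;>
    linarith

theorem isConnected_middleCell_of_lt (ha : 0 < a) (h3 : 3 * a < b) {σ : ℝ} (hσ : σ ^ 2 = 1) :
    IsConnected (middleCell a b fun v => 0 < σ * v.1) := by
  have hab : a < b := by linarith
  have hp := crossFst_pos ha h3
  have hq := crossSnd_pos ha hab
  have hpos : ∀ v : ℝ × ℝ, 0 < σ * crossSnd a b * v.1 + crossFst a b * v.2 →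
      0 < σ * crossSnd a b * v.1 + -crossFst a b * v.2 →
      0 < σ * v.1 ∧ (crossFst a b * v.2) ^ 2 < (crossSnd a b * v.1) ^ 2 := fun v h1 h2 => by
    have h : 0 < σ * (crossSnd a b * v.1) := by linarith
    exact ⟨pos_of_mul_pos_right (by linarith : 0 < crossSnd a b * (σ * v.1)) hq.le,
      (sq_lt_sq_iff_wedge hσ h).2 ⟨by linarith, by linarith⟩⟩
  have h1 : σ * crossSnd a b * σ = crossSnd a b := by linear_combination crossSnd a b * hσ
  have := isConnected_middle ha hab
    (isConnected_wedge (c := σ * crossSnd a b) (d := crossFst a b) (c' := σ * crossSnd a b)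
      (d' := -crossFst a b) (σ, 0) (by simp [h1, hq]) (by simp [h1, hq])) wedge_cone
    (fun v hv h => by have := (hpos v hv.1 hv.2).1; rw [h] at this; simp at this)
    (fun v hv => innerForm_lt_outerForm_of_wedge ha h3 (hpos v hv.1 hv.2).2)
  convert this using 1
  ext v
  constructor
  · rintro ⟨h1, h2, h3'⟩
    have h1 : 0 < σ * v.1 := h1
    -- The inequalities `inner < 1 < outer` already force `v` into the wedges around the `p`-axis;
    -- the sign condition selects one of them.
    have hlt := (innerForm_lt_iff ha h3).1 (h2.trans h3')
    rw [sq_lt_sq_iff_wedge hσ (by have := mul_pos hq h1; linarith)] at hlt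
    refine ⟨⟨?_, ?_⟩, h2, h3'⟩ <;> simp only [Set.mem_ofPred_eq] <;> linarith [hlt.1, hlt.2]
  · rintro ⟨⟨h1, h1'⟩, h2, h3'⟩
    exact ⟨(hpos v h1 h1').1, h2, h3'⟩

theorem isConnected_middleCell' (ha : 0 < a) (h3 : 3 * a < b) {σ : ℝ} (hσ : σ ^ 2 = 1) :
    IsConnected (middleCell' a b σ) := by
  have hab : a < b := by linarith
  have hp := crossFst_pos ha h3
  have hq := crossSnd_pos ha hab
  have hpos : ∀ v : ℝ × ℝ, 0 < crossSnd a b * v.1 + σ * crossFst a b * v.2 →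
      0 < -crossSnd a b * v.1 + σ * crossFst a b * v.2 →
      0 < σ * v.2 ∧ (crossSnd a b * v.1) ^ 2 < (crossFst a b * v.2) ^ 2 := fun v h1 h2 => by
    have h : 0 < σ * (crossFst a b * v.2) := by linarith
    exact ⟨pos_of_mul_pos_right (by linarith : 0 < crossFst a b * (σ * v.2)) hp.le,
      (sq_lt_sq_iff_wedge hσ h).2 ⟨by linarith, by linarith⟩⟩
  have h1 : σ * crossFst a b * σ = crossFst a b := by linear_combination crossFst a b * hσ
  have hne : ∀ v : ℝ × ℝ, 0 < σ * v.2 → v ≠ 0 := by rintro v hv rfl; simp at hv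
  have := isConnected_between (g₁ := outerForm a b) (g₂ := innerForm a b)
    (isConnected_wedge (c := crossSnd a b) (d := σ * crossFst a b) (c' := -crossSnd a b)
      (d' := σ * crossFst a b) (0, σ) (by simp [h1, hp]) (by simp [h1, hp])) wedge_cone
    (continuous_outerForm a b) (continuous_innerForm ha hab) (outerForm_smul a b)
    (innerForm_smul ha hab)
    (fun v hv => (outerForm_pos ha hab (hne v (hpos v hv.1 hv.2).1)).le)
    (fun v hv => outerForm_lt_innerForm_of_wedge ha h3 (hpos v hv.1 hv.2).2)
  convert this using 1
  ext v
  constructor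
  · rintro ⟨h1, h2, h3'⟩
    have h1 : 0 < σ * v.2 := h1
    have hlt := (outerForm_lt_iff ha h3).1 (h2.trans h3')
    rw [sq_lt_sq_iff_wedge hσ (by have := mul_pos hp h1; linarith)] at hlt
    refine ⟨⟨?_, ?_⟩, h2, h3'⟩ <;> simp only [Set.mem_ofPred_eq] <;> linarith [hlt.1, hlt.2]
  · rintro ⟨⟨h1, h1'⟩, h2, h3'⟩
    exact ⟨(hpos v h1 h1').1, h2, h3'⟩

/-- Star-shaped about `(0, σ)`: the point `s(0, σ) + tv` has the first coordinate of `tv` and a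
second coordinate at least as large in absolute value, so `innerForm_pos_of_le` applies. -/
theorem isConnected_innerForm_pos (ha : 0 < a) (hab : a < b) (h2 : 2 * a < b) {σ : ℝ}
    (hσ : σ ^ 2 = 1) : IsConnected {v : ℝ × ℝ | 0 < σ * v.2 ∧ 0 < innerForm a b v} := by
  have hσ0 : σ ≠ 0 := by rintro rfl; norm_num at hσ
  have hmem : ((0 : ℝ), σ) ∈ {v : ℝ × ℝ | 0 < σ * v.2 ∧ 0 < innerForm a b v} :=
    ⟨by simp only; nlinarith, innerForm_axis_pos ha hab h2 hσ0⟩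
  have hs : StarConvex ℝ ((0 : ℝ), σ) {v : ℝ × ℝ | 0 < σ * v.2 ∧ 0 < innerForm a b v} := by
    rintro v ⟨hv, hv'⟩ s t hs ht hst
    have e1 : (s • ((0 : ℝ), σ) + t • v).1 = t * v.1 := by simp
    have e2 : (s • ((0 : ℝ), σ) + t • v).2 = s * σ + t * v.2 := by simp
    have h2' : 0 < σ * (s * σ + t * v.2) := by
      have e : σ * (s * σ + t * v.2) = s + t * (σ * v.2) := by linear_combination s * hσ
      rw [e]
      rcases hs.lt_or_eq with hs | rfl
      · have : 0 ≤ t * (σ * v.2) := by positivity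
        linarith
      · obtain rfl : t = 1 := by linarith
        linarith
    refine ⟨by rw [e2]; exact h2', ?_⟩
    rcases ht.lt_or_eq with ht0 | rfl
    · have hpos : 0 < innerForm a b (t • v) := by
        rw [innerForm_smul ha hab]; positivity
      refine innerForm_pos_of_le ha hab hpos (by rw [e1]; rfl) ?_
      rw [e2, Prod.smul_snd, smul_eq_mul]
      have : 0 ≤ t * s * (σ * v.2) := by positivity
      nlinarith [sq_nonneg (s * σ)]
    · obtain rfl : s = 1 := by linarith
      rw [one_smul, zero_smul, add_zero]
      exact hmem.2
  exact (hs.isPathConnected hmem).isConnected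

theorem isConnected_upperCell (ha : 0 < a) (hab : a < b) (h2 : 2 * a < b) {σ : ℝ}
    (hσ : σ ^ 2 = 1) : IsConnected (upperCell a b σ) := by
  have hne : ∀ v : ℝ × ℝ, 0 < σ * v.2 → v ≠ 0 := by rintro v hv rfl; simp at hv
  -- Being above both caustics means that the smaller form exceeds 1; the lower bound is vacuous,
  -- hence the form 0.
  have := isConnected_between (g₁ := fun _ => 0)
    (g₂ := fun v => min (innerForm a b v) (outerForm a b v))
    (isConnected_innerForm_pos ha hab h2 hσ)
    (fun v hv c hc => by
      refine ⟨?_, ?_⟩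
      · have := mul_pos hc hv.1
        rw [Prod.smul_snd, smul_eq_mul]; linarith
      · rw [innerForm_smul ha hab]; have := hv.2; positivity)
    continuous_const ((continuous_innerForm ha hab).min (continuous_outerForm a b))
    (fun c v => by simp) (fun c v => by
      simp only [innerForm_smul ha hab, outerForm_smul]
      rw [mul_min_of_nonneg _ _ (sq_nonneg c)])
    (fun v _ => le_rfl) (fun v hv => lt_min hv.2 (outerForm_pos ha hab (hne v hv.1)))
  convert this using 1
  ext v
  constructor
  · rintro ⟨h1, h2, h3⟩
    exact ⟨⟨h1, one_pos.trans h2⟩, one_pos, lt_min h2 h3⟩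
  · rintro ⟨⟨h1, -⟩, -, h3⟩
    exact ⟨h1, (lt_min_iff.1 h3).1, (lt_min_iff.1 h3).2⟩

theorem pos_or_pos_neg {x : ℝ} (hx : x ≠ 0) : 0 < 1 * x ∨ 0 < -1 * x := by
  rcases lt_or_gt_of_ne hx with h | h
  · right; linarith
  · left; linarith

theorem isRegionWith_image {W : Set (ℝ × ℝ)} {pos : Space → Prop} {k : ℕ}
    (h : ∀ v ∈ W, pos (lift a b v) ∧ normalCount a b (lift a b v) = k) :
    IsRegionWith a b (lift a b '' W) pos k := by
  rintro _ ⟨v, hv, rfl⟩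
  exact h v hv

theorem isRegionWith_lowerCell (ha : 0 < a) (hab : a < b) :
    IsRegionWith a b (lift a b '' lowerCell a b) (Lower a b) 1 :=
  isRegionWith_image fun _ hv => lower_cell ha hab hv.2.1 hv.2.2

theorem isRegionWith_middleCell (ha : 0 < a) (hab : a < b) (K : ℝ × ℝ → Prop) :
    IsRegionWith a b (lift a b '' middleCell a b K) (Middle a b) 3 :=
  isRegionWith_image fun _ hv => (middle_cell ha hab hv.2.1 hv.2.2).imp_left Or.inr

theorem isRegionWith_middleCell' (ha : 0 < a) (hab : a < b) (σ : ℝ) :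
    IsRegionWith a b (lift a b '' middleCell' a b σ) (Middle a b) 3 :=
  isRegionWith_image fun _ hv => (middle_cell' ha hab hv.2.2 hv.2.1).imp_left Or.inl

theorem isRegionWith_upperCell (ha : 0 < a) (hab : a < b) (σ : ℝ) :
    IsRegionWith a b (lift a b '' upperCell a b σ) (Upper a b) 5 :=
  isRegionWith_image fun _ hv => upper_cell ha hab hv.2.1 hv.2.2

theorem regionsOneThreeFive_of_range {n : ℕ} {W : Fin n → Set (ℝ × ℝ)}
    (hW : regions a b = Set.range fun i => lift a b '' W i)
    (h : ∀ i, IsRegionWith a b (lift a b '' W i) (Lower a b) 1 ∨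
      IsRegionWith a b (lift a b '' W i) (Middle a b) 3 ∨
      IsRegionWith a b (lift a b '' W i) (Upper a b) 5) (i₁ i₂ i₃ : Fin n)
    (h1 : IsRegionWith a b (lift a b '' W i₁) (Lower a b) 1)
    (h2 : IsRegionWith a b (lift a b '' W i₂) (Middle a b) 3)
    (h3 : IsRegionWith a b (lift a b '' W i₃) (Upper a b) 5) : RegionsOneThreeFive a b := by
  refine ⟨?_, ⟨_, ?_, h1⟩, ⟨_, ?_, h2⟩, ⟨_, ?_, h3⟩⟩
  · rw [hW]; rintro _ ⟨i, rfl⟩; exact h i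
  all_goals rw [hW]; exact ⟨_, rfl⟩

theorem regions_of_le_two (ha : 0 < a) (hab : a < b) (h2 : b ≤ 2 * a) :
    ∃ R₁ R₂ : Set Space, R₁ ≠ R₂ ∧ regions a b = {R₁, R₂} ∧
      IsRegionWith a b R₁ (Lower a b) 1 ∧
      IsRegionWith a b R₂
        (fun A => Below A (innerCaustic a b) ∧ Above A (outerCaustic a b)) 3 := by
  set W : Fin 2 → Set (ℝ × ℝ) := ![lowerCell a b, middleCell a b fun _ => True] with hW
  have hdisj : ∀ i j, i ≠ j → Disjoint (W i) (W j) := by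
    intro i j hij
    fin_cases i <;> fin_cases j <;> first
      | exact absurd rfl hij
      | exact disjoint_cell fun v _ h2 h3 _ h5 h6 => by linarith
  have hconn : ∀ i, IsConnected (W i) := by
    intro i
    fin_cases i
    · exact isConnected_lowerCell ha hab
    · exact isConnected_middleCell_top ha hab (by linarith)
  have hr := regions_eq_range ha hab (W := W) (fun i => by
    fin_cases i
    · exact isOpen_lowerCell ha hab
    · exact isOpen_middleCell ha hab (by simp)) hconn hdisj (by
      ext v
      rw [Set.mem_ofPred_eq, Set.mem_iUnion]
      constructor
      · rintro ⟨-, ho⟩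
        have hi := (innerForm_nonpos (v := v) ha hab h2).trans_lt one_pos
        rcases lt_or_gt_of_ne ho with ho | ho
        · exact ⟨0, trivial, hi, ho⟩
        · exact ⟨1, trivial, hi, ho⟩
      · rintro ⟨i, hi⟩
        fin_cases i
        · exact ⟨hi.2.1.ne, hi.2.2.ne⟩
        · exact ⟨hi.2.1.ne, hi.2.2.ne'⟩)
  refine ⟨lift a b '' W 0, lift a b '' W 1, fun h => ?_, ?_, isRegionWith_lowerCell ha hab,
    isRegionWith_image fun _ hv => middle_cell ha hab hv.2.1 hv.2.2⟩
  · exact absurd (image_lift_injective (fun i => (hconn i).nonempty) hdisj h) (by decide)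
  · rw [hr]
    ext R
    simp only [Set.mem_range, Fin.exists_fin_two, Set.mem_insert_iff, Set.mem_singleton_iff,
      eq_comm]

theorem regions_of_lt_three (ha : 0 < a) (hab : a < b) (h2 : 2 * a < b) (h3 : b < 3 * a) :
    (regions a b).ncard = 4 ∧ RegionsOneThreeFive a b := by
  set W : Fin 4 → Set (ℝ × ℝ) :=
    ![lowerCell a b, middleCell a b fun _ => True, upperCell a b 1, upperCell a b (-1)] with hW
  have hdisj : ∀ i j, i ≠ j → Disjoint (W i) (W j) := by
    intro i j hij
    fin_cases i <;> fin_cases j <;> first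
      | exact absurd rfl hij
      | exact disjoint_cell fun v h1 h2 h3 h4 h5 h6 => by linarith
  have hconn : ∀ i, IsConnected (W i) := by
    intro i
    fin_cases i
    · exact isConnected_lowerCell ha hab
    · exact isConnected_middleCell_top ha hab h3
    · exact isConnected_upperCell ha hab h2 (by norm_num)
    · exact isConnected_upperCell ha hab h2 (by norm_num)
  have hopen : ∀ i, IsOpen (W i) := by
    intro i
    fin_cases i
    · exact isOpen_lowerCell ha hab
    · exact isOpen_middleCell ha hab (by simp)
    · exact isOpen_upperCell ha hab _
    · exact isOpen_upperCell ha hab _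
  have hcover : {v | innerForm a b v ≠ 1 ∧ outerForm a b v ≠ 1} = ⋃ i, W i := by
    ext v
    rw [Set.mem_ofPred_eq, Set.mem_iUnion]
    constructor
    · rintro ⟨hi, ho⟩
      rcases lt_or_gt_of_ne hi with hi | hi
      · rcases lt_or_gt_of_ne ho with ho | ho
        · exact ⟨0, trivial, hi, ho⟩
        · exact ⟨1, trivial, hi, ho⟩
      · have hv : v ≠ 0 := by
          rintro rfl
          rw [(forms_zero ha hab).1] at hi
          linarith
        have ho := hi.trans (innerForm_lt_outerForm ha hab h3 hv)
        rcases pos_or_pos_neg (snd_ne_zero_of_innerForm_pos ha hab (one_pos.trans hi)) with h | h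
        · exact ⟨2, h, hi, ho⟩
        · exact ⟨3, h, hi, ho⟩
    · rintro ⟨i, hi⟩
      fin_cases i
      · exact ⟨hi.2.1.ne, hi.2.2.ne⟩
      · exact ⟨hi.2.1.ne, hi.2.2.ne'⟩
      · exact ⟨hi.2.1.ne', hi.2.2.ne'⟩
      · exact ⟨hi.2.1.ne', hi.2.2.ne'⟩
  refine ⟨regions_ncard ha hab hopen hconn hdisj hcover, regionsOneThreeFive_of_range
    (regions_eq_range ha hab hopen hconn hdisj hcover) (fun i => ?_) 0 1 2
    (isRegionWith_lowerCell ha hab) (isRegionWith_middleCell ha hab _)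
    (isRegionWith_upperCell ha hab _)⟩
  fin_cases i
  · exact Or.inl (isRegionWith_lowerCell ha hab)
  · exact Or.inr (Or.inl (isRegionWith_middleCell ha hab _))
  · exact Or.inr (Or.inr (isRegionWith_upperCell ha hab _))
  · exact Or.inr (Or.inr (isRegionWith_upperCell ha hab _))

theorem innerForm_le_outerForm (ha : 0 < a) (v : ℝ × ℝ) :
    innerForm a (3 * a) v ≤ outerForm a (3 * a) v := by
  rcases eq_or_ne v.1 0 with h | h
  · rw [show v = (0, v.2) from Prod.ext h rfl, (innerForm_eq_outerForm_axis ha v.2).1,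
      (innerForm_eq_outerForm_axis ha v.2).2]
  · exact (innerForm_lt_outerForm_of_fst_ne ha (by linarith) le_rfl h).le

theorem fst_ne_zero_of_lt (ha : 0 < a) (h : innerForm a (3 * a) v < outerForm a (3 * a) v) :
    v.1 ≠ 0 := fun h0 => by
  rw [show v = (0, v.2) from Prod.ext h0 rfl, (innerForm_eq_outerForm_axis ha v.2).1,
    (innerForm_eq_outerForm_axis ha v.2).2] at h
  exact lt_irrefl _ h

theorem regions_of_eq_three (ha : 0 < a) :
    (regions a (3 * a)).ncard = 5 ∧ RegionsOneThreeFive a (3 * a) := by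
  have hab : a < 3 * a := by linarith
  have h2 : 2 * a < 3 * a := by linarith
  set b := 3 * a with hb
  set W : Fin 5 → Set (ℝ × ℝ) :=
    ![lowerCell a b, middleCell a b fun v => 0 < 1 * v.1, middleCell a b fun v => 0 < -1 * v.1,
      upperCell a b 1, upperCell a b (-1)] with hW
  have hdisj : ∀ i j, i ≠ j → Disjoint (W i) (W j) := by
    intro i j hij
    fin_cases i <;> fin_cases j <;> first
      | exact absurd rfl hij
      | exact disjoint_cell fun v h1 h2 h3 h4 h5 h6 => by linarith
  have hconn : ∀ i, IsConnected (W i) := by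
    intro i
    fin_cases i
    · exact isConnected_lowerCell ha hab
    · exact isConnected_middleCell_of_eq ha (by norm_num)
    · exact isConnected_middleCell_of_eq ha (by norm_num)
    · exact isConnected_upperCell ha hab h2 (by norm_num)
    · exact isConnected_upperCell ha hab h2 (by norm_num)
  have hopen : ∀ i, IsOpen (W i) := by
    intro i
    fin_cases i
    · exact isOpen_lowerCell ha hab
    · exact isOpen_middleCell ha hab (isOpen_pos_fst _)
    · exact isOpen_middleCell ha hab (isOpen_pos_fst _)
    · exact isOpen_upperCell ha hab _
    · exact isOpen_upperCell ha hab _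
  have hcover : {v | innerForm a b v ≠ 1 ∧ outerForm a b v ≠ 1} = ⋃ i, W i := by
    ext v
    rw [Set.mem_ofPred_eq, Set.mem_iUnion]
    constructor
    · rintro ⟨hi, ho⟩
      rcases lt_or_gt_of_ne hi with hi | hi
      · rcases lt_or_gt_of_ne ho with ho | ho
        · exact ⟨0, trivial, hi, ho⟩
        · rcases pos_or_pos_neg (fst_ne_zero_of_lt ha (hi.trans ho)) with h | h
          · exact ⟨1, h, hi, ho⟩
          · exact ⟨2, h, hi, ho⟩
      · have ho := hi.trans_le (innerForm_le_outerForm ha v)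
        rcases pos_or_pos_neg (snd_ne_zero_of_innerForm_pos ha hab (one_pos.trans hi)) with h | h
        · exact ⟨3, h, hi, ho⟩
        · exact ⟨4, h, hi, ho⟩
    · rintro ⟨i, hi⟩
      fin_cases i
      · exact ⟨hi.2.1.ne, hi.2.2.ne⟩
      · exact ⟨hi.2.1.ne, hi.2.2.ne'⟩
      · exact ⟨hi.2.1.ne, hi.2.2.ne'⟩
      · exact ⟨hi.2.1.ne', hi.2.2.ne'⟩
      · exact ⟨hi.2.1.ne', hi.2.2.ne'⟩
  refine ⟨regions_ncard ha hab hopen hconn hdisj hcover, regionsOneThreeFive_of_range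
    (regions_eq_range ha hab hopen hconn hdisj hcover) (fun i => ?_) 0 1 3
    (isRegionWith_lowerCell ha hab) (isRegionWith_middleCell ha hab _)
    (isRegionWith_upperCell ha hab _)⟩
  fin_cases i
  · exact Or.inl (isRegionWith_lowerCell ha hab)
  · exact Or.inr (Or.inl (isRegionWith_middleCell ha hab _))
  · exact Or.inr (Or.inl (isRegionWith_middleCell ha hab _))
  · exact Or.inr (Or.inr (isRegionWith_upperCell ha hab _))
  · exact Or.inr (Or.inr (isRegionWith_upperCell ha hab _))

theorem regions_of_three_lt (ha : 0 < a) (h3 : 3 * a < b) :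
    (regions a b).ncard = 7 ∧ RegionsOneThreeFive a b := by
  have hab : a < b := by linarith
  have h2 : 2 * a < b := by linarith
  -- One lower cell, two middle cells around the `p`-axis, two middle cells around the `q`-axis with
  -- the order of the forms reversed, and two upper cells.
  set W : Fin 7 → Set (ℝ × ℝ) :=
    ![lowerCell a b, middleCell a b fun v => 0 < 1 * v.1, middleCell a b fun v => 0 < -1 * v.1,
      middleCell' a b 1, middleCell' a b (-1), upperCell a b 1, upperCell a b (-1)] with hW
  have hdisj : ∀ i j, i ≠ j → Disjoint (W i) (W j) := by
    intro i j hij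
    fin_cases i <;> fin_cases j <;> first
      | exact absurd rfl hij
      | exact disjoint_cell fun v h1 h2 h3 h4 h5 h6 => by linarith
  have hconn : ∀ i, IsConnected (W i) := by
    intro i
    fin_cases i
    · exact isConnected_lowerCell ha hab
    · exact isConnected_middleCell_of_lt ha h3 (by norm_num)
    · exact isConnected_middleCell_of_lt ha h3 (by norm_num)
    · exact isConnected_middleCell' ha h3 (by norm_num)
    · exact isConnected_middleCell' ha h3 (by norm_num)
    · exact isConnected_upperCell ha hab h2 (by norm_num)
    · exact isConnected_upperCell ha hab h2 (by norm_num)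
  have hopen : ∀ i, IsOpen (W i) := by
    intro i
    fin_cases i
    · exact isOpen_lowerCell ha hab
    · exact isOpen_middleCell ha hab (isOpen_pos_fst _)
    · exact isOpen_middleCell ha hab (isOpen_pos_fst _)
    · exact isOpen_middleCell' ha hab _
    · exact isOpen_middleCell' ha hab _
    · exact isOpen_upperCell ha hab _
    · exact isOpen_upperCell ha hab _
  have hcover : {v | innerForm a b v ≠ 1 ∧ outerForm a b v ≠ 1} = ⋃ i, W i := by
    ext v
    rw [Set.mem_ofPred_eq, Set.mem_iUnion]
    constructor
    · rintro ⟨hi, ho⟩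
      rcases lt_or_gt_of_ne hi with hi | hi
      · rcases lt_or_gt_of_ne ho with ho | ho
        · exact ⟨0, trivial, hi, ho⟩
        · have hv : v.1 ≠ 0 := by
            intro h
            have := (innerForm_lt_iff ha h3).1 (hi.trans ho)
            rw [h, mul_zero, zero_pow two_ne_zero] at this
            exact (sq_nonneg _).not_gt this
          rcases pos_or_pos_neg hv with h | h
          · exact ⟨1, h, hi, ho⟩
          · exact ⟨2, h, hi, ho⟩
      · rcases pos_or_pos_neg (snd_ne_zero_of_innerForm_pos ha hab (one_pos.trans hi)) with h | h
        · rcases lt_or_gt_of_ne ho with ho | ho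
          · exact ⟨3, h, ho, hi⟩
          · exact ⟨5, h, hi, ho⟩
        · rcases lt_or_gt_of_ne ho with ho | ho
          · exact ⟨4, h, ho, hi⟩
          · exact ⟨6, h, hi, ho⟩
    · rintro ⟨i, hi⟩
      fin_cases i
      · exact ⟨hi.2.1.ne, hi.2.2.ne⟩
      · exact ⟨hi.2.1.ne, hi.2.2.ne'⟩
      · exact ⟨hi.2.1.ne, hi.2.2.ne'⟩
      · exact ⟨hi.2.2.ne', hi.2.1.ne⟩
      · exact ⟨hi.2.2.ne', hi.2.1.ne⟩
      · exact ⟨hi.2.1.ne', hi.2.2.ne'⟩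
      · exact ⟨hi.2.1.ne', hi.2.2.ne'⟩
  refine ⟨regions_ncard ha hab hopen hconn hdisj hcover, regionsOneThreeFive_of_range
    (regions_eq_range ha hab hopen hconn hdisj hcover) (fun i => ?_) 0 1 5
    (isRegionWith_lowerCell ha hab) (isRegionWith_middleCell ha hab _)
    (isRegionWith_upperCell ha hab _)⟩
  fin_cases i
  · exact Or.inl (isRegionWith_lowerCell ha hab)
  · exact Or.inr (Or.inl (isRegionWith_middleCell ha hab _))
  · exact Or.inr (Or.inl (isRegionWith_middleCell ha hab _))
  · exact Or.inr (Or.inl (isRegionWith_middleCell' ha hab _))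
  · exact Or.inr (Or.inl (isRegionWith_middleCell' ha hab _))
  · exact Or.inr (Or.inr (isRegionWith_upperCell ha hab _))
  · exact Or.inr (Or.inr (isRegionWith_upperCell ha hab _))

end Cells


/-! ### The points E, F, G, H and the counts on the curves -/

section SpecialPoints

variable {a b : ℝ} {v : ℝ × ℝ}

theorem mem_innerCurve_lift (ha : 0 < a) (hab : a < b) :
    lift a b v ∈ innerCurve a b ↔ innerForm a b v = 1 := by
  rw [innerCurve_eq ha hab, (lift_injective a b).mem_set_image]; rfl

theorem mem_outerCurve_lift (ha : 0 < a) (hab : a < b) :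
    lift a b v ∈ outerCurve a b ↔ outerForm a b v = 1 := by
  rw [outerCurve_eq ha hab, (lift_injective a b).mem_set_image]; rfl

theorem exists_lift_innerCurve (ha : 0 < a) (hab : a < b) {A : Space}
    (hA : A ∈ innerCurve a b) : ∃ v, innerForm a b v = 1 ∧ A = lift a b v := by
  rw [innerCurve_eq ha hab] at hA
  obtain ⟨v, hv, rfl⟩ := hA
  exact ⟨v, hv, rfl⟩

theorem exists_lift_outerCurve (ha : 0 < a) (hab : a < b) {A : Space}
    (hA : A ∈ outerCurve a b) : ∃ v, outerForm a b v = 1 ∧ A = lift a b v := by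
  rw [outerCurve_eq ha hab] at hA
  obtain ⟨v, hv, rfl⟩ := hA
  exact ⟨v, hv, rfl⟩

theorem sign_sq {σ : ℝ} (h : σ ∈ ({1, -1} : Set ℝ)) : σ ^ 2 = 1 := by
  rcases h with rfl | rfl <;> norm_num

theorem pointE_eq_lift (ha : 0 < a) (hab : a < b) {σ τ : ℝ} (hσ : σ ^ 2 = 1) (hτ : τ ^ 2 = 1) :
    pointE a b σ τ = lift a b (σ * crossFst a b, τ * crossSnd a b) := by
  have hb := ha.trans hab
  refine space_ext (by simp [pointE, crossFst]) (by simp [pointE, crossSnd]) ?_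
  have h2 : Real.sqrt 2 ^ 2 = 2 := Real.sq_sqrt (by norm_num)
  rw [lift_two]
  simp only [mul_pow, hσ, hτ, one_mul]
  have e1 : crossFst a b ^ 2 = 8 * ((b - a) * (b - 3 * a)) ^ 2 / (a * (a + b) ^ 2) ^ 2 := by
    rw [crossFst, div_pow]; congr 1; linear_combination 4 * ((b - a) * (b - 3 * a)) ^ 2 * h2
  have e2 : crossSnd a b ^ 2 = 8 * ((b - a) * (3 * b - a)) ^ 2 / (b * (a + b) ^ 2) ^ 2 := by
    rw [crossSnd, div_pow]; congr 1; linear_combination 4 * ((b - a) * (3 * b - a)) ^ 2 * h2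
  rw [e1, e2]
  have : a + b ≠ 0 := by linarith
  simp only [pointE]
  simp
  field_simp
  ring

/-- The distance of the points `G₁`, `G₂` from the plane `y = 0`. -/
noncomputable def axisSnd (a b : ℝ) : ℝ := Real.sqrt (2 * (a - b) ^ 2 / (a * b ^ 2 * (b - 2 * a)))

theorem axisSnd_sq (ha : 0 < a) (hb : 0 < b) (h2 : 2 * a < b) :
    axisSnd a b ^ 2 = 2 * (a - b) ^ 2 / (a * b ^ 2 * (b - 2 * a)) := by
  have : 0 < b - 2 * a := by linarith
  exact Real.sq_sqrt (by positivity)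

theorem pointG_eq_lift (ha : 0 < a) (hb : 0 < b) (h2 : 2 * a < b) {τ : ℝ} (hτ : τ ^ 2 = 1) :
    pointG a b τ = lift a b (0, τ * axisSnd a b) := by
  refine space_ext (by simp [pointG]) (by simp [pointG, axisSnd]) ?_
  have : b - 2 * a ≠ 0 := by linarith
  rw [lift_two]
  simp only [mul_pow, hτ, one_mul, axisSnd_sq ha hb h2]
  simp only [pointG]
  simp
  field_simp

theorem axisRate_eq_one_iff (ha : 0 < a) (hab : a < b) (q : ℝ) :
    axisRate a b q = 1 ↔ 2 * a < b ∧ q ^ 2 = axisSnd a b ^ 2 := by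
  have hb := ha.trans hab
  have hba : b - a ≠ 0 := by linarith
  have hiff : ∀ h2 : 2 * a < b, axisRate a b q = 1 ↔ q ^ 2 = axisSnd a b ^ 2 := fun h2 => by
    have : b - 2 * a ≠ 0 := by linarith
    rw [axisSnd_sq ha hb h2, axisRate_eq ha hab, div_eq_one_iff_eq (by positivity),
      eq_div_iff (by positivity)]
    constructor <;> intro h <;> linear_combination h
  refine ⟨fun h => ?_, fun h => (hiff h.1).2 h.2⟩
  have h2 : 2 * a < b := by
    by_contra! hc
    have : profile (b / a) ≤ 0 := profile_nonpos (by rw [div_le_iff₀ ha]; exact hc)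
    have := mul_nonpos_of_nonneg_of_nonpos (by positivity : 0 ≤ b ^ 2 * q ^ 2) this
    rw [axisRate] at h
    linarith
  exact ⟨h2, (hiff h2).1 h⟩

theorem lift_eq_pointG (ha : 0 < a) (hab : a < b) (h : v.1 = 0) (h' : axisRate a b v.2 = 1) :
    lift a b v = pointG a b 1 ∨ lift a b v = pointG a b (-1) := by
  obtain ⟨h2, hq⟩ := (axisRate_eq_one_iff ha hab _).1 h'
  have hb := ha.trans hab
  rw [pointG_eq_lift ha hb h2 (by norm_num), pointG_eq_lift ha hb h2 (by norm_num)]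
  rcases sq_eq_sq_iff_eq_or_eq_neg.1 hq with hq | hq
  · left; rw [one_mul]; exact congrArg _ (Prod.ext h hq)
  · right; rw [neg_one_mul]; exact congrArg _ (Prod.ext h hq)

/-- The points `G` are exactly the points of the axis with `axisRate = 1`, the only exception to the
generic count. -/
theorem normalCount_eq_of_ne (ha : 0 < a) (hab : a < b)
    (h : 2 * a < b → lift a b v ≠ pointG a b 1 ∧ lift a b v ≠ pointG a b (-1)) :
    normalCount a b (lift a b v) = 1 + crossings (innerForm a b v) +
      crossings (outerForm a b v) :=
  normalCount_eq ha hab fun h0 h1 => by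
    have hne := h ((axisRate_eq_one_iff ha hab _).1 h1).1
    exact (lift_eq_pointG ha hab h0 h1).elim hne.1 hne.2

theorem normalCount_of_inner (ha : 0 < a) (hab : a < b)
    (h : 2 * a < b → lift a b v ≠ pointG a b 1 ∧ lift a b v ≠ pointG a b (-1))
    (hi : innerForm a b v = 1) :
    (outerForm a b v < 1 → normalCount a b (lift a b v) = 2) ∧
      (outerForm a b v = 1 → normalCount a b (lift a b v) = 3) ∧
      (1 < outerForm a b v → normalCount a b (lift a b v) = 4) := by
  rw [normalCount_eq_of_ne ha hab h, hi, crossings_one]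
  refine ⟨fun h => ?_, fun h => ?_, fun h => ?_⟩
  · rw [crossings_of_lt h]
  · rw [h, crossings_one]
  · rw [crossings_of_gt h]

theorem normalCount_of_outer (ha : 0 < a) (hab : a < b)
    (h : 2 * a < b → lift a b v ≠ pointG a b 1 ∧ lift a b v ≠ pointG a b (-1))
    (ho : outerForm a b v = 1) :
    (innerForm a b v < 1 → normalCount a b (lift a b v) = 2) ∧
      (1 < innerForm a b v → normalCount a b (lift a b v) = 4) := by
  rw [normalCount_eq_of_ne ha hab h, ho, crossings_one]
  refine ⟨fun h => ?_, fun h => ?_⟩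
  · rw [crossings_of_lt h]
  · rw [crossings_of_gt h]

theorem ne_pointG_of_fst (ha : 0 < a) (hab : a < b) (h : v.1 ≠ 0) :
    2 * a < b → lift a b v ≠ pointG a b 1 ∧ lift a b v ≠ pointG a b (-1) := fun h2 => by
  rw [pointG_eq_lift ha (ha.trans hab) h2 (by norm_num),
    pointG_eq_lift ha (ha.trans hab) h2 (by norm_num)]
  constructor <;> intro h' <;> exact h (congrArg Prod.fst (lift_injective a b h'))

/-- The off-plane pair has merged, so only the in-plane normals count. There are 3 of them, since
`b²q²/8 > axisRate = 1` by strict maximality of the profile at 3; for `b = 3a` equality holds and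
two coincide. -/
theorem normalCount_pointG (ha : 0 < a) (hab : a < b) (h2 : 2 * a < b) {τ : ℝ} (hτ : τ ^ 2 = 1) :
    axisRate a b (τ * axisSnd a b) = 1 ∧ (b ≠ 3 * a → 1 < b ^ 2 * (τ * axisSnd a b) ^ 2 / 8) ∧
      normalCount a b (pointG a b τ) = if b = 3 * a then 2 else 3 := by
  have h1 : axisRate a b (τ * axisSnd a b) = 1 :=
    (axisRate_eq_one_iff ha hab _).2 ⟨h2, by rw [mul_pow, hτ, one_mul]⟩
  have hq : τ * axisSnd a b ≠ 0 := fun h => by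
    rw [h, axisRate] at h1
    norm_num at h1
  have hlt : b ≠ 3 * a → 1 < b ^ 2 * (τ * axisSnd a b) ^ 2 / 8 := fun h => by
    rw [← h1]
    exact axisRate_lt ha (ha.trans hab) h hq
  refine ⟨h1, hlt, ?_⟩
  rw [pointG_eq_lift ha (ha.trans hab) h2 hτ, normalCount_axis ha hab, h1,
    if_neg (lt_irrefl _), add_zero]
  split_ifs with h
  · have e : b ^ 2 * (τ * axisSnd a b) ^ 2 / 8 = 1 := by
      have : profile (b / a) = 1 / 8 := by rw [h, mul_div_cancel_right₀ _ ha.ne', profile_three]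
      rw [axisRate, this] at h1
      linarith
    rw [e, crossings_one]
  · rw [crossings_of_gt (hlt h)]

theorem forms_pointE (ha : 0 < a) (h3 : 3 * a < b) {σ τ : ℝ} (hσ : σ ^ 2 = 1) (hτ : τ ^ 2 = 1) :
    innerForm a b (σ * crossFst a b, τ * crossSnd a b) = 1 ∧
      outerForm a b (σ * crossFst a b, τ * crossSnd a b) = 1 := by
  obtain ⟨hi, ho⟩ := forms_crossing ha h3
  have e1 : (σ * crossFst a b, τ * crossSnd a b).1 ^ 2 = (crossFst a b, crossSnd a b).1 ^ 2 := by
    simp only [mul_pow, hσ, one_mul]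
  have e2 : (σ * crossFst a b, τ * crossSnd a b).2 ^ 2 = (crossFst a b, crossSnd a b).2 ^ 2 := by
    simp only [mul_pow, hτ, one_mul]
  exact ⟨(envelope_congr e1 e2).trans hi, (envelope_congr e1 e2).trans ho⟩

theorem normalCount_pointE (ha : 0 < a) (h3 : 3 * a < b) {σ τ : ℝ} (hσ : σ ^ 2 = 1)
    (hτ : τ ^ 2 = 1) : normalCount a b (pointE a b σ τ) = 3 := by
  have hab : a < b := by linarith
  obtain ⟨hi, ho⟩ := forms_pointE ha h3 hσ hτ
  have hσ0 : σ ≠ 0 := by rintro rfl; norm_num at hσ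
  rw [pointE_eq_lift ha hab hσ hτ]
  exact (normalCount_of_inner ha hab
    (ne_pointG_of_fst ha hab (mul_ne_zero hσ0 (crossFst_pos ha h3).ne')) hi).2.1 ho

theorem fst_ne_zero_of_forms (ha : 0 < a) (h3 : 3 * a < b) (hi : innerForm a b v = 1)
    (ho : outerForm a b v = 1) : v.1 ≠ 0 := fun h => by
  have hab : a < b := by linarith
  have h2 := snd_ne_zero_of_innerForm_pos ha hab (hi ▸ one_pos)
  have := axisRate_lt ha (ha.trans hab) h3.ne' h2
  rw [show v = (0, v.2) from Prod.ext h rfl] at hi ho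
  rw [innerForm, innerEnvelope_axis_of_ge ha hab h3.le] at hi
  rw [outerForm, outerEnvelope_axis_of_ge ha hab h3.le] at ho
  linarith

theorem curves_inter_eq_image (ha : 0 < a) (h3 : 3 * a < b) :
    innerCurve a b ∩ outerCurve a b = lift a b ''
      {(crossFst a b, crossSnd a b), (-crossFst a b, -crossSnd a b),
        (crossFst a b, -crossSnd a b), (-crossFst a b, crossSnd a b)} := by
  have hab : a < b := by linarith
  ext A
  constructor
  · rintro ⟨h1, h2⟩
    obtain ⟨v, hi, rfl⟩ := exists_lift_innerCurve ha hab h1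
    have ho := (mem_outerCurve_lift ha hab).1 h2
    rw [(lift_injective a b).mem_set_image]
    obtain ⟨-, e1, e2⟩ := crossing ha hab (fst_ne_zero_of_forms ha h3 hi ho)
      (snd_ne_zero_of_innerForm_pos ha hab (hi ▸ one_pos)) hi ho
    obtain ⟨p, q⟩ := v
    simp only [Set.mem_insert_iff, Set.mem_singleton_iff, Prod.mk.injEq]
    rcases sq_eq_sq_iff_eq_or_eq_neg.1 e1 with e1 | e1 <;>
      rcases sq_eq_sq_iff_eq_or_eq_neg.1 e2 with e2 | e2
    · exact Or.inl ⟨e1, e2⟩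
    · exact Or.inr (Or.inr (Or.inl ⟨e1, e2⟩))
    · exact Or.inr (Or.inr (Or.inr ⟨e1, e2⟩))
    · exact Or.inr (Or.inl ⟨e1, e2⟩)
  · have key : ∀ σ τ : ℝ, σ ^ 2 = 1 → τ ^ 2 = 1 →
        lift a b (σ * crossFst a b, τ * crossSnd a b) ∈ innerCurve a b ∩ outerCurve a b :=
      fun σ τ hσ hτ => ⟨(mem_innerCurve_lift ha hab).2 (forms_pointE ha h3 hσ hτ).1,
        (mem_outerCurve_lift ha hab).2 (forms_pointE ha h3 hσ hτ).2⟩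
    rintro ⟨v, hv, rfl⟩
    rcases hv with rfl | rfl | rfl | rfl
    · simpa using key 1 1 (by norm_num) (by norm_num)
    · simpa using key (-1) (-1) (by norm_num) (by norm_num)
    · simpa using key 1 (-1) (by norm_num) (by norm_num)
    · simpa using key (-1) 1 (by norm_num) (by norm_num)

theorem curves_inter (ha : 0 < a) (h3 : 3 * a < b) :
    innerCurve a b ∩ outerCurve a b =
        {pointE a b 1 1, pointE a b (-1) (-1), pointE a b 1 (-1), pointE a b (-1) 1} ∧
      (innerCurve a b ∩ outerCurve a b).ncard = 4 := by
  have hab : a < b := by linarith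
  have hp := crossFst_pos ha h3
  have hq := crossSnd_pos ha hab
  rw [curves_inter_eq_image ha h3]
  constructor
  · rw [pointE_eq_lift ha hab (by norm_num) (by norm_num),
      pointE_eq_lift ha hab (by norm_num) (by norm_num),
      pointE_eq_lift ha hab (by norm_num) (by norm_num),
      pointE_eq_lift ha hab (by norm_num) (by norm_num)]
    simp only [Set.image_insert_eq, Set.image_singleton, one_mul, neg_one_mul]
  · have n1 : crossFst a b ≠ -crossFst a b := by linarith
    have n2 : crossSnd a b ≠ -crossSnd a b := by linarith
    rw [Set.ncard_image_of_injective _ (lift_injective a b), Set.ncard_insert_of_notMem,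
      Set.ncard_insert_of_notMem, Set.ncard_pair]
    · simp [n1]
    · simp [n1.symm, n2.symm]
    · simp [n1, n2]

theorem crossFst_three (a : ℝ) : crossFst a (3 * a) = 0 := by simp [crossFst]

theorem crossSnd_three (ha : 0 < a) : crossSnd a (3 * a) = 2 * Real.sqrt 2 / (3 * a) := by
  unfold crossSnd
  field_simp
  ring

theorem axisSnd_three (ha : 0 < a) : axisSnd a (3 * a) = 2 * Real.sqrt 2 / (3 * a) := by
  have h2 : Real.sqrt 2 ^ 2 = 2 := Real.sq_sqrt (by norm_num)
  unfold axisSnd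
  rw [Real.sqrt_eq_iff_mul_self_eq (by
    have : 0 < 3 * a - 2 * a := by linarith
    positivity) (by positivity)]
  have : 3 * a - 2 * a = a := by ring
  rw [this]
  field_simp
  rw [h2]
  ring

theorem special_points_three (ha : 0 < a) {σ τ : ℝ} (hτ : τ ^ 2 = 1) (hσ : σ ^ 2 = 1) :
    pointE a (3 * a) σ τ = pointF (3 * a) τ ∧ pointE a (3 * a) σ τ = pointG a (3 * a) τ ∧
      pointE a (3 * a) σ τ = pointH a (3 * a) τ := by
  have h2 : Real.sqrt 2 ^ 2 = 2 := Real.sq_sqrt (by norm_num)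
  have hab : a < 3 * a := by linarith
  rw [pointE_eq_lift ha hab hσ hτ, pointG_eq_lift ha (by positivity) (by linarith) hτ,
    crossFst_three, crossSnd_three ha, axisSnd_three ha, mul_zero]
  have hz : lift a (3 * a) (0, τ * (2 * Real.sqrt 2 / (3 * a))) 2 = 4 / (3 * a) := by
    rw [lift_two]
    simp only [mul_pow, div_pow, hτ, h2]
    field_simp
    ring
  refine ⟨?_, rfl, ?_⟩
  · refine space_ext (by simp [pointF]) (by simp [pointF]) ?_
    rw [hz]; simp [pointF]
  · refine space_ext (by simp [pointH]) ?_ ?_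
    · rw [lift_one]
      have : Real.sqrt ((3 * a - a) ^ 3 / (a ^ 3 * (3 * a) ^ 2)) = 2 * Real.sqrt 2 / (3 * a) := by
        rw [Real.sqrt_eq_iff_mul_self_eq (by
          have : 0 < 3 * a - a := by linarith
          positivity) (by positivity)]
        field_simp
        rw [h2]
        ring
      simp [pointH, this]
    · rw [hz]
      simp [pointH]
      field_simp
      ring

theorem forms_axis_three (ha : 0 < a) {τ : ℝ} (hτ : τ ^ 2 = 1) :
    innerForm a (3 * a) (0, τ * crossSnd a (3 * a)) = 1 ∧
      outerForm a (3 * a) (0, τ * crossSnd a (3 * a)) = 1 := by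
  have h2 : Real.sqrt 2 ^ 2 = 2 := Real.sq_sqrt (by norm_num)
  rw [(innerForm_eq_outerForm_axis ha _).1, (innerForm_eq_outerForm_axis ha _).2, and_self,
    crossSnd_three ha]
  simp only [mul_pow, div_pow, hτ, h2]
  field_simp
  norm_num

theorem curves_inter_three (ha : 0 < a) :
    innerCurve a (3 * a) ∩ outerCurve a (3 * a) =
      {pointE a (3 * a) 1 1, pointE a (3 * a) (-1) (-1)} := by
  have hab : a < 3 * a := by linarith
  have hq := crossSnd_pos ha hab
  rw [pointE_eq_lift ha hab (by norm_num) (by norm_num),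
    pointE_eq_lift ha hab (by norm_num) (by norm_num), crossFst_three, mul_zero, mul_zero]
  ext A
  constructor
  · rintro ⟨h1, h2⟩
    obtain ⟨v, hi, rfl⟩ := exists_lift_innerCurve ha hab h1
    have ho := (mem_outerCurve_lift ha hab).1 h2
    have h0 : v.1 = 0 := by
      by_contra h
      have := innerForm_lt_outerForm_of_fst_ne ha hab le_rfl h
      linarith
    obtain ⟨p, q⟩ := v
    obtain rfl : p = 0 := h0
    have hone := (forms_axis_three ha (τ := 1) (by norm_num)).1
    rw [(innerForm_eq_outerForm_axis ha _).1] at hi hone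
    have : q ^ 2 = crossSnd a (3 * a) ^ 2 := by
      have hne : (3 * a) ^ 2 ≠ 0 := by positivity
      apply mul_left_cancel₀ hne
      linarith
    rcases sq_eq_sq_iff_eq_or_eq_neg.1 this with rfl | rfl
    · left; rw [one_mul]
    · right; rw [Set.mem_singleton_iff, neg_one_mul]
  · have key : ∀ τ : ℝ, τ ^ 2 = 1 → lift a (3 * a) (0, τ * crossSnd a (3 * a)) ∈
        innerCurve a (3 * a) ∩ outerCurve a (3 * a) := fun τ hτ =>
      ⟨(mem_innerCurve_lift ha hab).2 (forms_axis_three ha hτ).1,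
        (mem_outerCurve_lift ha hab).2 (forms_axis_three ha hτ).2⟩
    rintro (rfl | rfl) <;> exact key _ (by norm_num)

theorem normalCount_pointE_three (ha : 0 < a) {σ τ : ℝ} (hσ : σ ^ 2 = 1) (hτ : τ ^ 2 = 1) :
    normalCount a (3 * a) (pointE a (3 * a) σ τ) = 2 := by
  rw [(special_points_three ha hτ hσ).2.1,
    (normalCount_pointG ha (by linarith) (by linarith) hτ).2.2, if_pos rfl]

theorem normalCount_outerCurve_three (ha : 0 < a) {A : Space} (hA : A ∈ outerCurve a (3 * a)) :
    normalCount a (3 * a) A = 2 := by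
  have hab : a < 3 * a := by linarith
  by_cases hi : A ∈ innerCurve a (3 * a)
  · have : A ∈ innerCurve a (3 * a) ∩ outerCurve a (3 * a) := ⟨hi, hA⟩
    rw [curves_inter_three ha] at this
    rcases this with rfl | rfl <;> exact normalCount_pointE_three ha (by norm_num) (by norm_num)
  · obtain ⟨v, ho, rfl⟩ := exists_lift_outerCurve ha hab hA
    rw [mem_innerCurve_lift ha hab] at hi
    have hlt := lt_of_le_of_ne (ho ▸ innerForm_le_outerForm ha v) hi
    exact (normalCount_of_outer ha hab
      (ne_pointG_of_fst ha hab (fst_ne_zero_of_lt ha (ho ▸ hlt))) ho).1 hlt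

end SpecialPoints

/-! ### The four cases -/

section Cases

variable {a b : ℝ}

theorem case_le_two (ha : 0 < a) (hab : a < b) (h2 : b ≤ 2 * a) :
    innerCurve a b = ∅ ∧ IsCurve (outerCurve a b) ∧ IsConnected (outerCurve a b) ∧
      (∃ R₁ R₂ : Set Space, R₁ ≠ R₂ ∧ regions a b = {R₁, R₂} ∧
        IsRegionWith a b R₁ (Lower a b) 1 ∧
        IsRegionWith a b R₂
          (fun A => Below A (innerCaustic a b) ∧ Above A (outerCaustic a b)) 3) ∧
      (∀ A ∈ outerCurve a b, normalCount a b A = 2) := by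
  have hlt : ∀ v, innerForm a b v < 1 := fun v => (innerForm_nonpos ha hab h2).trans_lt one_pos
  refine ⟨?_, isCurve_outerCurve ha hab, isConnected_outerCurve ha hab,
    regions_of_le_two ha hab h2, fun A hA => ?_⟩
  · rw [Set.eq_empty_iff_forall_notMem]
    intro A hA
    obtain ⟨v, hi, -⟩ := exists_lift_innerCurve ha hab hA
    exact (hlt v).ne hi
  · obtain ⟨v, ho, rfl⟩ := exists_lift_outerCurve ha hab hA
    exact (normalCount_of_outer ha hab (fun h => absurd h h2.not_gt) ho).1 (hlt v)

theorem case_two_lt_three (ha : 0 < a) (hab : a < b) (h2 : 2 * a < b) (h3 : b < 3 * a) :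
    IsCurve (innerCurve a b) ∧ IsCurve (outerCurve a b) ∧
      (regions a b).ncard = 4 ∧ RegionsOneThreeFive a b ∧
      (∀ A ∈ outerCurve a b, Below A (innerCaustic a b) ∧ normalCount a b A = 2) ∧
      (∀ A ∈ innerCurve a b, Above A (outerCaustic a b)) ∧
      (∀ A ∈ innerCurve a b, A ≠ pointG a b 1 → A ≠ pointG a b (-1) →
        normalCount a b A = 4) ∧
      pointG a b 1 ∈ innerCurve a b ∧ pointG a b (-1) ∈ innerCurve a b ∧
      normalCount a b (pointG a b 1) = 3 ∧ normalCount a b (pointG a b (-1)) = 3 := by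
  have hb := ha.trans hab
  obtain ⟨r1, r2⟩ := regions_of_lt_three ha hab h2 h3
  have hne : ∀ v : ℝ × ℝ, v ≠ 0 → innerForm a b v < outerForm a b v := fun v hv =>
    innerForm_lt_outerForm ha hab h3 hv
  have hlt : ∀ v : ℝ × ℝ, innerForm a b v = 1 ∨ outerForm a b v = 1 →
      innerForm a b v < outerForm a b v := fun v hv => hne v (by
    rintro rfl
    rw [(forms_zero ha hab).1, (forms_zero ha hab).2] at hv
    norm_num at hv)
  have hG : ∀ τ : ℝ, τ ^ 2 = 1 →
      pointG a b τ ∈ innerCurve a b ∧ normalCount a b (pointG a b τ) = 3 := fun τ hτ => by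
    obtain ⟨g1, -, g3⟩ := normalCount_pointG ha hab h2 hτ
    refine ⟨?_, by rw [g3, if_neg h3.ne]⟩
    rw [pointG_eq_lift ha hb h2 hτ, mem_innerCurve_lift ha hab, innerForm,
      innerEnvelope_axis_of_le ha hab h3.le, g1]
  refine ⟨isCurve_innerCurve ha hab h2, isCurve_outerCurve ha hab, r1, r2, fun A hA => ?_,
    fun A hA => ?_, fun A hA h1 h1' => ?_, (hG 1 (by norm_num)).1, (hG (-1) (by norm_num)).1,
    (hG 1 (by norm_num)).2, (hG (-1) (by norm_num)).2⟩
  · obtain ⟨v, ho, rfl⟩ := exists_lift_outerCurve ha hab hA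
    have hi : innerForm a b v < 1 := ho ▸ hlt v (Or.inr ho)
    refine ⟨(describesCaustic_inner ha hab).below _ hi,
      (normalCount_of_outer ha hab (fun _ => ⟨fun h => ?_, fun h => ?_⟩) ho).1 hi⟩
    · have := (hG 1 (by norm_num)).1
      rw [← h, mem_innerCurve_lift ha hab] at this
      exact hi.ne this
    · have := (hG (-1) (by norm_num)).1
      rw [← h, mem_innerCurve_lift ha hab] at this
      exact hi.ne this
  · obtain ⟨v, hi, rfl⟩ := exists_lift_innerCurve ha hab hA
    exact (describesCaustic_outer ha hab).above _ (hi ▸ hlt v (Or.inl hi))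
  · obtain ⟨v, hi, rfl⟩ := exists_lift_innerCurve ha hab hA
    exact (normalCount_of_inner ha hab (fun _ => ⟨h1, h1'⟩) hi).2.2 (hi ▸ hlt v (Or.inl hi))

theorem case_eq_three (ha : 0 < a) :
    IsCurve (innerCurve a (3 * a)) ∧ IsCurve (outerCurve a (3 * a)) ∧
      innerCurve a (3 * a) ∩ outerCurve a (3 * a) =
        {pointE a (3 * a) 1 1, pointE a (3 * a) (-1) (-1)} ∧
      pointE a (3 * a) 1 1 ≠ pointE a (3 * a) (-1) (-1) ∧
      (∀ σ ∈ ({1, -1} : Set ℝ), ∀ τ ∈ ({1, -1} : Set ℝ),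
        pointE a (3 * a) σ τ = pointF (3 * a) τ ∧ pointE a (3 * a) σ τ = pointG a (3 * a) τ ∧
        pointE a (3 * a) σ τ = pointH a (3 * a) τ) ∧
      (regions a (3 * a)).ncard = 5 ∧ RegionsOneThreeFive a (3 * a) ∧
      (∀ A ∈ outerCurve a (3 * a), normalCount a (3 * a) A = 2) ∧
      (∀ A ∈ outerCurve a (3 * a) \ innerCurve a (3 * a), Below A (innerCaustic a (3 * a))) ∧
      (∀ A ∈ innerCurve a (3 * a) \ outerCurve a (3 * a),
        Above A (outerCaustic a (3 * a)) ∧ normalCount a (3 * a) A = 4) ∧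
      (∀ σ ∈ ({1, -1} : Set ℝ), ∀ τ ∈ ({1, -1} : Set ℝ),
        normalCount a (3 * a) (pointE a (3 * a) σ τ) = 2) := by
  have hab : a < 3 * a := by linarith
  have hq := crossSnd_pos ha hab
  obtain ⟨r1, r2⟩ := regions_of_eq_three ha
  refine ⟨isCurve_innerCurve ha hab (by linarith), isCurve_outerCurve ha hab,
    curves_inter_three ha, fun h => ?_,
    fun σ hσ τ hτ => special_points_three ha (sign_sq hτ) (sign_sq hσ), r1, r2,
    fun A hA => normalCount_outerCurve_three ha hA, ?_, ?_,
    fun σ hσ τ hτ => normalCount_pointE_three ha (sign_sq hσ) (sign_sq hτ)⟩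
  · rw [pointE_eq_lift ha hab (by norm_num) (by norm_num),
      pointE_eq_lift ha hab (by norm_num) (by norm_num)] at h
    have := congrArg Prod.snd (lift_injective _ _ h)
    simp only at this
    linarith
  · rintro A ⟨hA, hA'⟩
    obtain ⟨v, ho, rfl⟩ := exists_lift_outerCurve ha hab hA
    rw [mem_innerCurve_lift ha hab] at hA'
    exact (describesCaustic_inner ha hab).below _
      (lt_of_le_of_ne (ho ▸ innerForm_le_outerForm ha v) hA')
  · rintro A ⟨hA, hA'⟩
    obtain ⟨v, hi, rfl⟩ := exists_lift_innerCurve ha hab hA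
    rw [mem_outerCurve_lift ha hab] at hA'
    have hlt := lt_of_le_of_ne (hi ▸ innerForm_le_outerForm ha v) (Ne.symm hA')
    exact ⟨(describesCaustic_outer ha hab).above _ hlt, (normalCount_of_inner ha hab
      (ne_pointG_of_fst ha hab (fst_ne_zero_of_lt ha (hi ▸ hlt))) hi).2.2 hlt⟩

theorem case_three_lt (ha : 0 < a) (h3 : 3 * a < b) :
    IsCurve (innerCurve a b) ∧ IsCurve (outerCurve a b) ∧
      innerCurve a b ∩ outerCurve a b =
        {pointE a b 1 1, pointE a b (-1) (-1), pointE a b 1 (-1), pointE a b (-1) 1} ∧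
      (innerCurve a b ∩ outerCurve a b).ncard = 4 ∧
      (regions a b).ncard = 7 ∧ RegionsOneThreeFive a b ∧
      (∀ A ∈ innerCurve a b ∪ outerCurve a b, A ∉ innerCurve a b ∩ outerCurve a b →
        A ≠ pointG a b 1 → A ≠ pointG a b (-1) →
        (OnLowerPart a b A ∧ normalCount a b A = 2) ∨
          (OnUpperPart a b A ∧ normalCount a b A = 4)) ∧
      (∃ A ∈ innerCurve a b ∪ outerCurve a b, OnLowerPart a b A ∧ normalCount a b A = 2) ∧
      (∃ A ∈ innerCurve a b ∪ outerCurve a b, OnUpperPart a b A ∧ normalCount a b A = 4) ∧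
      (∀ σ ∈ ({1, -1} : Set ℝ), ∀ τ ∈ ({1, -1} : Set ℝ),
        normalCount a b (pointE a b σ τ) = 3) ∧
      (∀ τ ∈ ({1, -1} : Set ℝ), pointG a b τ ∈ outerCurve a b ∧
        OnUpperPart a b (pointG a b τ) ∧ normalCount a b (pointG a b τ) = 3) := by
  have hab : a < b := by linarith
  have h2 : 2 * a < b := by linarith
  have hb := ha.trans hab
  have hp := crossFst_pos ha h3
  have hq := crossSnd_pos ha hab
  have dI := describesCaustic_inner ha hab
  have dO := describesCaustic_outer ha hab
  obtain ⟨r1, r2⟩ := regions_of_three_lt ha h3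
  obtain ⟨i1, i2⟩ := curves_inter ha h3
  refine ⟨isCurve_innerCurve ha hab h2, isCurve_outerCurve ha hab, i1, i2, r1, r2, ?_, ?_, ?_,
    fun σ hσ τ hτ => normalCount_pointE ha h3 (sign_sq hσ) (sign_sq hτ), fun τ hτ => ?_⟩
  · rintro A hA hA' g1 g2
    rcases hA with hA | hA
    · obtain ⟨v, hi, rfl⟩ := exists_lift_innerCurve ha hab hA
      have hmem := (dI.mem_iff v).2 hi
      obtain ⟨c1, -, c3⟩ := normalCount_of_inner ha hab (fun _ => ⟨g1, g2⟩) hi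
      have ho : outerForm a b v ≠ 1 := fun h => hA' ⟨hA, (mem_outerCurve_lift ha hab).2 h⟩
      rcases lt_or_gt_of_ne ho with ho | ho
      · exact Or.inl ⟨Or.inl ⟨hmem, dO.below _ ho⟩, c1 ho⟩
      · exact Or.inr ⟨Or.inl ⟨hmem, dO.above _ ho⟩, c3 ho⟩
    · obtain ⟨v, ho, rfl⟩ := exists_lift_outerCurve ha hab hA
      have hmem := (dO.mem_iff v).2 ho
      obtain ⟨c1, c3⟩ := normalCount_of_outer ha hab (fun _ => ⟨g1, g2⟩) ho
      have hi : innerForm a b v ≠ 1 := fun h => hA' ⟨(mem_innerCurve_lift ha hab).2 h, hA⟩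
      rcases lt_or_gt_of_ne hi with hi | hi
      · exact Or.inl ⟨Or.inr ⟨hmem, dI.below _ hi⟩, c1 hi⟩
      · exact Or.inr ⟨Or.inr ⟨hmem, dI.above _ hi⟩, c3 hi⟩
  -- Witness on the lower part: the direction `(1, 0)` rescaled to the outer curve, where the inner
  -- form is smaller.
  · have hlt := innerForm_lt_outerForm_of_snd (v := (1, 0)) ha hab (by simp) rfl
    obtain ⟨hc, ho⟩ := exists_smul_eq_one (outerForm_smul a b)
      (outerForm_pos (v := (1, 0)) ha hab (by simp))
    set c := (Real.sqrt (outerForm a b (1, 0)))⁻¹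
    have hi : innerForm a b (c • (1, 0)) < 1 := by
      have := mul_lt_mul_of_pos_left hlt (by positivity : 0 < c ^ 2)
      rwa [← innerForm_smul ha hab, ← outerForm_smul, ho] at this
    exact ⟨_, Or.inr ((mem_outerCurve_lift ha hab).2 ho),
      Or.inr ⟨(dO.mem_iff _).2 ho, dI.below _ hi⟩,
      (normalCount_of_outer ha hab (ne_pointG_of_fst ha hab (by simpa using hc.ne')) ho).1 hi⟩
  -- Doubling the second coordinate of the crossing point enters the wedge around the `q`-axis while
  -- staying off the axis, so the rescaled point is on the upper part and is not a point `G`.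
  · have hlt : outerForm a b (crossFst a b, 2 * crossSnd a b) <
        innerForm a b (crossFst a b, 2 * crossSnd a b) :=
      outerForm_lt_innerForm_of_wedge ha h3 (by
        simp only
        have : 0 < (crossFst a b * crossSnd a b) ^ 2 := by positivity
        nlinarith)
    obtain ⟨hc, ho⟩ := exists_smul_eq_one (outerForm_smul a b)
      (outerForm_pos (v := (crossFst a b, 2 * crossSnd a b)) ha hab (by simp [hp.ne']))
    set c := (Real.sqrt (outerForm a b (crossFst a b, 2 * crossSnd a b)))⁻¹
    have hi : 1 < innerForm a b (c • (crossFst a b, 2 * crossSnd a b)) := by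
      have := mul_lt_mul_of_pos_left hlt (by positivity : 0 < c ^ 2)
      rwa [← innerForm_smul ha hab, ← outerForm_smul, ho] at this
    exact ⟨_, Or.inr ((mem_outerCurve_lift ha hab).2 ho),
      Or.inr ⟨(dO.mem_iff _).2 ho, dI.above _ hi⟩,
      (normalCount_of_outer ha hab
        (ne_pointG_of_fst ha hab (by simpa using ⟨hc.ne', hp.ne'⟩)) ho).2 hi⟩
  · obtain ⟨g1, g2, g3⟩ := normalCount_pointG ha hab h2 (sign_sq hτ)
    have ho : outerForm a b (0, τ * axisSnd a b) = 1 := by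
      rw [outerForm, outerEnvelope_axis_of_ge ha hab h3.le, g1]
    have hi : 1 < innerForm a b (0, τ * axisSnd a b) := by
      rw [innerForm, innerEnvelope_axis_of_ge ha hab h3.le]
      exact g2 h3.ne'
    refine ⟨?_, Or.inr ⟨?_, ?_⟩, by rw [g3, if_neg h3.ne']⟩ <;>
      rw [pointG_eq_lift ha hb h2 (sign_sq hτ)]
    · exact (mem_outerCurve_lift ha hab).2 ho
    · exact (dO.mem_iff _).2 ho
    · exact dI.above _ hi

end Cases

end Paraboloid

open Paraboloid in
theorem theorem7p1 (a b : ℝ) (ha : 0 < a) (hab : a < b) :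
    -- first case
    (b ≤ 2 * a →
      innerCurve a b = ∅ ∧ IsCurve (outerCurve a b) ∧ IsConnected (outerCurve a b) ∧
      (∃ R₁ R₂ : Set Space, R₁ ≠ R₂ ∧ regions a b = {R₁, R₂} ∧
        IsRegionWith a b R₁ (Lower a b) 1 ∧
        IsRegionWith a b R₂
          (fun A => Below A (innerCaustic a b) ∧ Above A (outerCaustic a b)) 3) ∧
      (∀ A ∈ outerCurve a b, normalCount a b A = 2)) ∧
    -- second case
    (2 * a < b → b < 3 * a →
      IsCurve (innerCurve a b) ∧ IsCurve (outerCurve a b) ∧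
      (regions a b).ncard = 4 ∧ RegionsOneThreeFive a b ∧
      (∀ A ∈ outerCurve a b, Below A (innerCaustic a b) ∧ normalCount a b A = 2) ∧
      (∀ A ∈ innerCurve a b, Above A (outerCaustic a b)) ∧
      (∀ A ∈ innerCurve a b, A ≠ pointG a b 1 → A ≠ pointG a b (-1) →
        normalCount a b A = 4) ∧
      pointG a b 1 ∈ innerCurve a b ∧ pointG a b (-1) ∈ innerCurve a b ∧
      normalCount a b (pointG a b 1) = 3 ∧ normalCount a b (pointG a b (-1)) = 3) ∧
    -- third case
    (b = 3 * a →
      IsCurve (innerCurve a b) ∧ IsCurve (outerCurve a b) ∧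
      innerCurve a b ∩ outerCurve a b = {pointE a b 1 1, pointE a b (-1) (-1)} ∧
      pointE a b 1 1 ≠ pointE a b (-1) (-1) ∧
      (∀ σ ∈ ({1, -1} : Set ℝ), ∀ τ ∈ ({1, -1} : Set ℝ),
        pointE a b σ τ = pointF b τ ∧ pointE a b σ τ = pointG a b τ ∧
        pointE a b σ τ = pointH a b τ) ∧
      (regions a b).ncard = 5 ∧ RegionsOneThreeFive a b ∧
      (∀ A ∈ outerCurve a b, normalCount a b A = 2) ∧
      (∀ A ∈ outerCurve a b \ innerCurve a b, Below A (innerCaustic a b)) ∧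
      (∀ A ∈ innerCurve a b \ outerCurve a b,
        Above A (outerCaustic a b) ∧ normalCount a b A = 4) ∧
      (∀ σ ∈ ({1, -1} : Set ℝ), ∀ τ ∈ ({1, -1} : Set ℝ),
        normalCount a b (pointE a b σ τ) = 2)) ∧
    -- fourth case
    (3 * a < b →
      IsCurve (innerCurve a b) ∧ IsCurve (outerCurve a b) ∧
      innerCurve a b ∩ outerCurve a b =
        {pointE a b 1 1, pointE a b (-1) (-1), pointE a b 1 (-1), pointE a b (-1) 1} ∧
      (innerCurve a b ∩ outerCurve a b).ncard = 4 ∧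
      (regions a b).ncard = 7 ∧ RegionsOneThreeFive a b ∧
      (∀ A ∈ innerCurve a b ∪ outerCurve a b, A ∉ innerCurve a b ∩ outerCurve a b →
        A ≠ pointG a b 1 → A ≠ pointG a b (-1) →
        (OnLowerPart a b A ∧ normalCount a b A = 2) ∨
          (OnUpperPart a b A ∧ normalCount a b A = 4)) ∧
      (∃ A ∈ innerCurve a b ∪ outerCurve a b, OnLowerPart a b A ∧ normalCount a b A = 2) ∧
      (∃ A ∈ innerCurve a b ∪ outerCurve a b, OnUpperPart a b A ∧ normalCount a b A = 4) ∧
      (∀ σ ∈ ({1, -1} : Set ℝ), ∀ τ ∈ ({1, -1} : Set ℝ),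
        normalCount a b (pointE a b σ τ) = 3) ∧
      (∀ τ ∈ ({1, -1} : Set ℝ), pointG a b τ ∈ outerCurve a b ∧
        OnUpperPart a b (pointG a b τ) ∧ normalCount a b (pointG a b τ) = 3)) := by
  refine ⟨case_le_two ha hab, case_two_lt_three ha hab, ?_, case_three_lt ha⟩
  rintro rfl
  exact case_eq_three ha
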